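/- Let $\mathbb{D}$ be a (pseudo) double category: objects and arrows form a category, while proarrows compose associatively and unitally up to coherent, invertible globular cells. Recall that a *companion* of an arrow $f : x \to y$ is a proarrow $f_!$ from $x$ to $y$ with cells (squares with proarrows on top and bottom and arrows on the sides) $\eta_f$ (top $\mathrm{id}_x$, bottom $f_!$, left side $1_x$, right side $f$) and $\varepsilon_f$ (top $f_!$, bottom $\mathrm{id}_y$, left side $f$, right side $1_y$) such that the composite of $\eta_f$ followed by $\varepsilon_f$ along arrows is the identity cell $\mathrm{id}_f$, and the composite of $\eta_f$ and $\varepsilon_f$ along proarrows is, up to unitors, the identity cell on $f_!$; a *conjoint* of $f$ is the dual notion, a proarrow $f^*$ from $y$ to $x$. Suppose that $\mathbb{D}$ is a *cartesian equipment*: every arrow of $\mathbb{D}$ has a companion and a conjoint, and the diagonal $\Delta : \mathbb{D} \to \mathbb{D} \times \mathbb{D}$ and the unique double functor $! : \mathbb{D} \to \mathbf{1}$ to the terminal double category have right adjoints in the 2-category of double categories, (pseudo) double functors and natural transformations. Then the underlying bicategory $\mathbf{D}$ of $\mathbb{D}$, formed by its objects, proarrows and globular cells, is a *cartesian bicategory*.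 That is, there exist 1. pseudofunctors $\otimes : \mathbf{D} \times \mathbf{D} \to \mathbf{D}$ and $I : \mathbf{1} \to \mathbf{D}$; 2. oplax natural transformations $\delta : 1_{\mathbf{D}} \Rightarrow \otimes \circ \Delta$, $\pi : \Delta \circ \otimes \Rightarrow 1_{\mathbf{D} \times \mathbf{D}}$ and $\varepsilon : 1_{\mathbf{D}} \Rightarrow I \circ {!}$ that are map-valued, meaning that each of their components has a right adjoint; 3. invertible modifications (triangulators), where composites are written in diagrammatic order, $$s : 1_\Delta \cong (\Delta * \delta) \cdot (\pi * \Delta), \qquad t : (\delta * \otimes) \cdot (\otimes * \pi) \cong 1_\otimes, \qquad u : (\varepsilon * I) \cdot (I * 1_{1_{\mathbf{1}}}) \cong 1_I,$$ such that $(\delta, \pi, s, t) : \Delta \dashv \otimes$ and $(\varepsilon, 1, 1, u) : {!} \dashv I$ are lax adjunctions. Here a lax adjunction $(\eta, \theta, s, t) : F \dashv G$ between pseudofunctors consists of oplax natural transformations $\eta : 1 \Rightarrow G F$ and $\theta : F G \Rightarrow 1$ (with comparison cells $\eta_f : f \cdot \eta_y \Rightarrow \eta_x \cdot G F f$, and similarly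 for $\theta$) and invertible modifications $s : 1_F \cong (F * \eta) \cdot (\theta * F)$ and $t : (\eta * G) \cdot (G * \theta) \cong 1_G$ satisfying the two swallowtail identities: for every $x$ the composite $$\eta_x \xrightarrow{t^{-1}_{Fx}} \eta_x \cdot \eta_{GFx} \cdot G\theta_{Fx} \xrightarrow{\eta_{\eta_x}} \eta_x \cdot GF\eta_x \cdot G\theta_{Fx} \xrightarrow{G s^{-1}_x} \eta_x$$ is the identity (up to coherence isomorphisms), and for every $y$ the composite $$\theta_y \xrightarrow{F t^{-1}_y} F\eta_{Gy} \cdot FG\theta_y \cdot \theta_y \xrightarrow{\theta_{\theta_y}} F\eta_{Gy} \cdot \theta_{FGy} \cdot \theta_y \xrightarrow{s^{-1}_{Gy}} \theta_y$$ is the identity (up to coherence isomorphisms). -/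

import Mathlib

open CategoryTheory Bicategory

universe c c₁ c₂ c₃ w w₁ w₂ w₃ v v₁ v₂ v₃ u u₁ u₂ u₃

namespace CartEquip

/-! ### Double categories -/

set_option linter.checkUnivs false in
/-- A (pseudo) double category. The arrows form a category `D`; `Pro x y` is the type of proarrows
from `x` to `y`; `Cell f m n g` is the type of cells with top `m`, bottom `n`, left side `f` and
right side `g`. Composition of cells along proarrows (`compCell`) is strictly associative and
unital; to avoid transports, it takes as arguments proofs that the sides compose as required.
External composition `compPro m n` of proarrows is in diagrammatic order, and is associative and
unital up to the coherent invertible globular cells `assocHom`, `leftHom`, `rightHom`. -/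
class DoubleCategory (D : Type u) extends Category.{v} D where
  /-- proarrows -/
  Pro : D → D → Type w
  /-- cells -/
  Cell {x y x' y' : D} (f : x ⟶ x') (m : Pro x y) (n : Pro x' y') (g : y ⟶ y') : Type c
  /-- the identity cell on a proarrow -/
  idCell {x y : D} (m : Pro x y) : Cell (𝟙 x) m m (𝟙 y)
  /-- composition of cells in the direction of arrows -/
  compCell {x y x' y' x'' y'' : D} {f : x ⟶ x'} {f' : x' ⟶ x''} {f'' : x ⟶ x''}
    {g : y ⟶ y'} {g' : y' ⟶ y''} {g'' : y ⟶ y''} {m : Pro x y} {n : Pro x' y'} {p : Pro x'' y''}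
    (hf : f ≫ f' = f'') (hg : g ≫ g' = g'') (α : Cell f m n g) (β : Cell f' n p g') :
    Cell f'' m p g''
  id_compCell {x y x' y' : D} {f : x ⟶ x'} {g : y ⟶ y'} {m : Pro x y} {n : Pro x' y'}
    (α : Cell f m n g) :
    compCell (Category.id_comp f) (Category.id_comp g) (idCell m) α = α
  compCell_id {x y x' y' : D} {f : x ⟶ x'} {g : y ⟶ y'} {m : Pro x y} {n : Pro x' y'}
    (α : Cell f m n g) :
    compCell (Category.comp_id f) (Category.comp_id g) α (idCell n) = α
  compCell_assoc {x y x' y' x'' y'' x''' y''' : D}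
    {f : x ⟶ x'} {f' : x' ⟶ x''} {f'' : x'' ⟶ x'''}
    {g : y ⟶ y'} {g' : y' ⟶ y''} {g'' : y'' ⟶ y'''}
    {m : Pro x y} {n : Pro x' y'} {p : Pro x'' y''} {q : Pro x''' y'''}
    (α : Cell f m n g) (β : Cell f' n p g') (γ : Cell f'' p q g'') :
    compCell (Category.assoc f f' f'') (Category.assoc g g' g'') (compCell rfl rfl α β) γ =
      compCell rfl rfl α (compCell rfl rfl β γ)
  /-- the external identity proarrow -/
  idPro (x : D) : Pro x x
  /-- external composition of proarrows -/
  compPro {x y z : D} (m : Pro x y) (n : Pro y z) : Pro x z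
  /-- the external identity cell on an arrow -/
  hid {x x' : D} (f : x ⟶ x') : Cell f (idPro x) (idPro x') f
  /-- external composition of cells -/
  hcomp {x y z x' y' z' : D} {f : x ⟶ x'} {g : y ⟶ y'} {h : z ⟶ z'} {m : Pro x y}
    {n : Pro y z} {m' : Pro x' y'} {n' : Pro y' z'} (α : Cell f m m' g) (β : Cell g n n' h) :
    Cell f (compPro m n) (compPro m' n') h
  hid_id (x : D) : hid (𝟙 x) = idCell (idPro x)
  hid_comp {x x' x'' : D} (f : x ⟶ x') (f' : x' ⟶ x'') :
    hid (f ≫ f') = compCell rfl rfl (hid f) (hid f')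
  hcomp_id {x y z : D} (m : Pro x y) (n : Pro y z) :
    hcomp (idCell m) (idCell n) = idCell (compPro m n)
  hcomp_comp {x y z x' y' z' x'' y'' z'' : D}
    {f : x ⟶ x'} {g : y ⟶ y'} {h : z ⟶ z'} {f' : x' ⟶ x''} {g' : y' ⟶ y''} {h' : z' ⟶ z''}
    {m : Pro x y} {n : Pro y z} {m' : Pro x' y'} {n' : Pro y' z'} {m'' : Pro x'' y''}
    {n'' : Pro y'' z''} (α : Cell f m m' g) (β : Cell g n n' h) (α' : Cell f' m' m'' g')
    (β' : Cell g' n' n'' h') :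
    hcomp (compCell rfl rfl α α') (compCell rfl rfl β β') =
      compCell rfl rfl (hcomp α β) (hcomp α' β')
  /-- the associator -/
  assocHom {x y z t : D} (m : Pro x y) (n : Pro y z) (p : Pro z t) :
    Cell (𝟙 x) (compPro (compPro m n) p) (compPro m (compPro n p)) (𝟙 t)
  /-- the inverse of the associator -/
  assocInv {x y z t : D} (m : Pro x y) (n : Pro y z) (p : Pro z t) :
    Cell (𝟙 x) (compPro m (compPro n p)) (compPro (compPro m n) p) (𝟙 t)
  assocHom_assocInv {x y z t : D} (m : Pro x y) (n : Pro y z) (p : Pro z t) :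
    compCell (Category.id_comp _) (Category.id_comp _) (assocHom m n p) (assocInv m n p) = idCell _
  assocInv_assocHom {x y z t : D} (m : Pro x y) (n : Pro y z) (p : Pro z t) :
    compCell (Category.id_comp _) (Category.id_comp _) (assocInv m n p) (assocHom m n p) = idCell _
  assocHom_naturality {x y z t x' y' z' t' : D} {f : x ⟶ x'} {g : y ⟶ y'} {h : z ⟶ z'}
    {k : t ⟶ t'} {m : Pro x y} {n : Pro y z} {p : Pro z t} {m' : Pro x' y'} {n' : Pro y' z'}
    {p' : Pro z' t'} (α : Cell f m m' g) (β : Cell g n n' h) (γ : Cell h p p' k) :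
    compCell (Category.comp_id f) (Category.comp_id k) (hcomp (hcomp α β) γ) (assocHom m' n' p') =
      compCell (Category.id_comp f) (Category.id_comp k) (assocHom m n p) (hcomp α (hcomp β γ))
  /-- the left unitor -/
  leftHom {x y : D} (m : Pro x y) : Cell (𝟙 x) (compPro (idPro x) m) m (𝟙 y)
  /-- the inverse of the left unitor -/
  leftInv {x y : D} (m : Pro x y) : Cell (𝟙 x) m (compPro (idPro x) m) (𝟙 y)
  leftHom_leftInv {x y : D} (m : Pro x y) :
    compCell (Category.id_comp _) (Category.id_comp _) (leftHom m) (leftInv m) = idCell _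
  leftInv_leftHom {x y : D} (m : Pro x y) :
    compCell (Category.id_comp _) (Category.id_comp _) (leftInv m) (leftHom m) = idCell _
  leftHom_naturality {x y x' y' : D} {f : x ⟶ x'} {g : y ⟶ y'} {m : Pro x y} {m' : Pro x' y'}
    (α : Cell f m m' g) :
    compCell (Category.comp_id f) (Category.comp_id g) (hcomp (hid f) α) (leftHom m') =
      compCell (Category.id_comp f) (Category.id_comp g) (leftHom m) α
  /-- the right unitor -/
  rightHom {x y : D} (m : Pro x y) : Cell (𝟙 x) (compPro m (idPro y)) m (𝟙 y)
  /-- the inverse of the right unitor -/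
  rightInv {x y : D} (m : Pro x y) : Cell (𝟙 x) m (compPro m (idPro y)) (𝟙 y)
  rightHom_rightInv {x y : D} (m : Pro x y) :
    compCell (Category.id_comp _) (Category.id_comp _) (rightHom m) (rightInv m) = idCell _
  rightInv_rightHom {x y : D} (m : Pro x y) :
    compCell (Category.id_comp _) (Category.id_comp _) (rightInv m) (rightHom m) = idCell _
  rightHom_naturality {x y x' y' : D} {f : x ⟶ x'} {g : y ⟶ y'} {m : Pro x y} {m' : Pro x' y'}
    (α : Cell f m m' g) :
    compCell (Category.comp_id f) (Category.comp_id g) (hcomp α (hid g)) (rightHom m') =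
      compCell (Category.id_comp f) (Category.id_comp g) (rightHom m) α
  pentagon {x y z t s : D} (m : Pro x y) (n : Pro y z) (p : Pro z t) (q : Pro t s) :
    compCell (Category.id_comp _) (Category.id_comp _) (hcomp (assocHom m n p) (idCell q))
        (compCell (Category.id_comp _) (Category.id_comp _) (assocHom m (compPro n p) q)
          (hcomp (idCell m) (assocHom n p q))) =
      compCell (Category.id_comp _) (Category.id_comp _) (assocHom (compPro m n) p q)
        (assocHom m n (compPro p q))
  triangle {x y z : D} (m : Pro x y) (n : Pro y z) :
    compCell (Category.id_comp _) (Category.id_comp _) (assocHom m (idPro y) n)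
        (hcomp (idCell m) (leftHom n)) =
      hcomp (rightHom m) (idCell n)

open DoubleCategory

section Basic

variable {D : Type u} [DoubleCategory.{c, w, v, u} D]

/-- Change of the sides of a cell along equalities of arrows. -/
def castCell {x y x' y' : D} {f f' : x ⟶ x'} {g g' : y ⟶ y'} {m : Pro x y} {n : Pro x' y'}
    (hf : f = f') (hg : g = g') (α : Cell f m n g) : Cell f' m n g' :=
  compCell ((Category.comp_id f).trans hf) ((Category.comp_id g).trans hg) α (idCell n)

theorem compCell_assoc' {x y x' y' x'' y'' x''' y''' : D}
    {f : x ⟶ x'} {f' : x' ⟶ x''} {f'' : x'' ⟶ x'''} {k : x ⟶ x''} {k' : x' ⟶ x'''} {l : x ⟶ x'''}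
    {g : y ⟶ y'} {g' : y' ⟶ y''} {g'' : y'' ⟶ y'''} {j : y ⟶ y''} {j' : y' ⟶ y'''} {r : y ⟶ y'''}
    {m : Pro x y} {n : Pro x' y'} {p : Pro x'' y''} {q : Pro x''' y'''}
    (hk : f ≫ f' = k) (hj : g ≫ g' = j) (hl : k ≫ f'' = l) (hr : j ≫ g'' = r)
    (hk' : f' ≫ f'' = k') (hj' : g' ≫ g'' = j') (hl' : f ≫ k' = l) (hr' : g ≫ j' = r)
    (α : Cell f m n g) (β : Cell f' n p g') (γ : Cell f'' p q g'') :
    compCell hl hr (compCell hk hj α β) γ = compCell hl' hr' α (compCell hk' hj' β γ) := by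
  subst hk hj hk' hj' hl' hr'
  exact compCell_assoc α β γ

theorem castCell_rfl {x y x' y' : D} {f : x ⟶ x'} {g : y ⟶ y'} {m : Pro x y} {n : Pro x' y'}
    (α : Cell f m n g) : castCell rfl rfl α = α :=
  compCell_id α

/-- The category of proarrows `x` to `y` and globular cells between them. -/
instance proCategory (x y : D) : Category.{c} (Pro x y) where
  Hom m n := Cell (𝟙 x) m n (𝟙 y)
  id m := idCell m
  comp α β := compCell (Category.id_comp (𝟙 x)) (Category.id_comp (𝟙 y)) α β
  id_comp α := id_compCell α
  comp_id α := compCell_id α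
  assoc α β γ := compCell_assoc' _ _ _ _ _ _ _ _ α β γ

theorem hcomp_comp' {x y z x' y' z' x'' y'' z'' : D}
    {f : x ⟶ x'} {g : y ⟶ y'} {h : z ⟶ z'} {f' : x' ⟶ x''} {g' : y' ⟶ y''} {h' : z' ⟶ z''}
    {f'' : x ⟶ x''} {g'' : y ⟶ y''} {h'' : z ⟶ z''}
    {m : Pro x y} {n : Pro y z} {m' : Pro x' y'} {n' : Pro y' z'} {m'' : Pro x'' y''}
    {n'' : Pro y'' z''} (hf : f ≫ f' = f'') (hg : g ≫ g' = g'') (hh : h ≫ h' = h'')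
    (α : Cell f m m' g) (β : Cell g n n' h) (α' : Cell f' m' m'' g') (β' : Cell g' n' n'' h') :
    hcomp (compCell hf hg α α') (compCell hg hh β β') =
      compCell hf hh (hcomp α β) (hcomp α' β') := by
  subst hf hg hh
  exact hcomp_comp α β α' β'

theorem compCell_castCell_left {x y x' y' x'' y'' : D} {f₀ f : x ⟶ x'} {f' : x' ⟶ x''}
    {f'' : x ⟶ x''} {g₀ g : y ⟶ y'} {g' : y' ⟶ y''} {g'' : y ⟶ y''} {m : Pro x y} {n : Pro x' y'}
    {p : Pro x'' y''} (hf₀ : f₀ = f) (hg₀ : g₀ = g) (hf : f ≫ f' = f'') (hg : g ≫ g' = g'')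
    (α : Cell f₀ m n g₀) (β : Cell f' n p g') :
    compCell hf hg (castCell hf₀ hg₀ α) β =
      compCell (hf₀ ▸ hf) (hg₀ ▸ hg) α β := by
  subst hf₀ hg₀
  rw [castCell_rfl]

theorem compCell_castCell_right {x y x' y' x'' y'' : D} {f : x ⟶ x'} {f₀ f' : x' ⟶ x''}
    {f'' : x ⟶ x''} {g : y ⟶ y'} {g₀ g' : y' ⟶ y''} {g'' : y ⟶ y''} {m : Pro x y} {n : Pro x' y'}
    {p : Pro x'' y''} (hf₀ : f₀ = f') (hg₀ : g₀ = g') (hf : f ≫ f' = f'') (hg : g ≫ g' = g'')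
    (α : Cell f m n g) (β : Cell f₀ n p g₀) :
    compCell hf hg α (castCell hf₀ hg₀ β) =
      compCell (hf₀ ▸ hf) (hg₀ ▸ hg) α β := by
  subst hf₀ hg₀
  rw [castCell_rfl]

theorem castCell_compCell {x y x' y' x'' y'' : D} {f : x ⟶ x'} {f' : x' ⟶ x''}
    {f₀ f'' : x ⟶ x''} {g : y ⟶ y'} {g' : y' ⟶ y''} {g₀ g'' : y ⟶ y''} {m : Pro x y} {n : Pro x' y'}
    {p : Pro x'' y''} (hf₀ : f₀ = f'') (hg₀ : g₀ = g'') (hf : f ≫ f' = f₀) (hg : g ≫ g' = g₀)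
    (α : Cell f m n g) (β : Cell f' n p g') :
    castCell hf₀ hg₀ (compCell hf hg α β) = compCell (hf.trans hf₀) (hg.trans hg₀) α β := by
  subst hf₀ hg₀
  rw [castCell_rfl]

theorem castCell_castCell {x y x' y' : D} {f f' f'' : x ⟶ x'} {g g' g'' : y ⟶ y'} {m : Pro x y}
    {n : Pro x' y'} (hf : f = f') (hg : g = g') (hf' : f' = f'') (hg' : g' = g'')
    (α : Cell f m n g) :
    castCell hf' hg' (castCell hf hg α) = castCell (hf.trans hf') (hg.trans hg') α := by
  subst hf hg hf' hg'
  simp only [castCell_rfl]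

theorem hcomp_castCell {x y z x' y' z' : D} {f f' : x ⟶ x'} {g g' : y ⟶ y'} {h h' : z ⟶ z'}
    {m : Pro x y} {n : Pro y z} {m' : Pro x' y'} {n' : Pro y' z'} (hf : f = f') (hg : g = g')
    (hh : h = h') (α : Cell f m m' g) (β : Cell g n n' h) :
    hcomp (castCell hf hg α) (castCell hg hh β) = castCell hf hh (hcomp α β) := by
  subst hf hg hh
  simp only [castCell_rfl]

/-- External composition of globular cells. -/
def ghcomp {x y z : D} {m m' : Pro x y} {n n' : Pro y z} (α : m ⟶ m') (β : n ⟶ n') :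
    compPro m n ⟶ compPro m' n' :=
  hcomp (D := D) α β

theorem ghcomp_comp {x y z : D} {m m' m'' : Pro x y} {n n' n'' : Pro y z}
    (α : m ⟶ m') (β : n ⟶ n') (α' : m' ⟶ m'') (β' : n' ⟶ n'') :
    ghcomp (α ≫ α') (β ≫ β') = ghcomp α β ≫ ghcomp α' β' :=
  hcomp_comp' _ _ _ _ _ _ _

theorem ghcomp_id {x y z : D} (m : Pro x y) (n : Pro y z) : ghcomp (𝟙 m) (𝟙 n) = 𝟙 _ :=
  hcomp_id m n

/-- The associator as an isomorphism of proarrows. -/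
def assocIso {x y z t : D} (m : Pro x y) (n : Pro y z) (p : Pro z t) :
    compPro (compPro m n) p ≅ compPro m (compPro n p) where
  hom := assocHom m n p
  inv := assocInv m n p
  hom_inv_id := assocHom_assocInv m n p
  inv_hom_id := assocInv_assocHom m n p

/-- The left unitor as an isomorphism of proarrows. -/
def leftIso {x y : D} (m : Pro x y) : compPro (idPro x) m ≅ m where
  hom := leftHom m
  inv := leftInv m
  hom_inv_id := leftHom_leftInv m
  inv_hom_id := leftInv_leftHom m

/-- The right unitor as an isomorphism of proarrows. -/
def rightIso {x y : D} (m : Pro x y) : compPro m (idPro y) ≅ m where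
  hom := rightHom m
  inv := rightInv m
  hom_inv_id := rightHom_rightInv m
  inv_hom_id := rightInv_rightHom m

theorem assocIso_naturality {x y z t : D} {m m' : Pro x y} {n n' : Pro y z} {p p' : Pro z t}
    (α : m ⟶ m') (β : n ⟶ n') (γ : p ⟶ p') :
    ghcomp (ghcomp α β) γ ≫ (assocIso m' n' p').hom =
      (assocIso m n p).hom ≫ ghcomp α (ghcomp β γ) :=
  assocHom_naturality (D := D) α β γ

theorem leftIso_naturality {x y : D} {m m' : Pro x y} (α : m ⟶ m') :
    ghcomp (𝟙 (idPro x)) α ≫ (leftIso m').hom = (leftIso m).hom ≫ α := by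
  have h := leftHom_naturality (D := D) (f := 𝟙 x) (g := 𝟙 y) (m := m) (m' := m') α
  rw [hid_id] at h
  exact h

theorem rightIso_naturality {x y : D} {m m' : Pro x y} (α : m ⟶ m') :
    ghcomp α (𝟙 (idPro y)) ≫ (rightIso m').hom = (rightIso m).hom ≫ α := by
  have h := rightHom_naturality (D := D) (f := 𝟙 x) (g := 𝟙 y) (m := m) (m' := m') α
  rw [hid_id] at h
  exact h

end Basic

/-! ### The underlying bicategory -/

/-- The type of objects of the underlying bicategory of a double category: a copy of `D`. -/
structure UnderlyingBicategory (D : Type u) : Type u where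
  /-- the underlying object of the double category -/
  as : D

/-- The underlying bicategory: objects, proarrows and globular cells. -/
instance underlyingBicategory (D : Type u) [DoubleCategory.{c, w, v, u} D] :
    Bicategory.{c, w} (UnderlyingBicategory D) where
  Hom x y := Pro x.as y.as
  id x := idPro x.as
  comp m n := compPro m n
  homCategory x y := proCategory x.as y.as
  whiskerLeft m _ _ β := ghcomp (𝟙 m) β
  whiskerRight α p := ghcomp α (𝟙 p)
  associator m n p := assocIso m n p
  leftUnitor m := leftIso m
  rightUnitor m := rightIso m
  whiskerLeft_id m n := ghcomp_id m n
  whiskerLeft_comp m _ _ _ β γ := by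
    have := ghcomp_comp (𝟙 m) β (𝟙 m) γ
    rwa [Category.comp_id] at this
  id_whiskerLeft β := by
    have := leftIso_naturality β
    rw [← Category.assoc, ← this, Category.assoc, Iso.hom_inv_id, Category.comp_id]
  comp_whiskerLeft m n _ _ β := by
    have := assocIso_naturality (𝟙 m) (𝟙 n) β
    rw [← Category.assoc, ← this, Category.assoc, Iso.hom_inv_id, Category.comp_id, ghcomp_id]
  id_whiskerRight m n := ghcomp_id m n
  comp_whiskerRight α β p := by
    have := ghcomp_comp α (𝟙 p) β (𝟙 p)
    rwa [Category.comp_id] at this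
  whiskerRight_id α := by
    have := rightIso_naturality α
    rw [← Category.assoc, ← this, Category.assoc, Iso.hom_inv_id, Category.comp_id]
  whiskerRight_comp α n p := by
    have := assocIso_naturality α (𝟙 n) (𝟙 p)
    rw [this, Iso.inv_hom_id_assoc, ghcomp_id]
  whisker_assoc m _ _ α p := by
    have := assocIso_naturality (𝟙 m) α (𝟙 p)
    rw [← Category.assoc, ← this, Category.assoc, Iso.hom_inv_id, Category.comp_id]
  whisker_exchange {_ _ _} m m' n n' α β := by
    have h₁ := ghcomp_comp (𝟙 m) β α (𝟙 n')
    have h₂ := ghcomp_comp α (𝟙 n) (𝟙 m') β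
    rw [Category.id_comp, Category.comp_id] at h₁ h₂
    rw [← h₁, ← h₂]
  pentagon m n p q := pentagon m n p q
  triangle m n := triangle m n

/-! ### Double functors, transformations, adjunctions -/

/-- A (pseudo) double functor. -/
structure DoubleFunctor (D : Type u₁) [DoubleCategory.{c₁, w₁, v₁, u₁} D]
    (E : Type u₂) [DoubleCategory.{c₂, w₂, v₂, u₂} E] extends D ⥤ E where
  /-- the action on proarrows -/
  mapPro {x y : D} (m : Pro x y) : Pro (obj x) (obj y)
  /-- the action on cells -/
  mapCell {x y x' y' : D} {f : x ⟶ x'} {m : Pro x y} {n : Pro x' y'} {g : y ⟶ y'}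
    (α : Cell f m n g) : Cell (map f) (mapPro m) (mapPro n) (map g)
  mapCell_id {x y : D} (m : Pro x y) :
    mapCell (idCell m) = castCell (map_id x).symm (map_id y).symm (idCell (mapPro m))
  mapCell_comp {x y x' y' x'' y'' : D} {f : x ⟶ x'} {f' : x' ⟶ x''} {g : y ⟶ y'} {g' : y' ⟶ y''}
    {m : Pro x y} {n : Pro x' y'} {p : Pro x'' y''} (α : Cell f m n g) (β : Cell f' n p g') :
    mapCell (compCell rfl rfl α β) =
      compCell (map_comp f f').symm (map_comp g g').symm (mapCell α) (mapCell β)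
  /-- the comparison for external composition -/
  mu {x y z : D} (m : Pro x y) (n : Pro y z) :
    compPro (mapPro m) (mapPro n) ≅ mapPro (compPro m n)
  /-- the comparison for external identities -/
  iota (x : D) : idPro (obj x) ≅ mapPro (idPro x)
  mu_naturality {x y z x' y' z' : D} {f : x ⟶ x'} {g : y ⟶ y'} {h : z ⟶ z'} {m : Pro x y}
    {n : Pro y z} {m' : Pro x' y'} {n' : Pro y' z'} (α : Cell f m m' g) (β : Cell g n n' h) :
    compCell (Category.comp_id _) (Category.comp_id _) (hcomp (mapCell α) (mapCell β))
        (mu m' n').hom =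
      compCell (Category.id_comp _) (Category.id_comp _) (mu m n).hom (mapCell (hcomp α β))
  iota_naturality {x x' : D} (f : x ⟶ x') :
    compCell (Category.comp_id _) (Category.comp_id _) (hid (map f)) (iota x').hom =
      compCell (Category.id_comp _) (Category.id_comp _) (iota x).hom (mapCell (hid f))
  mu_assoc {x y z t : D} (m : Pro x y) (n : Pro y z) (p : Pro z t) :
    ghcomp (mu m n).hom (𝟙 (mapPro p)) ≫ (mu (compPro m n) p).hom ≫
        (castCell (map_id x) (map_id t) (mapCell (assocIso m n p).hom) :
          mapPro (compPro (compPro m n) p) ⟶ mapPro (compPro m (compPro n p))) =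
      (assocIso (mapPro m) (mapPro n) (mapPro p)).hom ≫
        ghcomp (𝟙 (mapPro m)) (mu n p).hom ≫ (mu m (compPro n p)).hom
  mu_left {x y : D} (m : Pro x y) :
    ghcomp (iota x).hom (𝟙 (mapPro m)) ≫ (mu (idPro x) m).hom ≫
        (castCell (map_id x) (map_id y) (mapCell (leftIso m).hom) :
          mapPro (compPro (idPro x) m) ⟶ mapPro m) =
      (leftIso (mapPro m)).hom
  mu_right {x y : D} (m : Pro x y) :
    ghcomp (𝟙 (mapPro m)) (iota y).hom ≫ (mu m (idPro y)).hom ≫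
        (castCell (map_id x) (map_id y) (mapCell (rightIso m).hom) :
          mapPro (compPro m (idPro y)) ⟶ mapPro m) =
      (rightIso (mapPro m)).hom

namespace DoubleFunctor

variable {D : Type u₁} [DoubleCategory.{c₁, w₁, v₁, u₁} D]
  {E : Type u₂} [DoubleCategory.{c₂, w₂, v₂, u₂} E]
  {K : Type u₃} [DoubleCategory.{c₃, w₃, v₃, u₃} K]

theorem mapCell_comp' (F : DoubleFunctor D E)
    {x y x' y' x'' y'' : D} {f : x ⟶ x'} {f' : x' ⟶ x''} {f'' : x ⟶ x''}
    {g : y ⟶ y'} {g' : y' ⟶ y''} {g'' : y ⟶ y''}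
    {m : Pro x y} {n : Pro x' y'} {p : Pro x'' y''} (hf : f ≫ f' = f'') (hg : g ≫ g' = g'')
    (hf' : F.map f ≫ F.map f' = F.map f'') (hg' : F.map g ≫ F.map g' = F.map g'')
    (α : Cell f m n g) (β : Cell f' n p g') :
    F.mapCell (compCell hf hg α β) = compCell hf' hg' (F.mapCell α) (F.mapCell β) := by
  subst hf hg
  exact F.mapCell_comp α β

theorem mapCell_castCell (F : DoubleFunctor D E) {x y x' y' : D} {f f' : x ⟶ x'} {g g' : y ⟶ y'}
    {m : Pro x y} {n : Pro x' y'} (hf : f = f') (hg : g = g') (α : Cell f m n g) :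
    F.mapCell (castCell hf hg α) =
      castCell (congrArg F.map hf) (congrArg F.map hg) (F.mapCell α) := by
  subst hf hg
  simp only [castCell_rfl]

/-- The action of a double functor on globular cells. -/
def mapGlob (F : DoubleFunctor D E) {x y : D} {m n : Pro x y} (α : m ⟶ n) :
    F.mapPro m ⟶ F.mapPro n :=
  castCell (F.map_id x) (F.map_id y) (F.mapCell α)

theorem mapGlob_id (F : DoubleFunctor D E) {x y : D} (m : Pro x y) :
    F.mapGlob (𝟙 m) = 𝟙 (F.mapPro m) := by
  change castCell _ _ (F.mapCell (idCell m)) = idCell _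
  rw [F.mapCell_id, castCell_castCell, castCell_rfl]

theorem mapGlob_comp (F : DoubleFunctor D E) {x y : D} {m n p : Pro x y} (α : m ⟶ n)
    (β : n ⟶ p) : F.mapGlob (α ≫ β) = F.mapGlob α ≫ F.mapGlob β := by
  change castCell _ _ (F.mapCell (compCell _ _ α β)) =
    compCell _ _ (castCell _ _ (F.mapCell α)) (castCell _ _ (F.mapCell β))
  rw [F.mapCell_comp' _ _ (by simp) (by simp), castCell_compCell, compCell_castCell_left,
    compCell_castCell_right]

/-- The action of a double functor on globular isomorphisms. -/
def mapGlobIso (F : DoubleFunctor D E) {x y : D} {m n : Pro x y} (α : m ≅ n) :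
    F.mapPro m ≅ F.mapPro n where
  hom := F.mapGlob α.hom
  inv := F.mapGlob α.inv
  hom_inv_id := by rw [← mapGlob_comp, Iso.hom_inv_id, mapGlob_id]
  inv_hom_id := by rw [← mapGlob_comp, Iso.inv_hom_id, mapGlob_id]

theorem mapCell_mapGlob (F : DoubleFunctor D E) {x y x' y' : D} {f : x ⟶ x'} {g : y ⟶ y'}
    {m : Pro x y} {n n' : Pro x' y'} (α : Cell f m n g) (β : n ⟶ n') :
    compCell (Category.comp_id _) (Category.comp_id _) (F.mapCell α) (F.mapGlob β) =
      F.mapCell (compCell (Category.comp_id _) (Category.comp_id _) α β) := by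
  rw [F.mapCell_comp' _ _ (by simp) (by simp)]
  exact compCell_castCell_right _ _ _ _ _ _

theorem mapGlob_mapCell (F : DoubleFunctor D E) {x y x' y' : D} {f : x ⟶ x'} {g : y ⟶ y'}
    {m m' : Pro x y} {n : Pro x' y'} (β : m ⟶ m') (α : Cell f m' n g) :
    compCell (Category.id_comp _) (Category.id_comp _) (F.mapGlob β) (F.mapCell α) =
      F.mapCell (compCell (Category.id_comp _) (Category.id_comp _) β α) := by
  rw [F.mapCell_comp' _ _ (by simp) (by simp)]
  exact compCell_castCell_left _ _ _ _ _ _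

theorem ghcomp_mapGlob (F : DoubleFunctor D E) {x y z : D} {m m' : Pro x y} {n n' : Pro y z}
    (α : m ⟶ m') (β : n ⟶ n') :
    ghcomp (F.mapGlob α) (F.mapGlob β) ≫ (F.mu m' n').hom =
      (F.mu m n).hom ≫ F.mapGlob (ghcomp α β) := by
  have h := F.mu_naturality (f := 𝟙 x) (g := 𝟙 y) (h := 𝟙 z) α β
  have e : ghcomp (F.mapGlob α) (F.mapGlob β) =
      castCell (F.map_id x) (F.map_id z) (hcomp (F.mapCell (f := 𝟙 x) (g := 𝟙 y) α)
        (F.mapCell (f := 𝟙 y) (g := 𝟙 z) β)) :=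
    hcomp_castCell _ _ _ _ _
  have h₁ := congrArg (castCell (F.map_id x) (F.map_id z)) h
  rw [castCell_compCell, castCell_compCell] at h₁
  rw [e]
  exact (compCell_castCell_left _ _ _ _ _ _).trans
    (h₁.trans (compCell_castCell_right (F.map_id x) (F.map_id z) _ _ _ _).symm)

/-- The identity double functor. -/
def id (D : Type u₁) [DoubleCategory.{c₁, w₁, v₁, u₁} D] : DoubleFunctor D D where
  toFunctor := 𝟭 D
  mapPro m := m
  mapCell α := α
  mapCell_id m := (castCell_rfl _).symm
  mapCell_comp α β := rfl
  mu m n := Iso.refl _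
  iota x := Iso.refl _
  mu_naturality α β := (compCell_id _).trans (id_compCell _).symm
  iota_naturality f := (compCell_id _).trans (id_compCell _).symm
  mu_assoc m n p := by
    dsimp only [Iso.refl_hom]
    erw [castCell_rfl, ghcomp_id, ghcomp_id]
    simp
  mu_left m := by
    dsimp only [Iso.refl_hom]
    erw [castCell_rfl, ghcomp_id]
    simp
  mu_right m := by
    dsimp only [Iso.refl_hom]
    erw [castCell_rfl, ghcomp_id]
    simp

/-- Composition of double functors. -/
def comp (F : DoubleFunctor D E) (G : DoubleFunctor E K) : DoubleFunctor D K where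
  toFunctor := F.toFunctor ⋙ G.toFunctor
  mapPro m := G.mapPro (F.mapPro m)
  mapCell α := G.mapCell (F.mapCell α)
  mapCell_id m := by
    rw [F.mapCell_id, mapCell_castCell, G.mapCell_id, castCell_castCell]
  mapCell_comp α β := by
    rw [F.mapCell_comp]
    exact G.mapCell_comp' _ _ _ _ _ _
  mu m n := G.mu _ _ ≪≫ G.mapGlobIso (F.mu m n)
  iota x := G.iota _ ≪≫ G.mapGlobIso (F.iota x)
  mu_naturality {x y z x' y' z' f g h m n m' n'} α β := by
    have h₁ := G.mu_naturality (F.mapCell α) (F.mapCell β)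
    have h₂ := F.mu_naturality α β
    refine (compCell_assoc' (Category.comp_id _) (Category.comp_id _) (Category.comp_id _)
      (Category.comp_id _) _ _ _ _ _ _ _).symm.trans ?_
    refine Eq.trans ?_ (compCell_assoc' _ _ _ _ (Category.id_comp _) (Category.id_comp _)
      (Category.id_comp _) (Category.id_comp _) _ _ _).symm
    refine (congrArg (fun γ => compCell _ _ γ _) h₁).trans ?_
    refine (compCell_assoc' _ _ _ _ (Category.comp_id _) (Category.comp_id _)
      (Category.id_comp _) (Category.id_comp _) _ _ _).trans ?_
    refine congrArg (fun γ => compCell _ _ (G.mu (F.mapPro m) (F.mapPro n)).hom γ) ?_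
    refine (G.mapCell_mapGlob _ _).trans ?_
    refine Eq.trans ?_ (G.mapGlob_mapCell _ _).symm
    exact congrArg G.mapCell h₂
  iota_naturality {x x'} f := by
    have h₁ := G.iota_naturality (F.map f)
    have h₂ := F.iota_naturality f
    refine (compCell_assoc' (Category.comp_id _) (Category.comp_id _) (Category.comp_id _)
      (Category.comp_id _) _ _ _ _ _ _ _).symm.trans ?_
    refine Eq.trans ?_ (compCell_assoc' _ _ _ _ (Category.id_comp _) (Category.id_comp _)
      (Category.id_comp _) (Category.id_comp _) _ _ _).symm
    refine (congrArg (fun γ => compCell _ _ γ _) h₁).trans ?_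
    refine (compCell_assoc' _ _ _ _ (Category.comp_id _) (Category.comp_id _)
      (Category.id_comp _) (Category.id_comp _) _ _ _).trans ?_
    refine congrArg (fun γ => compCell _ _ (G.iota (F.obj x)).hom γ) ?_
    refine (G.mapCell_mapGlob _ _).trans ?_
    refine Eq.trans ?_ (G.mapGlob_mapCell _ _).symm
    exact congrArg G.mapCell h₂
  mu_assoc {x y z t} m n p := by
    have e : (castCell ((F.toFunctor ⋙ G.toFunctor).map_id x)
        ((F.toFunctor ⋙ G.toFunctor).map_id t)
        (G.mapCell (F.mapCell (f := 𝟙 x) (g := 𝟙 t) (assocIso m n p).hom)) :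
          G.mapPro (F.mapPro _) ⟶ G.mapPro (F.mapPro _)) =
        G.mapGlob (F.mapGlob (assocIso m n p).hom) := by
      refine Eq.symm ((congrArg (castCell _ _) (G.mapCell_castCell _ _ _)).trans ?_)
      exact castCell_castCell _ _ _ _ _
    have hF := congrArg G.mapGlob (F.mu_assoc m n p)
    have hG := G.mu_assoc (F.mapPro m) (F.mapPro n) (F.mapPro p)
    change _ ≫ _ ≫ G.mapGlob (assocIso _ _ _).hom = _ at hG
    change G.mapGlob (_ ≫ _ ≫ F.mapGlob _) = _ at hF
    simp only [mapGlob_comp] at hF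
    refine (congrArg (fun γ => _ ≫ _ ≫ γ) e).trans ?_
    dsimp only [Iso.trans_hom, mapGlobIso]
    have n₁ := G.ghcomp_mapGlob (F.mu m n).hom (𝟙 (F.mapPro p))
    have n₂ := G.ghcomp_mapGlob (𝟙 (F.mapPro m)) (F.mu n p).hom
    rw [mapGlob_id] at n₁ n₂
    have c₁ := ghcomp_comp (G.mu (F.mapPro m) (F.mapPro n)).hom (𝟙 (G.mapPro (F.mapPro p)))
      (G.mapGlob (F.mu m n).hom) (𝟙 (G.mapPro (F.mapPro p)))
    have c₂ := ghcomp_comp (𝟙 (G.mapPro (F.mapPro m))) (G.mu (F.mapPro n) (F.mapPro p)).hom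
      (𝟙 (G.mapPro (F.mapPro m))) (G.mapGlob (F.mu n p).hom)
    rw [Category.comp_id] at c₁ c₂
    calc _ = ghcomp (G.mu (F.mapPro m) (F.mapPro n)).hom (𝟙 (G.mapPro (F.mapPro p))) ≫
          (ghcomp (G.mapGlob (F.mu m n).hom) (𝟙 (G.mapPro (F.mapPro p))) ≫ (G.mu _ _).hom) ≫
          G.mapGlob (F.mu _ _).hom ≫ G.mapGlob (F.mapGlob (assocIso m n p).hom) := by
            refine (congrArg (fun γ => γ ≫ _) c₁).trans ?_
            simp only [Category.assoc]
      _ = ghcomp (G.mu (F.mapPro m) (F.mapPro n)).hom (𝟙 (G.mapPro (F.mapPro p))) ≫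
          (G.mu _ _).hom ≫ G.mapGlob (assocIso (F.mapPro m) (F.mapPro n) (F.mapPro p)).hom ≫
            G.mapGlob (ghcomp (𝟙 (F.mapPro m)) (F.mu n p).hom) ≫
              G.mapGlob (F.mu m (compPro n p)).hom := by
            rw [n₁, Category.assoc, hF]
      _ = (assocIso _ _ _).hom ≫
          ghcomp (𝟙 (G.mapPro (F.mapPro m))) (G.mu (F.mapPro n) (F.mapPro p)).hom ≫
          ((G.mu _ _).hom ≫ G.mapGlob (ghcomp (𝟙 (F.mapPro m)) (F.mu n p).hom)) ≫
              G.mapGlob (F.mu m (compPro n p)).hom := by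
            rw [reassoc_of% hG, Category.assoc]
      _ = _ := by
            rw [← n₂]
            refine Eq.trans ?_ (congrArg (fun γ => _ ≫ γ ≫ _) c₂.symm)
            simp only [Category.assoc]
  mu_left {x y} m := by
    have e : (castCell ((F.toFunctor ⋙ G.toFunctor).map_id x)
        ((F.toFunctor ⋙ G.toFunctor).map_id y)
        (G.mapCell (F.mapCell (f := 𝟙 x) (g := 𝟙 y) (leftIso m).hom)) :
          G.mapPro (F.mapPro _) ⟶ G.mapPro (F.mapPro _)) =
        G.mapGlob (F.mapGlob (leftIso m).hom) := by
      refine Eq.symm ((congrArg (castCell _ _) (G.mapCell_castCell _ _ _)).trans ?_)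
      exact castCell_castCell _ _ _ _ _
    have hF := congrArg G.mapGlob (F.mu_left m)
    have hG := G.mu_left (F.mapPro m)
    change _ ≫ _ ≫ G.mapGlob (leftIso _).hom = _ at hG
    change G.mapGlob (_ ≫ _ ≫ F.mapGlob _) = _ at hF
    simp only [mapGlob_comp] at hF
    refine (congrArg (fun (γ : G.mapPro (F.mapPro (compPro (idPro x) m)) ⟶ G.mapPro (F.mapPro m)) =>
      _ ≫ _ ≫ γ) e).trans ?_
    dsimp only [Iso.trans_hom, mapGlobIso]
    have n₁ := G.ghcomp_mapGlob (F.iota x).hom (𝟙 (F.mapPro m))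
    rw [mapGlob_id] at n₁
    have c₁ := ghcomp_comp (G.iota (F.obj x)).hom (𝟙 (G.mapPro (F.mapPro m)))
      (G.mapGlob (F.iota x).hom) (𝟙 (G.mapPro (F.mapPro m)))
    rw [Category.comp_id] at c₁
    calc _ = ghcomp (G.iota (F.obj x)).hom (𝟙 (G.mapPro (F.mapPro m))) ≫
          (ghcomp (G.mapGlob (F.iota x).hom) (𝟙 (G.mapPro (F.mapPro m))) ≫ (G.mu _ _).hom) ≫
          G.mapGlob (F.mu _ _).hom ≫ G.mapGlob (F.mapGlob (leftIso m).hom) := by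
            refine (congrArg (fun γ => γ ≫ _) c₁).trans ?_
            simp only [Category.assoc]
      _ = _ := by
            rw [n₁, Category.assoc, hF]
            exact hG
  mu_right {x y} m := by
    have e : (castCell ((F.toFunctor ⋙ G.toFunctor).map_id x)
        ((F.toFunctor ⋙ G.toFunctor).map_id y)
        (G.mapCell (F.mapCell (f := 𝟙 x) (g := 𝟙 y) (rightIso m).hom)) :
          G.mapPro (F.mapPro _) ⟶ G.mapPro (F.mapPro _)) =
        G.mapGlob (F.mapGlob (rightIso m).hom) := by
      refine Eq.symm ((congrArg (castCell _ _) (G.mapCell_castCell _ _ _)).trans ?_)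
      exact castCell_castCell _ _ _ _ _
    have hF := congrArg G.mapGlob (F.mu_right m)
    have hG := G.mu_right (F.mapPro m)
    change _ ≫ _ ≫ G.mapGlob (rightIso _).hom = _ at hG
    change G.mapGlob (_ ≫ _ ≫ F.mapGlob _) = _ at hF
    simp only [mapGlob_comp] at hF
    refine (congrArg (fun γ => _ ≫ _ ≫ γ) e).trans ?_
    dsimp only [Iso.trans_hom, mapGlobIso]
    have n₁ := G.ghcomp_mapGlob (𝟙 (F.mapPro m)) (F.iota y).hom
    rw [mapGlob_id] at n₁
    have c₁ := ghcomp_comp (𝟙 (G.mapPro (F.mapPro m))) (G.iota (F.obj y)).hom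
      (𝟙 (G.mapPro (F.mapPro m))) (G.mapGlob (F.iota y).hom)
    rw [Category.comp_id] at c₁
    calc _ = ghcomp (𝟙 (G.mapPro (F.mapPro m))) (G.iota (F.obj y)).hom ≫
          (ghcomp (𝟙 (G.mapPro (F.mapPro m))) (G.mapGlob (F.iota y).hom) ≫ (G.mu _ _).hom) ≫
          G.mapGlob (F.mu _ _).hom ≫ G.mapGlob (F.mapGlob (rightIso m).hom) := by
            refine (congrArg (fun γ => γ ≫ _) c₁).trans ?_
            simp only [Category.assoc]
      _ = _ := by
            rw [n₁, Category.assoc, hF]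
            exact hG

end DoubleFunctor

/-- A natural transformation between double functors: its components at objects are arrows, and
its components at proarrows are cells. -/
structure DoubleTrans {D : Type u₁} [DoubleCategory.{c₁, w₁, v₁, u₁} D]
    {E : Type u₂} [DoubleCategory.{c₂, w₂, v₂, u₂} E] (F G : DoubleFunctor D E)
    extends NatTrans F.toFunctor G.toFunctor where
  /-- the component at a proarrow -/
  cell {x y : D} (m : Pro x y) : Cell (app x) (F.mapPro m) (G.mapPro m) (app y)
  cell_naturality {x y x' y' : D} {f : x ⟶ x'} {m : Pro x y} {n : Pro x' y'} {g : y ⟶ y'}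
    (α : Cell f m n g) :
    compCell (naturality f) (naturality g) (F.mapCell α) (cell n) =
      compCell rfl rfl (cell m) (G.mapCell α)
  cell_comp {x y z : D} (m : Pro x y) (n : Pro y z) :
    compCell (Category.comp_id _) (Category.comp_id _) (hcomp (cell m) (cell n)) (G.mu m n).hom =
      compCell (Category.id_comp _) (Category.id_comp _) (F.mu m n).hom (cell (compPro m n))
  cell_id (x : D) :
    compCell (Category.comp_id _) (Category.comp_id _) (hid (app x)) (G.iota x).hom =
      compCell (Category.id_comp _) (Category.id_comp _) (F.iota x).hom (cell (idPro x))

/-- A double adjunction between pseudo double functors: an adjunction in the 2-category of double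
categories, double functors and natural transformations, presented by unit and counit. The
triangle identities are stated at objects and at proarrows. -/
structure DoubleAdjunction {D : Type u₁} [DoubleCategory.{c₁, w₁, v₁, u₁} D]
    {E : Type u₂} [DoubleCategory.{c₂, w₂, v₂, u₂} E]
    (F : DoubleFunctor D E) (G : DoubleFunctor E D) where
  /-- the unit -/
  unit : DoubleTrans (DoubleFunctor.id D) (F.comp G)
  /-- the counit -/
  counit : DoubleTrans (G.comp F) (DoubleFunctor.id E)
  left_app (x : D) : F.map (unit.app x) ≫ counit.app (F.obj x) = 𝟙 (F.obj x)
  left_cell {x y : D} (m : Pro x y) :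
    compCell (left_app x) (left_app y) (F.mapCell (unit.cell m)) (counit.cell (F.mapPro m)) =
      idCell (F.mapPro m)
  right_app (x : E) : unit.app (G.obj x) ≫ G.map (counit.app x) = 𝟙 (G.obj x)
  right_cell {x y : E} (m : Pro x y) :
    compCell (right_app x) (right_app y) (unit.cell (G.mapPro m)) (G.mapCell (counit.cell m)) =
      idCell (G.mapPro m)

/-! ### Product and terminal double categories -/

/-- The product of two double categories, with all structure componentwise. -/
instance prodDouble (D : Type u₁) [DoubleCategory.{c₁, w₁, v₁, u₁} D]
    (E : Type u₂) [DoubleCategory.{c₂, w₂, v₂, u₂} E] :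
    DoubleCategory.{max c₁ c₂, max w₁ w₂, max v₁ v₂, max u₁ u₂} (D × E) where
  toCategory := CategoryTheory.prod' D E
  Pro x y := Pro x.1 y.1 × Pro x.2 y.2
  Cell f m n g := Cell f.1 m.1 n.1 g.1 × Cell f.2 m.2 n.2 g.2
  idCell m := (idCell m.1, idCell m.2)
  compCell hf hg α β :=
    (compCell (congrArg (fun k => k.1) hf) (congrArg (fun k => k.1) hg) α.1 β.1,
      compCell (congrArg (fun k => k.2) hf) (congrArg (fun k => k.2) hg) α.2 β.2)
  id_compCell α := Prod.ext (id_compCell α.1) (id_compCell α.2)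
  compCell_id α := Prod.ext (compCell_id α.1) (compCell_id α.2)
  compCell_assoc α β γ :=
    Prod.ext (compCell_assoc α.1 β.1 γ.1) (compCell_assoc α.2 β.2 γ.2)
  idPro x := (idPro x.1, idPro x.2)
  compPro m n := (compPro m.1 n.1, compPro m.2 n.2)
  hid f := (hid f.1, hid f.2)
  hcomp α β := (hcomp α.1 β.1, hcomp α.2 β.2)
  hid_id x := Prod.ext (hid_id x.1) (hid_id x.2)
  hid_comp f f' := Prod.ext (hid_comp f.1 f'.1) (hid_comp f.2 f'.2)
  hcomp_id m n := Prod.ext (hcomp_id m.1 n.1) (hcomp_id m.2 n.2)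
  hcomp_comp α β α' β' :=
    Prod.ext (hcomp_comp α.1 β.1 α'.1 β'.1) (hcomp_comp α.2 β.2 α'.2 β'.2)
  assocHom m n p := (assocHom m.1 n.1 p.1, assocHom m.2 n.2 p.2)
  assocInv m n p := (assocInv m.1 n.1 p.1, assocInv m.2 n.2 p.2)
  assocHom_assocInv m n p :=
    Prod.ext (assocHom_assocInv m.1 n.1 p.1) (assocHom_assocInv m.2 n.2 p.2)
  assocInv_assocHom m n p :=
    Prod.ext (assocInv_assocHom m.1 n.1 p.1) (assocInv_assocHom m.2 n.2 p.2)
  assocHom_naturality α β γ :=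
    Prod.ext (assocHom_naturality α.1 β.1 γ.1) (assocHom_naturality α.2 β.2 γ.2)
  leftHom m := (leftHom m.1, leftHom m.2)
  leftInv m := (leftInv m.1, leftInv m.2)
  leftHom_leftInv m := Prod.ext (leftHom_leftInv m.1) (leftHom_leftInv m.2)
  leftInv_leftHom m := Prod.ext (leftInv_leftHom m.1) (leftInv_leftHom m.2)
  leftHom_naturality α := Prod.ext (leftHom_naturality α.1) (leftHom_naturality α.2)
  rightHom m := (rightHom m.1, rightHom m.2)
  rightInv m := (rightInv m.1, rightInv m.2)
  rightHom_rightInv m := Prod.ext (rightHom_rightInv m.1) (rightHom_rightInv m.2)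
  rightInv_rightHom m := Prod.ext (rightInv_rightHom m.1) (rightInv_rightHom m.2)
  rightHom_naturality α := Prod.ext (rightHom_naturality α.1) (rightHom_naturality α.2)
  pentagon m n p q := Prod.ext (pentagon m.1 n.1 p.1 q.1) (pentagon m.2 n.2 p.2 q.2)
  triangle m n := Prod.ext (triangle m.1 n.1) (triangle m.2 n.2)

/-- The terminal double category: one object, one arrow, one proarrow, one cell. -/
instance terminalDouble : DoubleCategory.{0, 0, 0, 0} (Discrete PUnit.{1}) where
  toCategory := discreteCategory PUnit.{1}
  Pro _ _ := PUnit
  Cell _ _ _ _ := PUnit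
  idCell _ := ⟨⟩
  compCell _ _ _ _ := ⟨⟩
  id_compCell _ := rfl
  compCell_id _ := rfl
  compCell_assoc _ _ _ := rfl
  idPro _ := ⟨⟩
  compPro _ _ := ⟨⟩
  hid _ := ⟨⟩
  hcomp _ _ := ⟨⟩
  hid_id _ := rfl
  hid_comp _ _ := rfl
  hcomp_id _ _ := rfl
  hcomp_comp _ _ _ _ := rfl
  assocHom _ _ _ := ⟨⟩
  assocInv _ _ _ := ⟨⟩
  assocHom_assocInv _ _ _ := rfl
  assocInv_assocHom _ _ _ := rfl
  assocHom_naturality _ _ _ := rfl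
  leftHom _ := ⟨⟩
  leftInv _ := ⟨⟩
  leftHom_leftInv _ := rfl
  leftInv_leftHom _ := rfl
  leftHom_naturality _ := rfl
  rightHom _ := ⟨⟩
  rightInv _ := ⟨⟩
  rightHom_rightInv _ := rfl
  rightInv_rightHom _ := rfl
  rightHom_naturality _ := rfl
  pentagon _ _ _ _ := rfl
  triangle _ _ := rfl

/-- The diagonal double functor. -/
def diagDouble (D : Type u) [DoubleCategory.{c, w, v, u} D] : DoubleFunctor D (D × D) where
  obj x := (x, x)
  map f := (f, f)
  map_id _ := rfl
  map_comp _ _ := rfl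
  mapPro m := (m, m)
  mapCell α := (α, α)
  mapCell_id _ := Prod.ext (castCell_rfl _).symm (castCell_rfl _).symm
  mapCell_comp _ _ := rfl
  mu _ _ := Iso.refl _
  iota _ := Iso.refl _
  mu_naturality _ _ := (compCell_id _).trans (id_compCell _).symm
  iota_naturality _ := (compCell_id _).trans (id_compCell _).symm
  mu_assoc m n p := by
    dsimp only [Iso.refl_hom]
    erw [castCell_rfl, ghcomp_id, ghcomp_id]
    simp
    rfl
  mu_left m := by
    dsimp only [Iso.refl_hom]
    erw [castCell_rfl, ghcomp_id]
    simp
    rfl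
  mu_right m := by
    dsimp only [Iso.refl_hom]
    erw [castCell_rfl, ghcomp_id]
    simp
    rfl

/-- The unique double functor to the terminal double category. -/
def bangDouble (D : Type u) [DoubleCategory.{c, w, v, u} D] :
    DoubleFunctor D (Discrete PUnit.{1}) where
  obj _ := ⟨⟨⟩⟩
  map _ := 𝟙 _
  map_id _ := rfl
  map_comp _ _ := rfl
  mapPro _ := ⟨⟩
  mapCell _ := ⟨⟩
  mapCell_id _ := rfl
  mapCell_comp _ _ := rfl
  mu _ _ := Iso.refl _
  iota _ := Iso.refl _
  mu_naturality _ _ := rfl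
  iota_naturality _ := rfl
  mu_assoc _ _ _ := rfl
  mu_left _ := rfl
  mu_right _ := rfl

/-! ### Cartesian equipments -/

/-- A companion of an arrow. -/
structure Companion {D : Type u} [DoubleCategory.{c, w, v, u} D] {x y : D} (f : x ⟶ y) where
  /-- the companion proarrow -/
  pro : Pro x y
  /-- the unit cell -/
  unit : Cell (𝟙 x) (idPro x) pro f
  /-- the counit cell -/
  counit : Cell f pro (idPro y) (𝟙 y)
  hcomp_eq : hcomp unit counit =
    compCell (Category.id_comp _) (Category.id_comp _) (leftHom pro) (rightInv pro)
  comp_eq : compCell (Category.id_comp f) (Category.comp_id f) unit counit = hid f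

/-- A conjoint of an arrow. -/
structure Conjoint {D : Type u} [DoubleCategory.{c, w, v, u} D] {x y : D} (f : x ⟶ y) where
  /-- the conjoint proarrow -/
  pro : Pro y x
  /-- the unit cell -/
  unit : Cell f (idPro x) pro (𝟙 x)
  /-- the counit cell -/
  counit : Cell (𝟙 y) pro (idPro y) f
  hcomp_eq : hcomp counit unit =
    compCell (Category.id_comp _) (Category.id_comp _) (rightHom pro) (leftInv pro)
  comp_eq : compCell (Category.comp_id f) (Category.id_comp f) unit counit = hid f

/-- An equipment: a double category in which every arrow has a companion and a conjoint. -/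
structure IsEquipment (D : Type u) [DoubleCategory.{c, w, v, u} D] : Prop where
  companion {x y : D} (f : x ⟶ y) : Nonempty (Companion f)
  conjoint {x y : D} (f : x ⟶ y) : Nonempty (Conjoint f)

/-- A cartesian double category: the diagonal and the double functor to the terminal double
category have right adjoints (among pseudo double functors). -/
structure IsCartesianDouble (D : Type u) [DoubleCategory.{c, w, v, u} D] : Prop where
  product : ∃ P : DoubleFunctor (D × D) D, Nonempty (DoubleAdjunction (diagDouble D) P)
  terminal : ∃ T : DoubleFunctor (Discrete PUnit.{1}) D,
    Nonempty (DoubleAdjunction (bangDouble D) T)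

/-- A cartesian equipment: an equipment that is a cartesian double category. -/
structure IsCartesianEquipment (D : Type u) [DoubleCategory.{c, w, v, u} D] : Prop where
  isEquipment : IsEquipment D
  isCartesianDouble : IsCartesianDouble D

/-! ### Cartesian bicategories -/

section Bicat

variable {B : Type u₁} [Bicategory.{w₁, v₁} B] {C : Type u₂} [Bicategory.{w₂, v₂} C]

theorem post_naturality (K : B ⥤ᵖ C) {a b a' b' : B} {f g : a ⟶ b} {f' g' : a' ⟶ b'}
    {ta : a ⟶ a'} {tb : b ⟶ b'} (β : f ⟶ g) (β' : f' ⟶ g') (nf : f ≫ tb ⟶ ta ≫ f')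
    (ng : g ≫ tb ⟶ ta ≫ g') (h : β ▷ tb ≫ ng = nf ≫ ta ◁ β') :
    K.map₂ β ▷ K.map tb ≫ (K.mapComp g tb).inv ≫ K.map₂ ng ≫ (K.mapComp ta g').hom =
      ((K.mapComp f tb).inv ≫ K.map₂ nf ≫ (K.mapComp ta f').hom) ≫ K.map ta ◁ K.map₂ β' := by
  have h' := congrArg K.map₂ h
  simp only [PrelaxFunctor.map₂_comp, Pseudofunctor.map₂_whisker_right,
    Pseudofunctor.map₂_whisker_left, Category.assoc] at h'
  rw [← cancel_epi (K.mapComp f tb).hom, ← cancel_mono (K.mapComp ta g').inv]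
  simpa using h'

theorem post_id (K : B ⥤ᵖ C) {a a' : B} {f : a ⟶ a} {f' : a' ⟶ a'} {t : a ⟶ a'}
    (μ : f ⟶ 𝟙 a) (ν : f' ⟶ 𝟙 a') (n : f ≫ t ⟶ t ≫ f')
    {r : K.map f ⟶ 𝟙 (K.obj a)} {r' : K.map f' ⟶ 𝟙 (K.obj a')}
    (h : n ≫ t ◁ ν = μ ▷ t ≫ (λ_ t).hom ≫ (ρ_ t).inv)
    (hr' : r' = K.map₂ ν ≫ (K.mapId a').hom) (hr : r = K.map₂ μ ≫ (K.mapId a).hom) :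
    ((K.mapComp f t).inv ≫ K.map₂ n ≫ (K.mapComp t f').hom) ≫
        K.map t ◁ r' =
      r ▷ K.map t ≫ (λ_ (K.map t)).hom ≫ (ρ_ (K.map t)).inv := by
  subst hr hr'
  have h' := congrArg K.map₂ h
  simp only [PrelaxFunctor.map₂_comp, Pseudofunctor.map₂_whisker_right,
    Pseudofunctor.map₂_whisker_left, Category.assoc, Pseudofunctor.map₂_left_unitor] at h'
  have h2 := h' =≫ (K.mapComp t (𝟙 a')).hom
  simp only [Category.assoc, Iso.inv_hom_id, Category.comp_id] at h2
  simp only [whiskerLeft_comp, Category.assoc, reassoc_of% h2]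
  have e : K.map₂ (ρ_ t).inv ≫ (K.mapComp t (𝟙 a')).hom ≫ K.map t ◁ (K.mapId a').hom =
      (ρ_ (K.map t)).inv := by
    rw [← cancel_mono (ρ_ (K.map t)).hom]
    simp only [Category.assoc, Iso.inv_hom_id]
    rw [← Pseudofunctor.map₂_right_unitor, ← PrelaxFunctor.map₂_comp, Iso.inv_hom_id,
      PrelaxFunctor.map₂_id]
  simp [e]

theorem post_comp (K : B ⥤ᵖ C) {a b c a' b' c' : B} {f : a ⟶ b} {g : b ⟶ c} {k : a ⟶ c}
    {f' : a' ⟶ b'} {g' : b' ⟶ c'} {k' : a' ⟶ c'} {ta : a ⟶ a'} {tb : b ⟶ b'} {tc : c ⟶ c'}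
    (μ : k ⟶ f ≫ g) (ν : k' ⟶ f' ≫ g') (nf : f ≫ tb ⟶ ta ≫ f') (ng : g ≫ tc ⟶ tb ≫ g')
    (nk : k ≫ tc ⟶ ta ≫ k')
    (h : nk ≫ ta ◁ ν = μ ▷ tc ≫ (α_ _ _ _).hom ≫ f ◁ ng ≫ (α_ _ _ _).inv ≫ nf ▷ g' ≫
      (α_ _ _ _).hom)
    {r : K.map k ⟶ K.map f ≫ K.map g} {r' : K.map k' ⟶ K.map f' ≫ K.map g'}
    (hr' : r' = K.map₂ ν ≫ (K.mapComp f' g').hom) (hr : r = K.map₂ μ ≫ (K.mapComp f g).hom) :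
    ((K.mapComp k tc).inv ≫ K.map₂ nk ≫ (K.mapComp ta k').hom) ≫
        K.map ta ◁ r' =
      r ▷ K.map tc ≫ (α_ _ _ _).hom ≫
        K.map f ◁ ((K.mapComp g tc).inv ≫ K.map₂ ng ≫ (K.mapComp tb g').hom) ≫ (α_ _ _ _).inv ≫
        ((K.mapComp f tb).inv ≫ K.map₂ nf ≫ (K.mapComp ta f').hom) ▷ K.map g' ≫
        (α_ _ _ _).hom := by
  subst hr hr'
  have h' := congrArg K.map₂ h
  simp only [PrelaxFunctor.map₂_comp, Pseudofunctor.map₂_whisker_right,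
    Pseudofunctor.map₂_whisker_left, Category.assoc, Pseudofunctor.map₂_associator] at h'
  have h2 := h' =≫ (K.mapComp ta (f' ≫ g')).hom
  simp only [Category.assoc, Iso.inv_hom_id, Category.comp_id] at h2
  simp only [whiskerLeft_comp, comp_whiskerRight, Category.assoc, reassoc_of% h2]
  have e : (K.mapComp f (tb ≫ g')).inv ≫ K.map₂ (α_ f tb g').inv ≫ (K.mapComp (f ≫ tb) g').hom =
      K.map f ◁ (K.mapComp tb g').hom ≫ (α_ _ _ _).inv ≫ (K.mapComp f tb).inv ▷ K.map g' := by
    rw [Iso.inv_comp_eq, reassoc_of% K.mapComp_assoc_right_hom f tb g']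
    simp
  simp [reassoc_of% e]

theorem pre_aux {a c a' c' : B} {k k₁ k₂ : a ⟶ c} {k' k₁' k₂' : a' ⟶ c'} {ta : a ⟶ a'}
    {tc : c ⟶ c'} {p : k ⟶ k₁} {q : k₁ ⟶ k₂} {r : k ⟶ k₂} {p' : k' ⟶ k₁'} {q' : k₁' ⟶ k₂'}
    {r' : k' ⟶ k₂'} {n : k ≫ tc ⟶ ta ≫ k'} {n₁ : k₁ ≫ tc ⟶ ta ≫ k₁'}
    {R : k₂ ≫ tc ⟶ ta ≫ k₂'} (h₁ : p ▷ tc ≫ n₁ = n ≫ ta ◁ p')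
    (h₂ : n₁ ≫ ta ◁ q' = q ▷ tc ≫ R) (hr' : r' = p' ≫ q') (hr : r = p ≫ q) :
    n ≫ ta ◁ r' = r ▷ tc ≫ R := by
  subst hr hr'
  rw [whiskerLeft_comp, ← reassoc_of% h₁, h₂, comp_whiskerRight, Category.assoc]

/-- An oplax natural transformation between pseudofunctors: components `app x : F x ⟶ G x` and
comparison 2-cells `F f ≫ app y ⟶ app x ≫ G f`. -/
abbrev OplaxNat (F G : B ⥤ᵖ C) := Oplax.OplaxTrans F.toOplax G.toOplax

/-- The whiskering `F * η : F ⟶ FGF` of `η : 1 ⟶ GF`. -/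
def postUnit {F : B ⥤ᵖ C} {G : C ⥤ᵖ B} (η : OplaxNat (Pseudofunctor.id B) (F.comp G)) :
    OplaxNat F (F.comp (G.comp F)) where
  app x := F.map (η.app x)
  naturality {x y} f := (F.mapComp f (η.app y)).inv ≫ F.map₂ (η.naturality f) ≫
    (F.mapComp (η.app x) (G.map (F.map f))).hom
  naturality_naturality β := post_naturality F β (G.map₂ (F.map₂ β)) _ _
    (η.naturality_naturality β)
  naturality_id x := post_id F (𝟙 (𝟙 x)) _ _ (η.naturality_id x)
    (by
      change F.map₂ (G.map₂ (F.mapId x).hom) ≫ F.map₂ (G.mapId (F.obj x)).hom ≫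
        (F.mapId (G.obj (F.obj x))).hom = F.map₂ (G.map₂ (F.mapId x).hom ≫
          (G.mapId (F.obj x)).hom) ≫ (F.mapId (G.obj (F.obj x))).hom
      rw [PrelaxFunctor.map₂_comp, Category.assoc])
    (by rw [PrelaxFunctor.map₂_id, Category.id_comp]; rfl)
  naturality_comp f g := post_comp F (𝟙 (f ≫ g)) _ _ _ _ (η.naturality_comp f g)
    (by
      change F.map₂ (G.map₂ (F.mapComp f g).hom) ≫ F.map₂ (G.mapComp (F.map f) (F.map g)).hom ≫
        (F.mapComp (G.map (F.map f)) (G.map (F.map g))).hom =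
          F.map₂ (G.map₂ (F.mapComp f g).hom ≫ (G.mapComp (F.map f) (F.map g)).hom) ≫
            (F.mapComp (G.map (F.map f)) (G.map (F.map g))).hom
      rw [PrelaxFunctor.map₂_comp, Category.assoc])
    (by rw [PrelaxFunctor.map₂_id, Category.id_comp]; rfl)

/-- The whiskering `θ * F : FGF ⟶ F` of `θ : FG ⟶ 1`. -/
def preCounit {F : B ⥤ᵖ C} {G : C ⥤ᵖ B} (θ : OplaxNat (G.comp F) (Pseudofunctor.id C)) :
    OplaxNat (F.comp (G.comp F)) F where
  app x := θ.app (F.obj x)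
  naturality f := θ.naturality (F.map f)
  naturality_naturality β := θ.naturality_naturality (F.map₂ β)
  naturality_id x := pre_aux (θ.naturality_naturality (F.mapId x).hom) (θ.naturality_id (F.obj x))
    (Category.comp_id _).symm rfl
  naturality_comp f g := pre_aux (θ.naturality_naturality (F.mapComp f g).hom)
    (θ.naturality_comp (F.map f) (F.map g)) (Category.comp_id _).symm rfl

/-- The whiskering `η * G : G ⟶ GFG` of `η : 1 ⟶ GF`. -/
def preUnit {F : B ⥤ᵖ C} {G : C ⥤ᵖ B} (η : OplaxNat (Pseudofunctor.id B) (F.comp G)) :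
    OplaxNat G (G.comp (F.comp G)) where
  app x := η.app (G.obj x)
  naturality f := η.naturality (G.map f)
  naturality_naturality β := η.naturality_naturality (G.map₂ β)
  naturality_id x := pre_aux (η.naturality_naturality (G.mapId x).hom) (η.naturality_id (G.obj x))
    rfl (Category.comp_id _).symm
  naturality_comp f g := pre_aux (η.naturality_naturality (G.mapComp f g).hom)
    (η.naturality_comp (G.map f) (G.map g)) rfl (Category.comp_id _).symm

/-- The whiskering `G * θ : GFG ⟶ G` of `θ : FG ⟶ 1`. -/
def postCounit {F : B ⥤ᵖ C} {G : C ⥤ᵖ B} (θ : OplaxNat (G.comp F) (Pseudofunctor.id C)) :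
    OplaxNat (G.comp (F.comp G)) G where
  app x := G.map (θ.app x)
  naturality {x y} f := (G.mapComp (F.map (G.map f)) (θ.app y)).inv ≫ G.map₂ (θ.naturality f) ≫
    (G.mapComp (θ.app x) f).hom
  naturality_naturality β := post_naturality G (F.map₂ (G.map₂ β)) β _ _
    (θ.naturality_naturality β)
  naturality_id x := post_id G _ (𝟙 (𝟙 x)) _ (θ.naturality_id x)
    (by rw [PrelaxFunctor.map₂_id, Category.id_comp]; rfl)
    (by
      change G.map₂ (F.map₂ (G.mapId x).hom) ≫ G.map₂ (F.mapId (G.obj x)).hom ≫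
        (G.mapId (F.obj (G.obj x))).hom = G.map₂ (F.map₂ (G.mapId x).hom ≫
          (F.mapId (G.obj x)).hom) ≫ (G.mapId (F.obj (G.obj x))).hom
      rw [PrelaxFunctor.map₂_comp, Category.assoc])
  naturality_comp f g := post_comp G _ (𝟙 (f ≫ g)) _ _ _ (θ.naturality_comp f g)
    (by rw [PrelaxFunctor.map₂_id, Category.id_comp]; rfl)
    (by
      change G.map₂ (F.map₂ (G.mapComp f g).hom) ≫ G.map₂ (F.mapComp (G.map f) (G.map g)).hom ≫
        (G.mapComp (F.map (G.map f)) (F.map (G.map g))).hom =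
          G.map₂ (F.map₂ (G.mapComp f g).hom ≫ (F.mapComp (G.map f) (G.map g)).hom) ≫
            (G.mapComp (F.map (G.map f)) (F.map (G.map g))).hom
      rw [PrelaxFunctor.map₂_comp, Category.assoc])

open scoped Oplax.OplaxTrans in
/-- A lax adjunction between pseudofunctors `F : B ⥤ᵖ C` and `G : C ⥤ᵖ B`, comprising oplax natural
transformations `η : 1 ⟶ GF` and `θ : FG ⟶ 1` (the unit and the counit), and invertible
modifications `s : 1 ≅ (F * η) ≫ (θ * F)` and `t : (η * G) ≫ (G * θ) ≅ 1` (the triangulators),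
subject to the two swallowtail identities. Each of these says that a pasting of the interchange
2-cell `η_η` (resp. `θ_θ`) with the triangulators (and the coherence isomorphisms) is an
identity. -/
structure LaxAdjunction (F : B ⥤ᵖ C) (G : C ⥤ᵖ B) where
  /-- the unit -/
  unit : OplaxNat (Pseudofunctor.id B) (F.comp G)
  /-- the counit -/
  counit : OplaxNat (G.comp F) (Pseudofunctor.id C)
  /-- the left triangulator -/
  s : Iso (C := F.toOplax ⟶ F.toOplax) (𝟙 F.toOplax) ((postUnit unit).vcomp (preCounit counit))
  /-- the right triangulator -/
  t : Iso (C := G.toOplax ⟶ G.toOplax) ((preUnit unit).vcomp (postCounit counit)) (𝟙 G.toOplax)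
  swallowtail_unit (x : B) :
    let ηx : x ⟶ G.obj (F.obj x) := unit.app x
    let ηGFx : G.obj (F.obj x) ⟶ G.obj (F.obj (G.obj (F.obj x))) := unit.app (G.obj (F.obj x))
    let θFx : F.obj (G.obj (F.obj x)) ⟶ F.obj x := counit.app (F.obj x)
    let ηη : ηx ≫ ηGFx ⟶ ηx ≫ G.map (F.map ηx) := unit.naturality ηx
    let sInv : F.map ηx ≫ θFx ⟶ 𝟙 (F.obj x) := s.inv.as.app x
    let tInv : 𝟙 (G.obj (F.obj x)) ⟶ ηGFx ≫ G.map θFx := t.inv.as.app (F.obj x)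
    (ρ_ ηx).inv ≫ ηx ◁ tInv ≫ (α_ ηx ηGFx (G.map θFx)).inv ≫ ηη ▷ G.map θFx ≫
        (α_ ηx (G.map (F.map ηx)) (G.map θFx)).hom ≫
        ηx ◁ ((G.mapComp (F.map ηx) θFx).inv ≫ G.map₂ sInv ≫ (G.mapId (F.obj x)).hom) ≫
        (ρ_ ηx).hom =
      𝟙 ηx
  swallowtail_counit (y : C) :
    let θy : F.obj (G.obj y) ⟶ y := counit.app y
    let θFGy : F.obj (G.obj (F.obj (G.obj y))) ⟶ F.obj (G.obj y) := counit.app (F.obj (G.obj y))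
    let ηGy : G.obj y ⟶ G.obj (F.obj (G.obj y)) := unit.app (G.obj y)
    let θθ : F.map (G.map θy) ≫ θy ⟶ θFGy ≫ θy := counit.naturality θy
    let sInv : F.map ηGy ≫ θFGy ⟶ 𝟙 (F.obj (G.obj y)) := s.inv.as.app (G.obj y)
    let tInv : 𝟙 (G.obj y) ⟶ ηGy ≫ G.map θy := t.inv.as.app y
    (λ_ θy).inv ≫ ((F.mapId (G.obj y)).inv ≫ F.map₂ tInv ≫ (F.mapComp ηGy (G.map θy)).hom) ▷ θy ≫
        (α_ (F.map ηGy) (F.map (G.map θy)) θy).hom ≫ F.map ηGy ◁ θθ ≫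
        (α_ (F.map ηGy) θFGy θy).inv ≫ sInv ▷ θy ≫ (λ_ θy).hom =
      𝟙 θy

/-- A 1-cell of a bicategory is a map if it has a right adjoint. -/
abbrev IsMap {x y : B} (f : x ⟶ y) : Prop := Bicategory.IsLeftAdjoint f

end Bicat

/-- The diagonal pseudofunctor of a bicategory. -/
def diagBicat (B : Type u) [Bicategory.{w, v} B] : B ⥤ᵖ (B × B) where
  obj x := (x, x)
  map f := (f, f)
  map₂ β := (β, β)
  map₂_id _ := rfl
  map₂_comp _ _ := rfl
  mapId _ := Iso.refl _
  mapComp _ _ := Iso.refl _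
  map₂_whisker_left f _ _ β := by
    refine Eq.symm ((Category.id_comp _).trans ?_)
    exact Category.comp_id _
  map₂_whisker_right β h := by
    refine Eq.symm ((Category.id_comp _).trans ?_)
    exact Category.comp_id _
  map₂_associator f g h := by
    refine Eq.symm ((Category.id_comp _).trans ?_)
    dsimp only [Iso.refl_hom, Iso.refl_inv]
    erw [id_whiskerRight, Category.id_comp, whiskerLeft_id, Category.comp_id, Category.comp_id]
    rfl
  map₂_left_unitor f := by
    refine Eq.symm ((Category.id_comp _).trans ?_)
    dsimp only [Iso.refl_hom]
    erw [id_whiskerRight, Category.id_comp]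
    rfl
  map₂_right_unitor f := by
    refine Eq.symm ((Category.id_comp _).trans ?_)
    dsimp only [Iso.refl_hom]
    erw [whiskerLeft_id, Category.id_comp]
    rfl

/-- The terminal bicategory. -/
abbrev TerminalBicat := LocallyDiscrete (Discrete PUnit.{1})

/-- The unique pseudofunctor to the terminal bicategory. -/
def bangBicat (B : Type u) [Bicategory.{w, v} B] : B ⥤ᵖ TerminalBicat where
  obj _ := ⟨⟨⟨⟩⟩⟩
  map _ := 𝟙 _
  map₂ _ := 𝟙 _
  map₂_id _ := rfl
  map₂_comp _ _ := (Category.id_comp _).symm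
  mapId _ := Iso.refl _
  mapComp _ _ := (λ_ _).symm
  map₂_whisker_left _ _ _ _ := Subsingleton.elim _ _
  map₂_whisker_right _ _ := Subsingleton.elim _ _
  map₂_associator _ _ _ := Subsingleton.elim _ _
  map₂_left_unitor _ := Subsingleton.elim _ _
  map₂_right_unitor _ := Subsingleton.elim _ _

/-- A cartesian structure on a bicategory `B`: pseudofunctors `⊗ : B × B ⥤ᵖ B` and `I : 1 ⥤ᵖ B`,
with lax adjunctions `(δ, π, s, t) : Δ ⊣ ⊗` and `(ε, 1, 1, u) : ! ⊣ I` whose transformations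
`δ`, `π`, `ε` are map-valued. (Since the only 1-cell and 2-cell of the terminal bicategory are
identities, the counit and the left triangulator of a lax adjunction `! ⊣ I` are automatically
identities.) -/
structure CartesianStructure (B : Type u) [Bicategory.{w, v} B] where
  /-- the tensor product -/
  tensor : (B × B) ⥤ᵖ B
  /-- the unit object -/
  unit : TerminalBicat ⥤ᵖ B
  /-- the lax adjunction `(δ, π, s, t) : Δ ⊣ ⊗` -/
  tensorAdj : LaxAdjunction (diagBicat B) tensor
  /-- the lax adjunction `(ε, 1, 1, u) : ! ⊣ I` -/
  unitAdj : LaxAdjunction (bangBicat B) unit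
  isMap_diag (x : B) : IsMap (tensorAdj.unit.app x)
  isMap_proj (x : B × B) : IsMap (tensorAdj.counit.app x)
  isMap_del (x : B) : IsMap (unitAdj.unit.app x)

/-- A bicategory is cartesian if it admits a cartesian structure. -/
def IsCartesianBicategory (B : Type u) [Bicategory.{w, v} B] : Prop :=
  Nonempty (CartesianStructure B)

end CartEquip

/-!
A double adjunction `F ⊣ G` whose unit and counit arrows have companions induces a lax adjunction
between the underlying pseudofunctors (`DoubleAdjunction.laxAdjunction`); the theorem is this fact
for the right adjoints of the diagonal and of the double functor to the terminal double category.

The components of the lax unit and counit at objects are the companions of the components of the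
double unit and counit. Their comparison cells are mates: for a cell `α` from `m` to `n` with sides
`f` and `g`, the mate is a globular cell `m ⊗ g_! ⟶ f_! ⊗ n`. The counit of `f_!` gives a cell
`f_! ⊗ n ⟶ n` with left side `f` (`resCell`), and composition with it is injective
(`Companion.resCell_injective`), so that the mate of `α` is characterised by its composite with
`resCell` being the pasting of `α` with the counit of `g_!` (`IsMate`). All laws are checked after
composition with `resCell`:

* the transformation laws follow from those of `α` (`mate_naturality`, `mate_id`, `mate_comp`);
* mates are stable under pasting (`IsMate.comp`) and under double functors
  (`DoubleFunctor.isMate_map`), so each side of a triangulator has as its comparison cells mates of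
  composites that the triangle identities turn into identity cells. The triangulators are the
  counits of composite companions of identity arrows, which are invertible (`compCounitIso`), and
  the modification axioms hold by `IsMate.whisker_eq`;
* in the swallowtail identities, the naturality of the double unit (counit) at the counit of the
  companion reduces the pasting to the composite of a triangulator with its inverse
  (`swallowtail_unit_of_isMate`, `swallowtail_counit_of_isMate`).

A companion is left adjoint to the corresponding conjoint (`Companion.adjunction`), hence the
transformations are map-valued.

Since the sides of a cell compose only up to propositional equality, equations between cells are
proved in the category `ProObj` of proarrows, in which a cell together with its sides is a morphism
(`sq`).
-/

namespace CartEquip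

open DoubleCategory

/-! ### The category of proarrows and cells -/

/-- A proarrow of a double category together with its source and target. -/
structure ProObj (D : Type u) [DoubleCategory.{c, w, v, u} D] where
  /-- the source -/
  src : D
  /-- the target -/
  tgt : D
  /-- the proarrow -/
  pro : Pro src tgt

/-- A cell of a double category, regarded as a morphism from its top to its bottom; its sides are
part of the data. -/
structure ProHom {D : Type u} [DoubleCategory.{c, w, v, u} D] (M N : ProObj D) where
  /-- the left side -/
  left : M.src ⟶ N.src
  /-- the right side -/
  right : M.tgt ⟶ N.tgt
  /-- the cell -/
  cell : Cell left M.pro N.pro right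

section Squares

variable {D : Type u} [DoubleCategory.{c, w, v, u} D]

/-- Proarrows and cells form a category under composition in the direction of arrows. As the sides
of a cell are part of a morphism, equations between cells whose sides are only propositionally
equal can be stated without transports. -/
instance proObjCategory : Category (ProObj D) where
  Hom := ProHom
  id M := ⟨𝟙 M.src, 𝟙 M.tgt, idCell M.pro⟩
  comp α β := ⟨α.left ≫ β.left, α.right ≫ β.right, compCell rfl rfl α.cell β.cell⟩
  id_comp α := by
    rcases α with ⟨f, g, α⟩
    have key : ∀ (f' : _) (g' : _) (hf : 𝟙 _ ≫ f = f') (hg : 𝟙 _ ≫ g = g'),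
        (⟨f', g', compCell hf hg (idCell _) α⟩ : ProHom _ _) =
          ⟨f, g, compCell (Category.id_comp f) (Category.id_comp g) (idCell _) α⟩ := by
      intro f' g' hf hg
      obtain rfl : f = f' := (Category.id_comp f).symm.trans hf
      obtain rfl : g = g' := (Category.id_comp g).symm.trans hg
      rfl
    exact (key _ _ rfl rfl).trans (by rw [id_compCell])
  comp_id α := by
    rcases α with ⟨f, g, α⟩
    have key : ∀ (f' : _) (g' : _) (hf : f ≫ 𝟙 _ = f') (hg : g ≫ 𝟙 _ = g'),
        (⟨f', g', compCell hf hg α (idCell _)⟩ : ProHom _ _) =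
          ⟨f, g, compCell (Category.comp_id f) (Category.comp_id g) α (idCell _)⟩ := by
      intro f' g' hf hg
      obtain rfl : f = f' := (Category.comp_id f).symm.trans hf
      obtain rfl : g = g' := (Category.comp_id g).symm.trans hg
      rfl
    exact (key _ _ rfl rfl).trans (by rw [compCell_id])
  assoc α β γ := by
    rcases α with ⟨f, g, α⟩
    rcases β with ⟨f', g', β⟩
    rcases γ with ⟨f'', g'', γ⟩
    have key : ∀ (k : _) (l : _) (hk : (f ≫ f') ≫ f'' = k) (hl : (g ≫ g') ≫ g'' = l),
        (⟨(f ≫ f') ≫ f'', (g ≫ g') ≫ g'',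
          compCell rfl rfl (compCell rfl rfl α β) γ⟩ : ProHom _ _) =
          ⟨k, l, compCell hk hl (compCell rfl rfl α β) γ⟩ := by
      rintro _ _ rfl rfl
      rfl
    exact (key _ _ (Category.assoc f f' f'') (Category.assoc g g' g'')).trans
      (by rw [compCell_assoc])

/-- A cell as a morphism of the category of proarrows. -/
def sq {x y x' y' : D} {f : x ⟶ x'} {m : Pro x y} {n : Pro x' y'} {g : y ⟶ y'}
    (α : Cell f m n g) : (⟨x, y, m⟩ : ProObj D) ⟶ ⟨x', y', n⟩ :=
  (⟨f, g, α⟩ : ProHom _ _)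

variable {x y z t x' y' z' t' x'' y'' z'' : D}

theorem sq_injective {f : x ⟶ x'} {m : Pro x y} {n : Pro x' y'} {g : y ⟶ y'}
    {α β : Cell f m n g} (h : sq α = sq β) : α = β := by
  have h' : (⟨f, g, α⟩ : ProHom ⟨x, y, m⟩ ⟨x', y', n⟩) = ⟨f, g, β⟩ := h
  injection h'

theorem sq_compCell {f : x ⟶ x'} {f' : x' ⟶ x''} {f'' : x ⟶ x''}
    {g : y ⟶ y'} {g' : y' ⟶ y''} {g'' : y ⟶ y''} {m : Pro x y} {n : Pro x' y'} {p : Pro x'' y''}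
    (hf : f ≫ f' = f'') (hg : g ≫ g' = g'') (α : Cell f m n g) (β : Cell f' n p g') :
    sq (compCell hf hg α β) = sq α ≫ sq β := by
  subst hf hg
  rfl

theorem sq_idCell (m : Pro x y) : sq (idCell m) = 𝟙 (⟨x, y, m⟩ : ProObj D) := rfl

theorem sq_castCell {f f' : x ⟶ x'} {g g' : y ⟶ y'} {m : Pro x y} {n : Pro x' y'}
    (hf : f = f') (hg : g = g') (α : Cell f m n g) : sq (castCell hf hg α) = sq α := by
  subst hf hg
  rw [castCell_rfl]

/-- The composite of two globular cells, as morphisms of the category of proarrows. -/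
theorem sq_comp {m n p : Pro x y} (α : m ⟶ n) (β : n ⟶ p) :
    sq (f := 𝟙 x) (g := 𝟙 y) (α ≫ β) = sq (f := 𝟙 x) (g := 𝟙 y) α ≫ sq (f := 𝟙 x) (g := 𝟙 y) β :=
  sq_compCell _ _ _ _

/-- Interchange: an external composite may be composed in the direction of arrows by composing its
two halves, in any way for which the sides shared by the halves agree. -/
theorem sq_hcomp_comp {f : x ⟶ x'} {g : y ⟶ y'} {h : z ⟶ z'} {f' : x' ⟶ x''} {g' : y' ⟶ y''}
    {h' : z' ⟶ z''} {f'' : x ⟶ x''} {g'' : y ⟶ y''} {h'' : z ⟶ z''}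
    {m : Pro x y} {n : Pro y z} {m' : Pro x' y'} {n' : Pro y' z'} {m'' : Pro x'' y''}
    {n'' : Pro y'' z''} {α : Cell f m m' g} {β : Cell g n n' h} {α' : Cell f' m' m'' g'}
    {β' : Cell g' n' n'' h'} {α'' : Cell f'' m m'' g''} {β'' : Cell g'' n n'' h''}
    (hα : sq α ≫ sq α' = sq α'') (hβ : sq β ≫ sq β' = sq β'') :
    sq (hcomp α β) ≫ sq (hcomp α' β') = sq (hcomp α'' β'') := by
  have hα' : (⟨f ≫ f', g ≫ g', compCell rfl rfl α α'⟩ : ProHom ⟨x, y, m⟩ ⟨x'', y'', m''⟩) =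
    ⟨f'', g'', α''⟩ := hα
  have hβ' : (⟨g ≫ g', h ≫ h', compCell rfl rfl β β'⟩ : ProHom ⟨y, z, n⟩ ⟨y'', z'', n''⟩) =
    ⟨g'', h'', β''⟩ := hβ
  obtain rfl : f ≫ f' = f'' := congrArg ProHom.left hα'
  obtain rfl : g ≫ g' = g'' := congrArg ProHom.right hα'
  obtain rfl : h ≫ h' = h'' := congrArg ProHom.right hβ'
  obtain rfl : compCell rfl rfl α α' = α'' := sq_injective hα'
  obtain rfl : compCell rfl rfl β β' = β'' := sq_injective hβ'
  rw [hcomp_comp, sq_compCell]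

/-- External composition respects equality of cells up to change of sides. -/
theorem sq_hcomp_congr {f f' : x ⟶ x'} {g g' : y ⟶ y'} {h h' : z ⟶ z'}
    {m : Pro x y} {n : Pro y z} {m' : Pro x' y'} {n' : Pro y' z'}
    {α : Cell f m m' g} {β : Cell g n n' h} {α' : Cell f' m m' g'} {β' : Cell g' n n' h'}
    (hα : sq α = sq α') (hβ : sq β = sq β') : sq (hcomp α β) = sq (hcomp α' β') := by
  have h := sq_hcomp_comp (α := idCell m) (β := idCell n) (α' := α) (β' := β) (α'' := α')
    (β'' := β') ((Category.id_comp (sq α)).trans hα) ((Category.id_comp (sq β)).trans hβ)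
  rw [hcomp_id, sq_idCell, Category.id_comp] at h
  exact h

theorem sq_hcomp_idCell (m : Pro x y) (n : Pro y z) :
    sq (hcomp (idCell m) (idCell n)) = 𝟙 (⟨x, z, compPro m n⟩ : ProObj D) := by
  rw [hcomp_id, sq_idCell]

theorem sq_hid_comp (f : x ⟶ x') (f' : x' ⟶ x'') :
    sq (hid (f ≫ f')) = sq (hid f) ≫ sq (hid f') := by
  rw [hid_comp, sq_compCell]

theorem sq_hid_id (x : D) : sq (hid (𝟙 x)) = 𝟙 (⟨x, x, idPro x⟩ : ProObj D) := by
  rw [hid_id, sq_idCell]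

theorem sq_left_naturality {f : x ⟶ x'} {g : y ⟶ y'} {m : Pro x y} {m' : Pro x' y'}
    (α : Cell f m m' g) :
    sq (hcomp (hid f) α) ≫ sq (leftHom m') = sq (leftHom m) ≫ sq α := by
  rw [← sq_compCell (Category.comp_id f) (Category.comp_id g), leftHom_naturality, sq_compCell]

theorem sq_right_naturality {f : x ⟶ x'} {g : y ⟶ y'} {m : Pro x y} {m' : Pro x' y'}
    (α : Cell f m m' g) :
    sq (hcomp α (hid g)) ≫ sq (rightHom m') = sq (rightHom m) ≫ sq α := by
  rw [← sq_compCell (Category.comp_id f) (Category.comp_id g), rightHom_naturality, sq_compCell]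

theorem sq_assoc_naturality {f : x ⟶ x'} {g : y ⟶ y'} {h : z ⟶ z'}
    {k : t ⟶ t'} {m : Pro x y} {n : Pro y z} {p : Pro z t} {m' : Pro x' y'} {n' : Pro y' z'}
    {p' : Pro z' t'} (α : Cell f m m' g) (β : Cell g n n' h) (γ : Cell h p p' k) :
    sq (hcomp (hcomp α β) γ) ≫ sq (assocHom m' n' p') =
      sq (assocHom m n p) ≫ sq (hcomp α (hcomp β γ)) := by
  rw [← sq_compCell (Category.comp_id f) (Category.comp_id k), assocHom_naturality, sq_compCell]

@[simp]
theorem sq_assocHom_assocInv (m : Pro x y) (n : Pro y z) (p : Pro z t) :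
    sq (assocHom m n p) ≫ sq (assocInv m n p) = 𝟙 _ := by
  rw [← sq_compCell (Category.id_comp _) (Category.id_comp _), assocHom_assocInv, sq_idCell]

@[simp]
theorem sq_assocInv_assocHom (m : Pro x y) (n : Pro y z) (p : Pro z t) :
    sq (assocInv m n p) ≫ sq (assocHom m n p) = 𝟙 _ := by
  rw [← sq_compCell (Category.id_comp _) (Category.id_comp _), assocInv_assocHom, sq_idCell]

@[simp]
theorem sq_leftHom_leftInv (m : Pro x y) : sq (leftHom m) ≫ sq (leftInv m) = 𝟙 _ := by
  rw [← sq_compCell (Category.id_comp _) (Category.id_comp _), leftHom_leftInv, sq_idCell]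

@[simp]
theorem sq_leftInv_leftHom (m : Pro x y) : sq (leftInv m) ≫ sq (leftHom m) = 𝟙 _ := by
  rw [← sq_compCell (Category.id_comp _) (Category.id_comp _), leftInv_leftHom, sq_idCell]

@[simp]
theorem sq_rightHom_rightInv (m : Pro x y) : sq (rightHom m) ≫ sq (rightInv m) = 𝟙 _ := by
  rw [← sq_compCell (Category.id_comp _) (Category.id_comp _), rightHom_rightInv, sq_idCell]

@[simp]
theorem sq_rightInv_rightHom (m : Pro x y) : sq (rightInv m) ≫ sq (rightHom m) = 𝟙 _ := by
  rw [← sq_compCell (Category.id_comp _) (Category.id_comp _), rightInv_rightHom, sq_idCell]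

/-- The associator as an isomorphism of the category of proarrows. -/
def sqAssoc (m : Pro x y) (n : Pro y z) (p : Pro z t) :
    (⟨x, t, compPro (compPro m n) p⟩ : ProObj D) ≅ ⟨x, t, compPro m (compPro n p)⟩ where
  hom := sq (assocHom m n p)
  inv := sq (assocInv m n p)

/-- The left unitor as an isomorphism of the category of proarrows. -/
def sqLeft (m : Pro x y) : (⟨x, y, compPro (idPro x) m⟩ : ProObj D) ≅ ⟨x, y, m⟩ where
  hom := sq (leftHom m)
  inv := sq (leftInv m)

/-- The right unitor as an isomorphism of the category of proarrows. -/
def sqRight (m : Pro x y) : (⟨x, y, compPro m (idPro y)⟩ : ProObj D) ≅ ⟨x, y, m⟩ where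
  hom := sq (rightHom m)
  inv := sq (rightInv m)

theorem sq_assocInv_naturality {f : x ⟶ x'} {g : y ⟶ y'} {h : z ⟶ z'}
    {k : t ⟶ t'} {m : Pro x y} {n : Pro y z} {p : Pro z t} {m' : Pro x' y'} {n' : Pro y' z'}
    {p' : Pro z' t'} (α : Cell f m m' g) (β : Cell g n n' h) (γ : Cell h p p' k) :
    sq (hcomp α (hcomp β γ)) ≫ sq (assocInv m' n' p') =
      sq (assocInv m n p) ≫ sq (hcomp (hcomp α β) γ) := by
  rw [← cancel_mono (sqAssoc m' n' p').hom, ← cancel_epi (sqAssoc m n p).hom]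
  simp [sqAssoc, sq_assoc_naturality, reassoc_of% sq_assocHom_assocInv]

theorem sq_leftInv_naturality {f : x ⟶ x'} {g : y ⟶ y'} {m : Pro x y} {m' : Pro x' y'}
    (α : Cell f m m' g) :
    sq α ≫ sq (leftInv m') = sq (leftInv m) ≫ sq (hcomp (hid f) α) := by
  rw [← cancel_mono (sqLeft m').hom, ← cancel_epi (sqLeft m).hom]
  simp [sqLeft, sq_left_naturality, reassoc_of% sq_leftHom_leftInv]

theorem sq_triangle (m : Pro x y) (n : Pro y z) :
    sq (assocHom m (idPro y) n) ≫ sq (hcomp (idCell m) (leftHom n)) =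
      sq (hcomp (rightHom m) (idCell n)) := by
  rw [← sq_compCell (Category.id_comp _) (Category.id_comp _), DoubleCategory.triangle]

theorem sq_triangle_inv (m : Pro x y) (n : Pro y z) :
    sq (assocInv m (idPro y) n) ≫ sq (hcomp (rightHom m) (idCell n)) =
      sq (hcomp (idCell m) (leftHom n)) := by
  rw [← sq_triangle, reassoc_of% sq_assocInv_assocHom]

theorem sq_assoc_leftHom (m : Pro x y) (n : Pro y z) :
    sq (assocHom (idPro x) m n) ≫ sq (leftHom (compPro m n)) =
      sq (hcomp (leftHom m) (idCell n)) := by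
  have h := leftUnitor_comp (B := UnderlyingBicategory D) (a := ⟨x⟩) (b := ⟨y⟩) (c := ⟨z⟩) m n
  have h' : sq (leftHom (compPro m n)) =
      sq (assocInv (idPro x) m n) ≫ sq (hcomp (leftHom m) (idCell n)) :=
    (congrArg (sq (D := D) (f := 𝟙 x) (g := 𝟙 z)) h).trans (sq_compCell _ _ _ _)
  rw [h', reassoc_of% sq_assocHom_assocInv]

theorem sq_assoc_rightHom (m : Pro x y) (n : Pro y z) :
    sq (assocHom m n (idPro z)) ≫ sq (hcomp (idCell m) (rightHom n)) =
      sq (rightHom (compPro m n)) := by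
  have h := rightUnitor_comp (B := UnderlyingBicategory D) (a := ⟨x⟩) (b := ⟨y⟩) (c := ⟨z⟩) m n
  exact ((congrArg (sq (D := D) (f := 𝟙 x) (g := 𝟙 z)) h).trans (sq_compCell _ _ _ _)).symm

theorem leftHom_idPro (x : D) : leftHom (idPro x) = rightHom (idPro x) :=
  unitors_equal (B := UnderlyingBicategory D) (a := ⟨x⟩)

end Squares

/-! ### Cells out of companions -/

section Companions

variable {D : Type u} [DoubleCategory.{c, w, v, u} D] {x y z t x' y' z' x'' y'' : D}

/-- The cell `P ⊗ n ⟶ n` with left side `f` obtained from a cell `κ : P ⟶ id` with left side `f`.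
For `κ` the counit of a companion of `f`, it is the cartesian cell exhibiting `P ⊗ n` as the
restriction of `n` along `f`. -/
def resCell {f : x ⟶ y} {P : Pro x y} (κ : Cell f P (idPro y) (𝟙 y)) (n : Pro y z) :
    Cell f (compPro P n) n (𝟙 z) :=
  compCell (Category.comp_id f) (Category.comp_id (𝟙 z)) (hcomp κ (idCell n)) (leftHom n)

theorem sq_resCell {f : x ⟶ y} {P : Pro x y} (κ : Cell f P (idPro y) (𝟙 y)) (n : Pro y z) :
    sq (resCell κ n) = sq (hcomp κ (idCell n)) ≫ sq (leftHom n) :=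
  sq_compCell _ _ _ _

/-- The composite of two cells to identity proarrows: for counits of companions of `f` and `g`, it
is the counit of a companion of `f ≫ g`. -/
def compCounit {f : x ⟶ y} {g : y ⟶ z} {k : x ⟶ z} (hk : f ≫ g = k) {P : Pro x y} {Q : Pro y z}
    (κ : Cell f P (idPro y) (𝟙 y)) (κ' : Cell g Q (idPro z) (𝟙 z)) :
    Cell k (compPro P Q) (idPro z) (𝟙 z) :=
  compCell hk (Category.comp_id _) (resCell κ Q) κ'

theorem sq_compCounit {f : x ⟶ y} {g : y ⟶ z} {k : x ⟶ z} (hk : f ≫ g = k) {P : Pro x y}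
    {Q : Pro y z} (κ : Cell f P (idPro y) (𝟙 y)) (κ' : Cell g Q (idPro z) (𝟙 z)) :
    sq (compCounit hk κ κ') = sq (resCell κ Q) ≫ sq κ' :=
  sq_compCell _ _ _ _

theorem sq_resCell_naturality {f : x ⟶ y} {P : Pro x y} (κ : Cell f P (idPro y) (𝟙 y))
    {g : z ⟶ z'} {n : Pro y z} {n' : Pro y z'} (β : Cell (𝟙 y) n n' g) :
    sq (hcomp (idCell P) β) ≫ sq (resCell κ n') = sq (resCell κ n) ≫ sq β := by
  have h₁ := sq_hcomp_comp (α := idCell P) (β := β) (α' := κ) (β' := idCell n') (α'' := κ) (β'' := β)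
    (Category.id_comp _) (Category.comp_id _)
  have h₂ := sq_hcomp_comp (α := κ) (β := idCell n) (α' := hid (𝟙 y)) (β' := β) (α'' := κ)
    (β'' := β) (by rw [sq_hid_id, Category.comp_id]) (Category.id_comp _)
  rw [sq_resCell, sq_resCell, reassoc_of% h₁, Category.assoc, ← sq_left_naturality β,
    reassoc_of% h₂]

theorem sq_assoc_resCell {f : x ⟶ y} {P : Pro x y} (κ : Cell f P (idPro y) (𝟙 y)) (n : Pro y z)
    (p : Pro z t) :
    sq (assocHom P n p) ≫ sq (resCell κ (compPro n p)) = sq (hcomp (resCell κ n) (idCell p)) := by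
  have h₁ := sq_hcomp_comp (α := hcomp κ (idCell n)) (β := idCell p) (α' := leftHom n)
    (β' := idCell p) (α'' := resCell κ n) (β'' := idCell p) (sq_resCell κ n).symm
    (Category.id_comp _)
  rw [sq_resCell, ← h₁, ← hcomp_id, ← reassoc_of% sq_assoc_naturality, sq_assoc_leftHom]

theorem sq_assocInv_hcomp_resCell {f : x ⟶ x'} {g : y ⟶ y'} {m : Pro x y} {m' : Pro x' y'}
    (α : Cell f m m' g) {P : Pro y y'} (κ : Cell g P (idPro y') (𝟙 y')) (n : Pro y' z) :
    sq (assocInv m P n) ≫ sq (hcomp (hcomp α κ) (idCell n)) ≫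
        sq (hcomp (rightHom m') (idCell n)) = sq (hcomp α (resCell κ n)) := by
  have h₁ := sq_hcomp_comp (α := α) (β := hcomp κ (idCell n)) (α' := idCell m') (β' := leftHom n)
    (α'' := α) (β'' := resCell κ n) (Category.comp_id _) (sq_resCell κ n).symm
  rw [← reassoc_of% sq_assocInv_naturality, sq_triangle_inv, h₁]

theorem sq_assoc_resCell_resCell {f : x ⟶ y} {g : y ⟶ z} {k : x ⟶ z} (hk : f ≫ g = k)
    {P : Pro x y} {Q : Pro y z} (κ : Cell f P (idPro y) (𝟙 y)) (κ' : Cell g Q (idPro z) (𝟙 z))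
    (n : Pro z t) :
    sq (assocHom P Q n) ≫ sq (resCell κ (compPro Q n)) ≫ sq (resCell κ' n) =
      sq (resCell (compCounit hk κ κ') n) := by
  have h₁ := sq_hcomp_comp (α := resCell κ Q) (β := idCell n) (α' := κ') (β' := idCell n)
    (α'' := compCounit hk κ κ') (β'' := idCell n) (sq_compCounit hk κ κ').symm
    (Category.id_comp _)
  rw [reassoc_of% sq_assoc_resCell, sq_resCell, sq_resCell, reassoc_of% h₁]

theorem resCell_idPro {f : x ⟶ y} {P : Pro x y} (κ : Cell f P (idPro y) (𝟙 y)) :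
    sq (resCell κ (idPro y)) = sq (rightHom P) ≫ sq κ := by
  rw [sq_resCell, leftHom_idPro, ← hid_id, sq_right_naturality]

/-- Composition with the cartesian cell of a companion is injective. -/
theorem Companion.resCell_injective {f : x ⟶ y} (C : Companion f) {n : Pro y z} {h : x' ⟶ x}
    {X : Pro x' z'} {k : z' ⟶ z} {β β' : Cell h X (compPro C.pro n) k}
    (e : sq β ≫ sq (resCell C.counit n) = sq β' ≫ sq (resCell C.counit n)) : β = β' := by
  -- A cell is recovered from its composite with the cartesian cell by inserting the unit of `C`.
  have key : ∀ γ : Cell h X (compPro C.pro n) k,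
      sq γ = sq (leftInv X) ≫ sq (hcomp (compCell (Category.comp_id h) rfl (hid h) C.unit)
        (compCell rfl (Category.comp_id k) γ (resCell C.counit n))) := by
    intro γ
    have h₁ := sq_hcomp_comp (α := hid h) (β := γ) (α' := C.unit) (β' := resCell C.counit n)
      (sq_compCell (Category.comp_id h) rfl _ _).symm
      (sq_compCell rfl (Category.comp_id k) _ _).symm
    have h₂ := sq_hcomp_comp (α := C.unit) (β := hcomp C.counit (idCell n)) (α' := idCell C.pro)
      (β' := leftHom n) (α'' := C.unit) (β'' := resCell C.counit n) (Category.comp_id _)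
      (sq_resCell _ _).symm
    have h₃ := sq_hcomp_comp (α := leftHom C.pro) (β := idCell n) (α' := rightInv C.pro)
      (β' := idCell n) (α'' := hcomp C.unit C.counit) (β'' := idCell n)
      (by rw [C.hcomp_eq, sq_compCell]) (Category.id_comp _)
    have h₄ := sq_hcomp_comp (α := rightInv C.pro) (β := idCell n) (α' := rightHom C.pro)
      (β' := idCell n) (α'' := idCell _) (β'' := idCell n) (sq_rightInv_rightHom _)
      (Category.id_comp _)
    have h₅ : sq (leftInv (compPro C.pro n)) ≫ sq (hcomp C.unit (resCell C.counit n)) = 𝟙 _ := by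
      rw [← h₂, ← sq_triangle_inv, reassoc_of% sq_assocInv_naturality, ← h₃, Category.assoc, h₄,
        sq_hcomp_idCell, Category.comp_id, ← sq_assoc_leftHom,
        reassoc_of% sq_assocInv_assocHom, sq_leftInv_leftHom]
    rw [← h₁, ← reassoc_of% sq_leftInv_naturality, h₅, Category.comp_id]
  apply sq_injective
  rw [key β, key β']
  congr 1
  exact sq_hcomp_congr rfl (by rw [sq_compCell, sq_compCell, e])

theorem Companion.counit_injective {f : x ⟶ y} (C : Companion f) {h : x' ⟶ x}
    {X : Pro x' z'} {k : z' ⟶ y} {β β' : Cell h X C.pro k}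
    (e : sq β ≫ sq C.counit = sq β' ≫ sq C.counit) : β = β' := by
  have h₁ : compCell (Category.comp_id h) (Category.comp_id k) β (rightInv C.pro) =
      compCell (Category.comp_id h) (Category.comp_id k) β' (rightInv C.pro) := by
    apply C.resCell_injective
    simp only [sq_compCell, Category.assoc, resCell_idPro, reassoc_of% sq_rightInv_rightHom, e]
  have h₂ := congrArg sq h₁
  rw [sq_compCell, sq_compCell] at h₂
  apply sq_injective
  simpa using h₂ =≫ sq (rightHom C.pro)

theorem Companion.sq_unit_counit {f : x ⟶ y} (C : Companion f) :
    sq C.unit ≫ sq C.counit = sq (hid f) := by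
  rw [← C.comp_eq, sq_compCell]

/-! ### Mates -/

/-- A globular cell `N : m ⊗ Q ⟶ P ⊗ n` is a mate of a cell `α` from `m` to `n` with sides `f` and
`g`, relative to cells `P ⟶ id` and `Q ⟶ id` with left sides `f` and `g`, if it becomes the
pasting of `α` with the latter cell after composition with the former. -/
def IsMate {f : x ⟶ x'} {g : y ⟶ y'} {P : Pro x x'} {Q : Pro y y'}
    (κP : Cell f P (idPro x') (𝟙 x')) (κQ : Cell g Q (idPro y') (𝟙 y')) {m : Pro x y}
    {n : Pro x' y'} (N : compPro m Q ⟶ compPro P n) (α : Cell f m n g) : Prop :=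
  sq (f := 𝟙 x) (g := 𝟙 y') N ≫ sq (resCell κP n) = sq (hcomp α κQ) ≫ sq (rightHom n)

/-- The mate of a cell relative to companions of its sides. -/
def mate {f : x ⟶ x'} {g : y ⟶ y'} (C : Companion f) (C' : Companion g) {m : Pro x y}
    {n : Pro x' y'} (α : Cell f m n g) : compPro m C'.pro ⟶ compPro C.pro n :=
  compCell (Category.id_comp (𝟙 x)) (Category.id_comp (𝟙 y')) (leftInv (compPro m C'.pro))
    (hcomp C.unit (compCell (Category.comp_id f) (Category.comp_id (𝟙 y')) (hcomp α C'.counit)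
      (rightHom n)))

theorem isMate_mate {f : x ⟶ x'} {g : y ⟶ y'} (C : Companion f) (C' : Companion g) {m : Pro x y}
    {n : Pro x' y'} (α : Cell f m n g) : IsMate C.counit C'.counit (mate C C' α) α := by
  let X : Cell f (compPro m C'.pro) n (𝟙 y') :=
    compCell (Category.comp_id f) (Category.comp_id (𝟙 y')) (hcomp α C'.counit) (rightHom n)
  have h₁ := sq_hcomp_comp (α := C.unit) (β := X) (α' := C.counit) (β' := idCell n)
    (α'' := hid f) (β'' := X) C.sq_unit_counit (Category.comp_id _)
  have h₂ : sq X = sq (hcomp α C'.counit) ≫ sq (rightHom n) := sq_compCell _ _ _ _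
  have h₃ : sq (f := 𝟙 x) (g := 𝟙 y') (mate C C' α) = sq (leftInv (compPro m C'.pro)) ≫
    sq (hcomp C.unit X) := sq_compCell _ _ _ _
  rw [IsMate, h₃, sq_resCell, Category.assoc, reassoc_of% h₁, sq_left_naturality,
    reassoc_of% sq_leftInv_leftHom, h₂]

/-- The canonical cell `m ⊗ id ⟶ id ⊗ m` is a mate of the identity cell. -/
theorem isMate_id (m : Pro x y) :
    IsMate (idCell (idPro x)) (idCell (idPro y)) ((rightIso m).hom ≫ (leftIso m).inv)
      (idCell m) := by
  have h : sq (f := 𝟙 x) (g := 𝟙 y) ((rightIso m).hom ≫ (leftIso m).inv) =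
    sq (rightHom m) ≫ sq (leftInv m) := sq_comp _ _
  rw [IsMate, h, sq_resCell, sq_hcomp_idCell, sq_hcomp_idCell, Category.id_comp, Category.id_comp,
    Category.assoc, sq_leftInv_leftHom, Category.comp_id]

theorem sq_ghcomp {m m' : Pro x y} {n n' : Pro y z} (α : m ⟶ m') (β : n ⟶ n') :
    sq (f := 𝟙 x) (g := 𝟙 z) (ghcomp α β) =
      sq (hcomp (f := 𝟙 x) (g := 𝟙 y) (h := 𝟙 z) α β) := rfl

/-- Pasting of mates, as in the vertical composition of oplax transformations. -/
theorem IsMate.comp {f : x ⟶ x'} {f' : x' ⟶ x''} {k : x ⟶ x''} {g : y ⟶ y'} {g' : y' ⟶ y''}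
    {l : y ⟶ y''} (hk : f ≫ f' = k) (hl : g ≫ g' = l) {P : Pro x x'} {Q : Pro y y'}
    {P' : Pro x' x''} {Q' : Pro y' y''}
    {κP : Cell f P (idPro x') (𝟙 x')} {κQ : Cell g Q (idPro y') (𝟙 y')}
    {κP' : Cell f' P' (idPro x'') (𝟙 x'')} {κQ' : Cell g' Q' (idPro y'') (𝟙 y'')}
    {m : Pro x y} {n : Pro x' y'} {p : Pro x'' y''}
    {N : compPro m Q ⟶ compPro P n} {N' : compPro n Q' ⟶ compPro P' p}
    {α : Cell f m n g} {β : Cell f' n p g'} (h : IsMate κP κQ N α) (h' : IsMate κP' κQ' N' β) :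
    IsMate (compCounit hk κP κP') (compCounit hl κQ κQ')
      ((assocIso m Q Q').inv ≫ ghcomp N (𝟙 Q') ≫ (assocIso P n Q').hom ≫ ghcomp (𝟙 P) N' ≫
        (assocIso P P' p).inv) (compCell hk hl α β) := by
  have e : sq (f := 𝟙 x) (g := 𝟙 y'') ((assocIso m Q Q').inv ≫ ghcomp N (𝟙 Q') ≫
      (assocIso P n Q').hom ≫ ghcomp (𝟙 P) N' ≫ (assocIso P P' p).inv) =
      sq (assocInv m Q Q') ≫ sq (hcomp (f := 𝟙 x) (g := 𝟙 y') N (idCell Q')) ≫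
        sq (assocHom P n Q') ≫ sq (hcomp (g := 𝟙 x') (h := 𝟙 y'') (idCell P) N') ≫
          sq (assocInv P P' p) := by
    rw [sq_comp, sq_comp, sq_comp, sq_comp]; rfl
  have h₁ := sq_hcomp_comp (f := 𝟙 x) (g := 𝟙 y') (α := N) (β := idCell Q') (α' := resCell κP n)
    (β' := idCell Q') (α'' := compCell (Category.comp_id f) (Category.comp_id (𝟙 y'))
      (hcomp α κQ) (rightHom n)) (β'' := idCell Q') (by rw [sq_compCell]; exact h)
      (Category.id_comp _)
  have h₂ := sq_hcomp_comp (α := hcomp α κQ) (β := idCell Q') (α' := rightHom n)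
    (β' := idCell Q') (sq_compCell (Category.comp_id f) (Category.comp_id (𝟙 y')) _ _).symm
    (Category.id_comp (sq (idCell Q')))
  have h₃ := sq_hcomp_comp (α := α) (β := resCell κQ Q') (α' := β) (β' := κQ')
    (sq_compCell hk hl _ _).symm (sq_compCounit hl _ _).symm
  rw [IsMate, e, ← sq_assoc_resCell_resCell hk]
  simp only [Category.assoc, reassoc_of% sq_assocInv_assocHom]
  rw [reassoc_of% (sq_resCell_naturality κP (g := 𝟙 y'') N'), h', reassoc_of% sq_assoc_resCell,
    reassoc_of% h₁, ← h₂, Category.assoc, reassoc_of% sq_assocInv_hcomp_resCell, reassoc_of% h₃]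

/-- The modification axiom for mates of a single cell: globular cells `Γ` and `Γ'` that respect the
cells to the identity proarrows commute with the mates, provided that composition with the cell
`P' ⊗ n ⟶ n` of the target is injective. -/
theorem IsMate.whisker_eq {f f' : x ⟶ x'} {g g' : y ⟶ y'} {P P' : Pro x x'} {Q Q' : Pro y y'}
    {κP : Cell f P (idPro x') (𝟙 x')} {κQ : Cell g Q (idPro y') (𝟙 y')}
    {κP' : Cell f' P' (idPro x') (𝟙 x')} {κQ' : Cell g' Q' (idPro y') (𝟙 y')}
    {m : Pro x y} {n : Pro x' y'} {N : compPro m Q ⟶ compPro P n}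
    {N' : compPro m Q' ⟶ compPro P' n} {α : Cell f m n g} {α' : Cell f' m n g'}
    (h : IsMate κP κQ N α) (h' : IsMate κP' κQ' N' α') (hα : sq α = sq α')
    (Γ : P ⟶ P') (Γ' : Q ⟶ Q') (hP : sq (f := 𝟙 x) (g := 𝟙 x') Γ ≫ sq κP' = sq κP)
    (hQ : sq (f := 𝟙 y) (g := 𝟙 y') Γ' ≫ sq κQ' = sq κQ)
    (inj : ∀ β β' : compPro m Q ⟶ compPro P' n,
      sq (f := 𝟙 x) (g := 𝟙 y') β ≫ sq (resCell κP' n) =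
        sq (f := 𝟙 x) (g := 𝟙 y') β' ≫ sq (resCell κP' n) → β = β') :
    ghcomp (𝟙 m) Γ' ≫ N' = N ≫ ghcomp Γ (𝟙 n) := by
  apply inj
  have h₁ := sq_hcomp_comp (g := 𝟙 y) (h := 𝟙 y') (α := idCell m) (β := Γ') (α' := α') (β' := κQ')
    (α'' := α) (β'' := κQ) ((Category.id_comp (sq α')).trans hα.symm) hQ
  have h₂ := sq_hcomp_comp (f := 𝟙 x) (g := 𝟙 x') (α := Γ) (β := idCell n) (α' := κP')
    (β' := idCell n) (α'' := κP) (β'' := idCell n) hP (Category.id_comp _)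
  rw [sq_comp, sq_comp, Category.assoc, Category.assoc, h', sq_ghcomp, sq_ghcomp]
  erw [reassoc_of% h₁]
  rw [sq_resCell]
  erw [reassoc_of% h₂]
  rw [← sq_resCell, h]

/-- Pasting a cell with a cell to an identity proarrow, when the bottom of the former is itself
equipped with a cell to an identity proarrow. -/
theorem sq_hcomp_rightHom_counit {f f₀ : x ⟶ y} {g' : y ⟶ z} {P : Pro x y}
    {Q : Pro y z} {R : Pro y z} {f' : y ⟶ z} {α : Cell f P R g'} {κP : Cell f₀ P (idPro y) (𝟙 y)}
    {κQ : Cell g' Q (idPro z) (𝟙 z)} {κR : Cell f' R (idPro z) (𝟙 z)}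
    (h : sq α ≫ sq κR = sq κP ≫ sq (hid g')) :
    sq (hcomp α κQ) ≫ sq (rightHom R) ≫ sq κR = sq (resCell κP Q) ≫ sq κQ := by
  have h₁ := sq_hcomp_comp (α := α) (β := κQ) (α' := κR) (β' := hid (𝟙 z))
    (α'' := compCell rfl (Category.id_comp g') κP (hid g')) (β'' := κQ)
    (by rw [sq_compCell, h]) (by rw [sq_hid_id, Category.comp_id])
  have h₂ := sq_hcomp_comp (α := κP) (β := idCell Q) (α' := hid g') (β' := κQ)
    (sq_compCell rfl (Category.id_comp g') _ _).symm (Category.id_comp (sq κQ))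
  rw [← sq_right_naturality, reassoc_of% h₁, sq_resCell, Category.assoc, ← sq_left_naturality,
    reassoc_of% h₂, leftHom_idPro]

end Companions

/-! ### Double functors on companions and on mates -/

namespace DoubleFunctor

variable {D : Type u₁} [DoubleCategory.{c₁, w₁, v₁, u₁} D]
  {E : Type u₂} [DoubleCategory.{c₂, w₂, v₂, u₂} E] (F : DoubleFunctor D E)

/-- The functor between categories of proarrows induced by a double functor. -/
def proFunctor : ProObj D ⥤ ProObj E where
  obj M := ⟨F.obj M.src, F.obj M.tgt, F.mapPro M.pro⟩
  map α := sq (F.mapCell (ProHom.cell α))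
  map_id M := (congrArg sq (F.mapCell_id M.pro)).trans (sq_castCell _ _ _)
  map_comp α β := (congrArg sq (F.mapCell_comp (ProHom.cell α) (ProHom.cell β))).trans
    (sq_compCell _ _ _ _)

variable {x y z x' y' z' : D}

theorem sq_mapCell_comp {x y x' y' x'' y'' : D} {f : x ⟶ x'} {f' : x' ⟶ x''} {f'' : x ⟶ x''}
    {g : y ⟶ y'} {g' : y' ⟶ y''} {g'' : y ⟶ y''} {m : Pro x y} {n : Pro x' y'} {p : Pro x'' y''}
    {α : Cell f m n g} {β : Cell f' n p g'} {γ : Cell f'' m p g''} (h : sq α ≫ sq β = sq γ) :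
    sq (F.mapCell α) ≫ sq (F.mapCell β) = sq (F.mapCell γ) :=
  (F.proFunctor.map_comp (sq α) (sq β)).symm.trans (congrArg F.proFunctor.map h)

theorem sq_mapCell_congr {f f' : x ⟶ x'} {g g' : y ⟶ y'} {m : Pro x y} {n : Pro x' y'}
    {α : Cell f m n g} {β : Cell f' m n g'} (h : sq α = sq β) :
    sq (F.mapCell α) = sq (F.mapCell β) :=
  congrArg F.proFunctor.map h

theorem sq_mapCell_id (m : Pro x y) : sq (F.mapCell (idCell m)) = 𝟙 _ :=
  F.proFunctor.map_id ⟨x, y, m⟩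

theorem sq_mapGlob {m n : Pro x y} (α : m ⟶ n) :
    sq (f := 𝟙 (F.obj x)) (g := 𝟙 (F.obj y)) (F.mapGlob α) =
      sq (F.mapCell (f := 𝟙 x) (g := 𝟙 y) α) :=
  sq_castCell _ _ _

/-- The comparison cell of `F` for external composition. -/
def muHom (m : Pro x y) (n : Pro y z) :
    Cell (𝟙 (F.obj x)) (compPro (F.mapPro m) (F.mapPro n)) (F.mapPro (compPro m n))
      (𝟙 (F.obj z)) :=
  (F.mu m n).hom

/-- The inverse of the comparison cell of `F` for external composition. -/
def muInv (m : Pro x y) (n : Pro y z) :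
    Cell (𝟙 (F.obj x)) (F.mapPro (compPro m n)) (compPro (F.mapPro m) (F.mapPro n))
      (𝟙 (F.obj z)) :=
  (F.mu m n).inv

/-- The comparison cell of `F` for external identities. -/
def iotaHom (x : D) : Cell (𝟙 (F.obj x)) (idPro (F.obj x)) (F.mapPro (idPro x)) (𝟙 (F.obj x)) :=
  (F.iota x).hom

/-- The inverse of the comparison cell of `F` for external identities. -/
def iotaInv (x : D) : Cell (𝟙 (F.obj x)) (F.mapPro (idPro x)) (idPro (F.obj x)) (𝟙 (F.obj x)) :=
  (F.iota x).inv

@[simp]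
theorem sq_muHom_muInv (m : Pro x y) (n : Pro y z) : sq (F.muHom m n) ≫ sq (F.muInv m n) = 𝟙 _ :=
  (sq_comp _ _).symm.trans (congrArg (sq (f := 𝟙 (F.obj x)) (g := 𝟙 (F.obj z)))
    (F.mu m n).hom_inv_id)

@[simp]
theorem sq_muInv_muHom (m : Pro x y) (n : Pro y z) : sq (F.muInv m n) ≫ sq (F.muHom m n) = 𝟙 _ :=
  (sq_comp _ _).symm.trans (congrArg (sq (f := 𝟙 (F.obj x)) (g := 𝟙 (F.obj z)))
    (F.mu m n).inv_hom_id)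

@[simp]
theorem sq_iotaHom_iotaInv (x : D) : sq (F.iotaHom x) ≫ sq (F.iotaInv x) = 𝟙 _ :=
  (sq_comp _ _).symm.trans (congrArg (sq (f := 𝟙 (F.obj x)) (g := 𝟙 (F.obj x)))
    (F.iota x).hom_inv_id)

@[simp]
theorem sq_iotaInv_iotaHom (x : D) : sq (F.iotaInv x) ≫ sq (F.iotaHom x) = 𝟙 _ :=
  (sq_comp _ _).symm.trans (congrArg (sq (f := 𝟙 (F.obj x)) (g := 𝟙 (F.obj x)))
    (F.iota x).inv_hom_id)

theorem sq_mu_naturality {f : x ⟶ x'} {g : y ⟶ y'} {h : z ⟶ z'} {m : Pro x y}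
    {n : Pro y z} {m' : Pro x' y'} {n' : Pro y' z'} (α : Cell f m m' g) (β : Cell g n n' h) :
    sq (hcomp (F.mapCell α) (F.mapCell β)) ≫ sq (F.muHom m' n') =
      sq (F.muHom m n) ≫ sq (F.mapCell (hcomp α β)) :=
  (sq_compCell _ _ _ _).symm.trans ((congrArg sq (F.mu_naturality α β)).trans (sq_compCell _ _ _ _))

theorem sq_iota_naturality (f : x ⟶ x') :
    sq (hid (F.map f)) ≫ sq (F.iotaHom x') = sq (F.iotaHom x) ≫ sq (F.mapCell (hid f)) :=
  (sq_compCell _ _ _ _).symm.trans ((congrArg sq (F.iota_naturality f)).trans (sq_compCell _ _ _ _))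

theorem sq_muHom_mapCell_leftHom (m : Pro x y) :
    sq (F.muHom (idPro x) m) ≫ sq (F.mapCell (leftHom m)) =
      sq (hcomp (F.iotaInv x) (idCell (F.mapPro m))) ≫ sq (leftHom (F.mapPro m)) := by
  have h := congrArg (sq (f := 𝟙 (F.obj x)) (g := 𝟙 (F.obj y))) (F.mu_left m)
  have h' : sq (hcomp (F.iotaHom x) (idCell (F.mapPro m))) ≫ sq (F.muHom (idPro x) m) ≫
      sq (F.mapCell (leftHom m)) = sq (leftHom (F.mapPro m)) := by
    rw [sq_comp, sq_comp] at h
    rw [← sq_castCell (F.map_id x) (F.map_id y) (F.mapCell (leftHom m))]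
    exact h
  have h₁ := sq_hcomp_comp (α := F.iotaInv x) (β := idCell (F.mapPro m)) (α' := F.iotaHom x)
    (β' := idCell (F.mapPro m)) (α'' := idCell _) (β'' := idCell _) (F.sq_iotaInv_iotaHom x)
    (Category.id_comp _)
  rw [← h', reassoc_of% h₁, sq_hcomp_idCell, Category.id_comp]

theorem sq_muHom_mapCell_rightHom (m : Pro x y) :
    sq (F.muHom m (idPro y)) ≫ sq (F.mapCell (rightHom m)) =
      sq (hcomp (idCell (F.mapPro m)) (F.iotaInv y)) ≫ sq (rightHom (F.mapPro m)) := by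
  have h := congrArg (sq (f := 𝟙 (F.obj x)) (g := 𝟙 (F.obj y))) (F.mu_right m)
  have h' : sq (hcomp (idCell (F.mapPro m)) (F.iotaHom y)) ≫ sq (F.muHom m (idPro y)) ≫
      sq (F.mapCell (rightHom m)) = sq (rightHom (F.mapPro m)) := by
    rw [sq_comp, sq_comp] at h
    rw [← sq_castCell (F.map_id x) (F.map_id y) (F.mapCell (rightHom m))]
    exact h
  have h₁ := sq_hcomp_comp (α := idCell (F.mapPro m)) (β := F.iotaInv y)
    (α' := idCell (F.mapPro m)) (β' := F.iotaHom y) (α'' := idCell _) (β'' := idCell _)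
    (Category.id_comp _) (F.sq_iotaInv_iotaHom y)
  rw [← h', reassoc_of% h₁, sq_hcomp_idCell, Category.id_comp]

/-- The image under a double functor of a cell to an identity proarrow. -/
def mapCounit {f : x ⟶ y} {P : Pro x y} (κ : Cell f P (idPro y) (𝟙 y)) :
    Cell (F.map f) (F.mapPro P) (idPro (F.obj y)) (𝟙 (F.obj y)) :=
  compCell (Category.comp_id _) ((Category.comp_id _).trans (F.map_id y)) (F.mapCell κ)
    (F.iotaInv y)

theorem sq_mapCounit {f : x ⟶ y} {P : Pro x y} (κ : Cell f P (idPro y) (𝟙 y)) :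
    sq (F.mapCounit κ) = sq (F.mapCell κ) ≫ sq (F.iotaInv y) :=
  sq_compCell _ _ _ _

theorem sq_muHom_mapCell_resCell {f : x ⟶ y} {P : Pro x y} (κ : Cell f P (idPro y) (𝟙 y))
    (n : Pro y z) :
    sq (F.muHom P n) ≫ sq (F.mapCell (resCell κ n)) =
      sq (resCell (F.mapCounit κ) (F.mapPro n)) := by
  rw [← F.sq_mapCell_comp (sq_resCell κ n).symm, ← reassoc_of% F.sq_mu_naturality,
    F.sq_muHom_mapCell_leftHom, sq_resCell]
  have h₁ := sq_hcomp_comp (α := F.mapCell κ) (β := F.mapCell (idCell n)) (α' := F.iotaInv y)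
    (β' := idCell (F.mapPro n)) (α'' := F.mapCounit κ) (β'' := idCell _) (F.sq_mapCounit κ).symm
    (by rw [F.sq_mapCell_id, Category.id_comp])
  rw [reassoc_of% h₁]

theorem sq_muHom_mapCell_hcomp_rightHom {f : x ⟶ x'} {g : y ⟶ y'} {m : Pro x y} {n : Pro x' y'}
    {Q : Pro y y'} (α : Cell f m n g) (κ : Cell g Q (idPro y') (𝟙 y')) :
    sq (F.muHom m Q) ≫ sq (F.mapCell (hcomp α κ)) ≫ sq (F.mapCell (rightHom n)) =
      sq (hcomp (F.mapCell α) (F.mapCounit κ)) ≫ sq (rightHom (F.mapPro n)) := by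
  rw [← reassoc_of% F.sq_mu_naturality, F.sq_muHom_mapCell_rightHom]
  have h₁ := sq_hcomp_comp (α := F.mapCell α) (β := F.mapCell κ) (α' := idCell (F.mapPro n))
    (β' := F.iotaInv y') (α'' := F.mapCell α) (β'' := F.mapCounit κ) (Category.comp_id _)
    (F.sq_mapCounit κ).symm
  rw [reassoc_of% h₁]

theorem isMate_map {f : x ⟶ x'} {g : y ⟶ y'} {P : Pro x x'} {Q : Pro y y'}
    {κP : Cell f P (idPro x') (𝟙 x')} {κQ : Cell g Q (idPro y') (𝟙 y')} {m : Pro x y}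
    {n : Pro x' y'} {N : compPro m Q ⟶ compPro P n} {α : Cell f m n g} (h : IsMate κP κQ N α) :
    IsMate (F.mapCounit κP) (F.mapCounit κQ)
      ((F.mu m Q).hom ≫ F.mapGlob N ≫ (F.mu P n).inv) (F.mapCell α) := by
  have e : sq (f := 𝟙 (F.obj x)) (g := 𝟙 (F.obj y'))
      ((F.mu m Q).hom ≫ F.mapGlob N ≫ (F.mu P n).inv) =
      sq (F.muHom m Q) ≫ sq (F.mapCell (f := 𝟙 x) (g := 𝟙 y') N) ≫ sq (F.muInv P n) := by
    rw [sq_comp, sq_comp, F.sq_mapGlob]; rfl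
  rw [IsMate, e, ← F.sq_muHom_mapCell_resCell, ← F.sq_muHom_mapCell_hcomp_rightHom,
    Category.assoc, Category.assoc, reassoc_of% F.sq_muInv_muHom]
  congr 1
  have h' := congrArg F.proFunctor.map h
  rw [Functor.map_comp, Functor.map_comp] at h'
  exact h'

theorem sq_muHom_mapCounit_compCounit {f : x ⟶ y} {g : y ⟶ z} {k : x ⟶ z} (hk : f ≫ g = k)
    {k' : F.obj x ⟶ F.obj z} (hk' : F.map f ≫ F.map g = k') {P : Pro x y} {Q : Pro y z}
    (κ : Cell f P (idPro y) (𝟙 y)) (κ' : Cell g Q (idPro z) (𝟙 z)) :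
    sq (F.muHom P Q) ≫ sq (F.mapCell (compCounit hk κ κ')) ≫ sq (F.iotaInv z) =
      sq (compCounit hk' (F.mapCounit κ) (F.mapCounit κ')) := by
  rw [sq_compCounit, ← F.sq_mapCell_comp (sq_compCounit hk κ κ').symm, Category.assoc,
    reassoc_of% F.sq_muHom_mapCell_resCell, sq_mapCounit _ κ']

/-- A double functor preserves companions. -/
def mapCompanion {f : x ⟶ y} (C : Companion f) : Companion (F.map f) where
  pro := F.mapPro C.pro
  unit := compCell ((Category.id_comp _).trans (F.map_id x)) (Category.id_comp _) (F.iotaHom x)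
    (F.mapCell C.unit)
  counit := F.mapCounit C.counit
  hcomp_eq := by
    apply sq_injective
    have h₁ := sq_hcomp_comp (α := F.iotaHom x) (β := idCell (F.mapPro C.pro))
      (α' := F.mapCell C.unit) (β' := F.mapCounit C.counit)
      (sq_compCell ((Category.id_comp _).trans (F.map_id x)) (Category.id_comp _) _ _).symm
      (Category.id_comp _)
    have h₂ := sq_hcomp_comp (α := F.mapCell C.unit) (β := F.mapCell C.counit)
      (α' := idCell (F.mapPro C.pro)) (β' := F.iotaInv y) (Category.comp_id _)
      (F.sq_mapCounit C.counit).symm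
    have h₃ : sq (F.mapCell (hcomp C.unit C.counit)) =
        sq (F.mapCell (leftHom C.pro)) ≫ sq (F.mapCell (rightInv C.pro)) := by
      rw [C.hcomp_eq]
      exact (F.sq_mapCell_comp (sq_compCell _ _ _ _).symm).symm
    have h₄ : sq (F.mapCell (rightInv C.pro)) ≫ sq (F.muInv _ _) ≫
        sq (hcomp (idCell (F.mapPro C.pro)) (F.iotaInv y)) ≫ sq (rightHom (F.mapPro C.pro)) =
          𝟙 _ := by
      rw [← F.sq_muHom_mapCell_rightHom, reassoc_of% F.sq_muInv_muHom,
        F.sq_mapCell_comp (sq_rightInv_rightHom C.pro), F.sq_mapCell_id]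
    have h₅ := sq_hcomp_comp (α := F.iotaHom x) (β := idCell (F.mapPro C.pro))
      (α' := F.iotaInv x) (β' := idCell (F.mapPro C.pro)) (α'' := idCell _) (β'' := idCell _)
      (F.sq_iotaHom_iotaInv x) (Category.id_comp _)
    have h₆ := F.sq_mu_naturality C.unit C.counit
    rw [h₃] at h₆
    have h₇ : sq (hcomp (F.mapCell C.unit) (F.mapCell C.counit)) =
        sq (F.muHom (idPro x) C.pro) ≫ sq (F.mapCell (leftHom C.pro)) ≫
          sq (F.mapCell (rightInv C.pro)) ≫ sq (F.muInv C.pro (idPro y)) := by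
      have := h₆ =≫ sq (F.muInv C.pro (idPro y))
      simpa only [Category.assoc, sq_muHom_muInv, Category.comp_id] using this
    rw [← h₁, ← h₂, h₇, sq_compCell]
    simp only [Category.assoc]
    rw [reassoc_of% F.sq_muHom_mapCell_leftHom, reassoc_of% h₅, sq_hcomp_idCell, Category.id_comp]
    congr 1
    have h₈ := h₄ =≫ sq (rightInv (F.mapPro C.pro))
    simpa only [Category.assoc, sq_rightHom_rightInv, Category.comp_id, Category.id_comp] using h₈
  comp_eq := by
    apply sq_injective
    rw [sq_compCell, sq_compCell, sq_mapCounit, Category.assoc,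
      ← Category.assoc (sq (F.mapCell C.unit)),
      F.sq_mapCell_comp (C.sq_unit_counit), ← reassoc_of% F.sq_iota_naturality,
      sq_iotaHom_iotaInv, Category.comp_id]

/-! ### The underlying pseudofunctor of a double functor -/

/-- An action of `F` on globular cells that agrees with `F.mapGlob`. It allows the pseudofunctor
underlying `F` to act on 2-cells by a definitionally simpler expression than `F.mapGlob`. -/
structure GlobAction where
  /-- the action on globular cells -/
  map {x y : D} {m n : Pro x y} (α : m ⟶ n) : F.mapPro m ⟶ F.mapPro n
  map_eq {x y : D} {m n : Pro x y} (α : m ⟶ n) : map α = F.mapGlob α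

variable {F} in
theorem GlobAction.sq_map (A : F.GlobAction) {m n : Pro x y} (α : m ⟶ n) :
    sq (f := 𝟙 (F.obj x)) (g := 𝟙 (F.obj y)) (A.map α) =
      sq (F.mapCell (f := 𝟙 x) (g := 𝟙 y) α) := by
  rw [A.map_eq, F.sq_mapGlob]

/-- The pseudofunctor between underlying bicategories induced by a double functor. -/
def underlying (A : F.GlobAction) : UnderlyingBicategory D ⥤ᵖ UnderlyingBicategory E where
  obj x := ⟨F.obj x.as⟩
  map m := F.mapPro m
  map₂ α := A.map α
  map₂_id m := (A.map_eq _).trans (F.mapGlob_id m)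
  map₂_comp α β := by
    have h : A.map (α ≫ β) = A.map α ≫ A.map β := by
      rw [A.map_eq, A.map_eq, A.map_eq, F.mapGlob_comp]
    exact h
  mapId x := (F.iota x.as).symm
  mapComp m n := (F.mu m n).symm
  map₂_whisker_left m _ _ β := by
    have h := F.ghcomp_mapGlob (𝟙 m) β
    rw [mapGlob_id, ← Iso.inv_comp_eq, ← A.map_eq, ← A.map_eq] at h
    exact h.symm
  map₂_whisker_right α n := by
    have h := F.ghcomp_mapGlob α (𝟙 n)
    rw [mapGlob_id, ← Iso.inv_comp_eq, ← A.map_eq, ← A.map_eq] at h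
    exact h.symm
  map₂_associator m n p := by
    have h₀ := ghcomp_comp (F.mu m n).inv (𝟙 (F.mapPro p)) (F.mu m n).hom (𝟙 (F.mapPro p))
    rw [Iso.inv_hom_id, Category.id_comp, ghcomp_id] at h₀
    have h : A.map (assocIso m n p).hom = (F.mu (compPro m n) p).inv ≫
        ghcomp (F.mu m n).inv (𝟙 (F.mapPro p)) ≫ (assocIso _ _ _).hom ≫
          ghcomp (𝟙 (F.mapPro m)) (F.mu n p).hom ≫ (F.mu m (compPro n p)).hom := by
      rw [A.map_eq, ← F.mu_assoc, ← reassoc_of% h₀, Iso.inv_hom_id_assoc]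
      rfl
    exact h
  map₂_left_unitor {x y} m := by
    have h₀ := ghcomp_comp (F.iota x.as).inv (𝟙 (F.mapPro m)) (F.iota x.as).hom (𝟙 (F.mapPro m))
    rw [Iso.inv_hom_id, Category.id_comp, ghcomp_id] at h₀
    have h : A.map (leftIso m).hom = (F.mu (idPro x.as) m).inv ≫
        ghcomp (F.iota x.as).inv (𝟙 (F.mapPro m)) ≫ (leftIso (F.mapPro m)).hom := by
      rw [A.map_eq, ← F.mu_left, ← reassoc_of% h₀, Iso.inv_hom_id_assoc]
      rfl
    exact h
  map₂_right_unitor {x y} m := by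
    have h₀ := ghcomp_comp (𝟙 (F.mapPro m)) (F.iota y.as).inv (𝟙 (F.mapPro m)) (F.iota y.as).hom
    rw [Iso.inv_hom_id, Category.id_comp, ghcomp_id] at h₀
    have h : A.map (rightIso m).hom = (F.mu m (idPro y.as)).inv ≫
        ghcomp (𝟙 (F.mapPro m)) (F.iota y.as).inv ≫ (rightIso (F.mapPro m)).hom := by
      rw [A.map_eq, ← F.mu_right, ← reassoc_of% h₀, Iso.inv_hom_id_assoc]
      rfl
    exact h

end DoubleFunctor

/-! ### Oplax transformations from companions -/

section Mates

variable {D : Type u} [DoubleCategory.{c, w, v, u} D] {x y z t x' y' z' x'' y'' : D}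

theorem mate_naturality {f : x ⟶ x'} {g : y ⟶ y'} (C : Companion f) (C' : Companion g)
    {m m' : Pro x y} {n n' : Pro x' y'} (β : m ⟶ m') (β' : n ⟶ n') (α : Cell f m n g)
    (α' : Cell f m' n' g)
    (h : sq (f := 𝟙 x) (g := 𝟙 y) β ≫ sq α' = sq α ≫ sq (f := 𝟙 x') (g := 𝟙 y') β') :
    ghcomp β (𝟙 C'.pro) ≫ mate C C' α' = mate C C' α ≫ ghcomp (𝟙 C.pro) β' := by
  apply C.resCell_injective (h := 𝟙 x) (k := 𝟙 y')
  let γ : Cell f m n' g := compCell (Category.id_comp f) (Category.id_comp g) β α'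
  have hγ : sq γ = sq (f := 𝟙 x) (g := 𝟙 y) β ≫ sq α' := sq_compCell _ _ _ _
  have h₁ : sq (f := 𝟙 x) (g := 𝟙 y') (ghcomp β (𝟙 C'.pro)) ≫ sq (hcomp α' C'.counit) =
      sq (hcomp γ C'.counit) :=
    sq_hcomp_comp (f := 𝟙 x) (g := 𝟙 y) (h := 𝟙 y') hγ.symm (Category.id_comp _)
  have h₂ := sq_hcomp_comp (f' := 𝟙 x') (g' := 𝟙 y') (α := α) (β := C'.counit) (α' := β')
    (β' := hid (𝟙 y')) (α'' := γ) (β'' := C'.counit) (hγ.trans h).symm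
    (by rw [sq_hid_id, Category.comp_id])
  have h₃ : sq (f := 𝟙 x) (g := 𝟙 y') (ghcomp (𝟙 C.pro) β') ≫ sq (resCell C.counit n') =
    sq (resCell C.counit n) ≫ sq (f := 𝟙 x') (g := 𝟙 y') β' :=
    sq_resCell_naturality C.counit (g := 𝟙 y') β'
  rw [sq_comp, sq_comp, Category.assoc, Category.assoc, isMate_mate C C' α', h₃,
    reassoc_of% (isMate_mate C C' α), reassoc_of% h₁, ← h₂, Category.assoc]
  congr 1
  exact sq_right_naturality (f := 𝟙 x') (g := 𝟙 y') β'

theorem mate_id {f : x ⟶ x'} (C : Companion f) {m : Pro x x} {n : Pro x' x'} (μ : m ⟶ idPro x)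
    (ν : n ⟶ idPro x') (α : Cell f m n f)
    (h : sq α ≫ sq (f := 𝟙 x') (g := 𝟙 x') ν = sq (f := 𝟙 x) (g := 𝟙 x) μ ≫ sq (hid f)) :
    mate C C α ≫ ghcomp (𝟙 C.pro) ν =
      ghcomp μ (𝟙 C.pro) ≫ (leftIso C.pro).hom ≫ (rightIso C.pro).inv := by
  have e : mate C C (hid f) = (leftIso C.pro).hom ≫ (rightIso C.pro).inv := by
    apply C.resCell_injective (h := 𝟙 x) (k := 𝟙 x')
    have h₁ : sq (f := 𝟙 x) (g := 𝟙 x') ((leftIso C.pro).hom ≫ (rightIso C.pro).inv) =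
      sq (leftHom C.pro) ≫ sq (rightInv C.pro) := sq_comp _ _
    rw [isMate_mate C C, h₁, resCell_idPro, Category.assoc,
      reassoc_of% sq_rightInv_rightHom, ← leftHom_idPro, sq_left_naturality]
  rw [← e]
  exact (mate_naturality C C μ ν α (hid f) h.symm).symm

theorem mate_comp {f : x ⟶ x'} {g : y ⟶ y'} {h : z ⟶ z'} (C : Companion f) (C' : Companion g)
    (C'' : Companion h) {m : Pro x y} {n : Pro y z} {k : Pro x z} {m' : Pro x' y'} {n' : Pro y' z'}
    {k' : Pro x' z'} (μ : k ⟶ compPro m n) (ν : k' ⟶ compPro m' n') (α : Cell f m m' g)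
    (β : Cell g n n' h) (γ : Cell f k k' h)
    (e : sq γ ≫ sq (f := 𝟙 x') (g := 𝟙 z') ν =
      sq (f := 𝟙 x) (g := 𝟙 z) μ ≫ sq (hcomp α β)) :
    mate C C'' γ ≫ ghcomp (𝟙 C.pro) ν =
      ghcomp μ (𝟙 C''.pro) ≫ (assocIso _ _ _).hom ≫ ghcomp (𝟙 m) (mate C' C'' β) ≫
        (assocIso _ _ _).inv ≫ ghcomp (mate C C' α) (𝟙 n') ≫ (assocIso _ _ _).hom := by
  -- By naturality of mates it suffices to compute the mate of an external composite.
  have key : mate C C'' (hcomp α β) = (assocIso _ _ _).hom ≫ ghcomp (𝟙 m) (mate C' C'' β) ≫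
        (assocIso _ _ _).inv ≫ ghcomp (mate C C' α) (𝟙 n') ≫ (assocIso _ _ _).hom := by
    apply C.resCell_injective (h := 𝟙 x) (k := 𝟙 z')
    let N : Cell (𝟙 x) (compPro m C'.pro) (compPro C.pro m') (𝟙 y') := mate C C' α
    let N' : Cell (𝟙 y) (compPro n C''.pro) (compPro C'.pro n') (𝟙 z') := mate C' C'' β
    have hN : sq N ≫ sq (resCell C.counit m') = sq (hcomp α C'.counit) ≫ sq (rightHom m') :=
      isMate_mate C C' α
    have hN' : sq N' ≫ sq (resCell C'.counit n') = sq (hcomp β C''.counit) ≫ sq (rightHom n') :=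
      isMate_mate C' C'' β
    have h₀ : sq (f := 𝟙 x) (g := 𝟙 z') ((assocIso m n C''.pro).hom ≫
        ghcomp (𝟙 m) (mate C' C'' β) ≫ (assocIso m C'.pro n').inv ≫
          ghcomp (mate C C' α) (𝟙 n') ≫ (assocIso C.pro m' n').hom) =
        sq (assocHom m n C''.pro) ≫ sq (hcomp (idCell m) N') ≫ sq (assocInv m C'.pro n') ≫
          sq (hcomp N (idCell n')) ≫ sq (assocHom C.pro m' n') := by
      rw [sq_comp, sq_comp, sq_comp, sq_comp]; rfl
    have h₁ := sq_hcomp_comp (α := N) (β := idCell n') (α' := resCell C.counit m')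
      (β' := idCell n') (α'' := compCell (Category.comp_id f) (Category.comp_id (𝟙 y'))
        (hcomp α C'.counit) (rightHom m')) (β'' := idCell n') (by rw [sq_compCell]; exact hN)
        (Category.id_comp _)
    have h₂ := sq_hcomp_comp (α := hcomp α C'.counit) (β := idCell n') (α' := rightHom m')
      (β' := idCell n') (sq_compCell (Category.comp_id f) (Category.comp_id (𝟙 y')) _ _).symm
      (Category.id_comp (sq (idCell n')))
    have h₃ := sq_hcomp_comp (α := idCell m) (β := N') (α' := α) (β' := resCell C'.counit n')
      (α'' := α) (β'' := compCell (Category.comp_id g) (Category.comp_id (𝟙 z'))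
        (hcomp β C''.counit) (rightHom n')) (Category.id_comp _) (by rw [sq_compCell]; exact hN')
    have h₄ := sq_hcomp_comp (α := α) (β := hcomp β C''.counit) (α' := idCell m')
      (β' := rightHom n') (Category.comp_id (sq α))
      (sq_compCell (Category.comp_id g) (Category.comp_id (𝟙 z')) _ _).symm
    rw [isMate_mate C C'', h₀]
    simp only [Category.assoc]
    rw [sq_assoc_resCell, h₁, ← h₂, sq_assocInv_hcomp_resCell, h₃, ← h₄,
      ← reassoc_of% sq_assoc_naturality, sq_assoc_rightHom]
  rw [← key]
  exact (mate_naturality C C'' μ ν γ (hcomp α β) e.symm).symm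

end Mates

/-- An arrow-valued transformation between pseudofunctors to the underlying bicategory of a double
category: its components are arrows at objects and cells at 1-cells, compatible with 2-cells and
with the comparison isomorphisms. -/
structure ArrowTrans {B : Type u₁} [Bicategory.{w₁, v₁} B] {E : Type u₂}
    [DoubleCategory.{c₂, w₂, v₂, u₂} E] (K L : B ⥤ᵖ UnderlyingBicategory E) where
  /-- the component at an object -/
  app (x : B) : (K.obj x).as ⟶ (L.obj x).as
  /-- the component at a 1-cell -/
  cell {x y : B} (m : x ⟶ y) : Cell (app x) (K.map m) (L.map m) (app y)
  naturality {x y : B} {m n : x ⟶ y} (β : m ⟶ n) :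
    sq (f := 𝟙 (K.obj x).as) (g := 𝟙 (K.obj y).as) (K.map₂ β) ≫ sq (cell n) =
      sq (cell m) ≫ sq (f := 𝟙 (L.obj x).as) (g := 𝟙 (L.obj y).as) (L.map₂ β)
  id (x : B) :
    sq (cell (𝟙 x)) ≫ sq (f := 𝟙 (L.obj x).as) (g := 𝟙 (L.obj x).as) (L.mapId x).hom =
      sq (f := 𝟙 (K.obj x).as) (g := 𝟙 (K.obj x).as) (K.mapId x).hom ≫ sq (hid (app x))
  comp {x y z : B} (m : x ⟶ y) (n : y ⟶ z) :
    sq (cell (m ≫ n)) ≫ sq (f := 𝟙 (L.obj x).as) (g := 𝟙 (L.obj z).as) (L.mapComp m n).hom =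
      sq (f := 𝟙 (K.obj x).as) (g := 𝟙 (K.obj z).as) (K.mapComp m n).hom ≫
        sq (hcomp (cell m) (cell n))

/-- An arrow-valued transformation whose components have companions gives an oplax natural
transformation: its components are the companions, and its comparison cells are mates. -/
def ArrowTrans.toOplax {B : Type u₁} [Bicategory.{w₁, v₁} B] {E : Type u₂}
    [DoubleCategory.{c₂, w₂, v₂, u₂} E] {K L : B ⥤ᵖ UnderlyingBicategory E} (T : ArrowTrans K L)
    (C : ∀ x, Companion (T.app x)) : OplaxNat K L where
  app x := (C x).pro
  naturality {x y} m := mate (C x) (C y) (T.cell m)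
  naturality_naturality {x y m n} β :=
    mate_naturality (C x) (C y) (K.map₂ β) (L.map₂ β) (T.cell m) (T.cell n) (T.naturality β)
  naturality_id x := mate_id (C x) (K.mapId x).hom (L.mapId x).hom (T.cell (𝟙 x)) (T.id x)
  naturality_comp {x y z} m n := mate_comp (C x) (C y) (C z) (K.mapComp m n).hom
    (L.mapComp m n).hom (T.cell m) (T.cell n) (T.cell (m ≫ n)) (T.comp m n)

/-! ### Composite companions of identity arrows -/

/-- The composite of the companions of `f` and `g` is isomorphic to the identity proarrow if
`f ≫ g` is the identity. -/
def compCounitIso {D : Type u} [DoubleCategory.{c, w, v, u} D] {x y : D} {f : x ⟶ y} {g : y ⟶ x}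
    (C : Companion f) (C' : Companion g) (hk : f ≫ g = 𝟙 x) :
    compPro C.pro C'.pro ≅ idPro x := by
  let V : Cell f (idPro x) C'.pro (𝟙 x) := compCell (Category.comp_id f) hk (hid f) C'.unit
  let e : Cell (𝟙 x) (compPro C.pro C'.pro) (idPro x) (𝟙 x) := compCounit hk C.counit C'.counit
  let η : Cell (𝟙 x) (idPro x) (compPro C.pro C'.pro) (𝟙 x) :=
    compCell (Category.id_comp (𝟙 x)) (Category.id_comp (𝟙 x)) (leftInv (idPro x))
      (hcomp C.unit V)
  have hη : sq η = sq (leftInv (idPro x)) ≫ sq (hcomp C.unit V) := sq_compCell _ _ _ _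
  have hV : sq V = sq (hid f) ≫ sq C'.unit := sq_compCell _ _ _ _
  have he : sq e = sq (resCell C.counit C'.pro) ≫ sq C'.counit := sq_compCounit _ _ _
  have h₁ : sq η ≫ sq e = 𝟙 _ := by
    have h := sq_hcomp_comp (α := C.unit) (β := V) (α' := C.counit) (β' := idCell C'.pro)
      (α'' := hid f) (β'' := V) C.sq_unit_counit (Category.comp_id _)
    rw [hη, he, sq_resCell, Category.assoc, Category.assoc, reassoc_of% h,
      reassoc_of% sq_left_naturality, reassoc_of% sq_leftInv_leftHom, hV, Category.assoc,
      C'.sq_unit_counit, ← sq_hid_comp, hk, sq_hid_id]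
  -- The other composite is tested against the counits of `C` and then of `C'`, that is, against `e`.
  have h₂ : sq e ≫ sq η ≫ sq (resCell C.counit C'.pro) = sq (resCell C.counit C'.pro) := by
    have h := C'.counit_injective (β := compCell (Category.id_comp f)
      (Category.id_comp (𝟙 x))
      (compCell (Category.id_comp (𝟙 x)) (Category.id_comp (𝟙 x)) e η) (resCell C.counit C'.pro))
      (β' := resCell C.counit C'.pro) (by
        rw [sq_compCell, sq_compCell, Category.assoc, Category.assoc, ← he, h₁, Category.comp_id])
    have h' := congrArg sq h
    rwa [sq_compCell, sq_compCell, Category.assoc] at h'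
  exact
    { hom := e
      inv := η
      hom_inv_id := by
        apply C.resCell_injective (h := 𝟙 x) (k := 𝟙 x)
        have h : sq (f := 𝟙 x) (g := 𝟙 x) (𝟙 (compPro C.pro C'.pro)) = 𝟙 _ := rfl
        rw [h, Category.id_comp]
        exact (congrArg (· ≫ _) (sq_compCell _ _ e η)).trans ((Category.assoc _ _ _).trans h₂)
      inv_hom_id := sq_injective ((sq_compCell _ _ η e).trans h₁) }

theorem compCounitIso_inv {D : Type u} [DoubleCategory.{c, w, v, u} D] {x y : D} {f : x ⟶ y}
    {g : y ⟶ x} (C : Companion f) (C' : Companion g) (hk : f ≫ g = 𝟙 x) :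
    sq (f := 𝟙 x) (g := 𝟙 x) (compCounitIso C C' hk).inv ≫
      sq (compCounit hk C.counit C'.counit) = 𝟙 _ :=
  (sq_comp _ _).symm.trans (congrArg (sq (f := 𝟙 x) (g := 𝟙 x)) (compCounitIso C C' hk).inv_hom_id)

theorem leftIso_injective {D : Type u} [DoubleCategory.{c, w, v, u} D] {x y : D} {X n : Pro x y}
    {β β' : X ⟶ compPro (idPro x) n}
    (e : sq (f := 𝟙 x) (g := 𝟙 y) β ≫ sq (resCell (idCell (idPro x)) n) =
      sq (f := 𝟙 x) (g := 𝟙 y) β' ≫ sq (resCell (idCell (idPro x)) n)) : β = β' := by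
  rw [sq_resCell, sq_hcomp_idCell, Category.id_comp] at e
  have h := e =≫ sq (leftInv n)
  simp only [Category.assoc, sq_leftHom_leftInv, Category.comp_id] at h
  exact sq_injective h

/-! ### The swallowtail identities -/

section Swallowtails

variable {D : Type u} [DoubleCategory.{c, w, v, u} D] {x x₁ x₂ : D}

/-- The swallowtail identity of the unit, in terms of mates. -/
theorem swallowtail_unit_of_isMate {f : x ⟶ x₁} {g f' : x₁ ⟶ x₂} {r : x₂ ⟶ x₁} (C : Companion f)
    {Q P' : Pro x₁ x₂} {R : Pro x₂ x₁} {κQ : Cell g Q (idPro x₂) (𝟙 x₂)}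
    {κP' : Cell f' P' (idPro x₂) (𝟙 x₂)} {κR : Cell r R (idPro x₁) (𝟙 x₁)}
    (hg : g ≫ r = 𝟙 x₁) (hf' : f' ≫ r = 𝟙 x₁)
    {α : Cell f C.pro P' g} (hα : sq α ≫ sq κP' = sq C.counit ≫ sq (hid g))
    {N : compPro C.pro Q ⟶ compPro C.pro P'} (hN : IsMate C.counit κQ N α)
    {τ : idPro x₁ ⟶ compPro Q R}
    (hτ : sq (f := 𝟙 x₁) (g := 𝟙 x₁) τ ≫ sq (compCounit hg κQ κR) = 𝟙 _)
    {σ : compPro P' R ⟶ idPro x₁}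
    (hσ : sq (f := 𝟙 x₁) (g := 𝟙 x₁) σ = sq (compCounit hf' κP' κR)) :
    (rightIso C.pro).inv ≫ ghcomp (𝟙 C.pro) τ ≫ (assocIso C.pro Q R).inv ≫ ghcomp N (𝟙 R) ≫
      (assocIso C.pro P' R).hom ≫ ghcomp (𝟙 C.pro) σ ≫ (rightIso C.pro).hom = 𝟙 C.pro := by
  apply C.counit_injective (h := 𝟙 x) (k := 𝟙 x₁)
  let N' : Cell (𝟙 x) (compPro C.pro Q) (compPro C.pro P') (𝟙 x₂) := N
  let τ' : Cell (𝟙 x₁) (idPro x₁) (compPro Q R) (𝟙 x₁) := τ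
  let σ' : Cell (𝟙 x₁) (compPro P' R) (idPro x₁) (𝟙 x₁) := σ
  have e : sq (f := 𝟙 x) (g := 𝟙 x₁) ((rightIso C.pro).inv ≫ ghcomp (𝟙 C.pro) τ ≫
      (assocIso C.pro Q R).inv ≫ ghcomp N (𝟙 R) ≫ (assocIso C.pro P' R).hom ≫
        ghcomp (𝟙 C.pro) σ ≫ (rightIso C.pro).hom) =
      sq (rightInv C.pro) ≫ sq (hcomp (idCell C.pro) τ') ≫ sq (assocInv C.pro Q R) ≫
        sq (hcomp N' (idCell R)) ≫ sq (assocHom C.pro P' R) ≫ sq (hcomp (idCell C.pro) σ') ≫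
          sq (rightHom C.pro) := by
    rw [sq_comp, sq_comp, sq_comp, sq_comp, sq_comp, sq_comp]; rfl
  have e' : sq (f := 𝟙 x) (g := 𝟙 x₁) (𝟙 C.pro) = 𝟙 _ := rfl
  have hN' : sq N' ≫ sq (resCell C.counit P') = sq (hcomp α κQ) ≫ sq (rightHom P') := hN
  have h₁ := sq_hcomp_comp (α := N') (β := idCell R) (α' := resCell C.counit P')
    (β' := idCell R) (sq_compCell (Category.id_comp f) (Category.id_comp (𝟙 x₂)) _ _).symm
    (Category.id_comp (sq (idCell R)))
  have h₂ := sq_hcomp_comp (α := compCell (Category.id_comp f) (Category.id_comp (𝟙 x₂)) N'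
    (resCell C.counit P')) (β := idCell R) (α' := κP') (β' := idCell R)
    (α'' := compCell rfl (Category.comp_id (𝟙 x₂)) (resCell C.counit Q) κQ) (β'' := idCell R)
    (by rw [sq_compCell, sq_compCell, hN', Category.assoc, sq_hcomp_rightHom_counit hα])
    (Category.id_comp (sq (idCell R)))
  have h₃ := sq_hcomp_comp (α := resCell C.counit Q) (β := idCell R) (α' := κQ) (β' := idCell R)
    (sq_compCell rfl (Category.comp_id (𝟙 x₂)) _ _).symm (Category.id_comp (sq (idCell R)))
  rw [e, e', Category.id_comp]
  simp only [Category.assoc]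
  -- Move the cartesian cell of `C` backwards past `σ` and the mate `N`; then `hα` turns the pasting
  -- of `α` with the counit of `P'` into the counit of `C ⊗ Q`.
  rw [← resCell_idPro, sq_resCell_naturality, reassoc_of% sq_assoc_resCell, reassoc_of% h₁]
  -- What is left of the pasting is `τ` followed by the composite counit, which cancel.
  have hσ' : sq σ' = sq (compCounit hf' κP' κR) := hσ
  have hτ' : sq τ' ≫ sq (compCounit hg κQ κR) = 𝟙 _ := hτ
  rw [hσ', sq_compCounit, sq_resCell κP', Category.assoc, reassoc_of% h₂, ← h₃, Category.assoc,
    ← sq_assoc_resCell, ← reassoc_of% (sq_resCell κQ R), ← sq_compCounit hg,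
    Category.assoc, reassoc_of% sq_assocInv_assocHom, reassoc_of% sq_resCell_naturality, hτ', Category.comp_id,
    resCell_idPro, reassoc_of% sq_rightInv_rightHom]

/-- The swallowtail identity of the counit, in terms of mates. -/
theorem swallowtail_counit_of_isMate {h : x₁ ⟶ x} {a : x₁ ⟶ x₂} {b h' : x₂ ⟶ x₁} (C : Companion h)
    {A : Pro x₁ x₂} {Q P' : Pro x₂ x₁} {κA : Cell a A (idPro x₂) (𝟙 x₂)}
    {κQ : Cell b Q (idPro x₁) (𝟙 x₁)} {κP' : Cell h' P' (idPro x₁) (𝟙 x₁)}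
    (hb : a ≫ b = 𝟙 x₁) (hh' : a ≫ h' = 𝟙 x₁)
    {β : Cell b P' C.pro h} (hβ : sq β ≫ sq C.counit = sq κP' ≫ sq (hid h))
    {N : compPro P' C.pro ⟶ compPro Q C.pro} (hN : IsMate κQ C.counit N β)
    {τ : idPro x₁ ⟶ compPro A P'}
    (hτ : sq (f := 𝟙 x₁) (g := 𝟙 x₁) τ ≫ sq (compCounit hh' κA κP') = 𝟙 _)
    {σ : compPro A Q ⟶ idPro x₁}
    (hσ : sq (f := 𝟙 x₁) (g := 𝟙 x₁) σ = sq (compCounit hb κA κQ)) :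
    (leftIso C.pro).inv ≫ ghcomp τ (𝟙 C.pro) ≫ (assocIso A P' C.pro).hom ≫ ghcomp (𝟙 A) N ≫
      (assocIso A Q C.pro).inv ≫ ghcomp σ (𝟙 C.pro) ≫ (leftIso C.pro).hom = 𝟙 C.pro := by
  apply C.counit_injective (h := 𝟙 x₁) (k := 𝟙 x)
  let N' : Cell (𝟙 x₂) (compPro P' C.pro) (compPro Q C.pro) (𝟙 x) := N
  let τ' : Cell (𝟙 x₁) (idPro x₁) (compPro A P') (𝟙 x₁) := τ
  let σ' : Cell (𝟙 x₁) (compPro A Q) (idPro x₁) (𝟙 x₁) := σ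
  have e : sq (f := 𝟙 x₁) (g := 𝟙 x) ((leftIso C.pro).inv ≫ ghcomp τ (𝟙 C.pro) ≫
      (assocIso A P' C.pro).hom ≫ ghcomp (𝟙 A) N ≫ (assocIso A Q C.pro).inv ≫
        ghcomp σ (𝟙 C.pro) ≫ (leftIso C.pro).hom) =
      sq (leftInv C.pro) ≫ sq (hcomp τ' (idCell C.pro)) ≫ sq (assocHom A P' C.pro) ≫
        sq (hcomp (idCell A) N') ≫ sq (assocInv A Q C.pro) ≫ sq (hcomp σ' (idCell C.pro)) ≫
          sq (leftHom C.pro) := by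
    rw [sq_comp, sq_comp, sq_comp, sq_comp, sq_comp, sq_comp]; rfl
  have e' : sq (f := 𝟙 x₁) (g := 𝟙 x) (𝟙 C.pro) = 𝟙 _ := rfl
  have hN' : sq N' ≫ sq (resCell κQ C.pro) = sq (hcomp β C.counit) ≫ sq (rightHom C.pro) := hN
  have hσ' : sq σ' = sq (compCounit hb κA κQ) := hσ
  have h₁ := sq_hcomp_comp (α := τ') (β := idCell C.pro) (α' := compCounit hh' κA κP')
    (β' := idCell C.pro) (α'' := idCell (idPro x₁)) (β'' := idCell C.pro) hτ (Category.id_comp _)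
  rw [e, e', Category.id_comp]
  simp only [Category.assoc]
  -- By `hσ` the last steps form the composite counit of `A`, `Q` and `C`; the mate `N` and `hβ`
  -- replace it by that of `A`, `P'` and `C`, whose first part is inverse to `τ`.
  rw [sq_hcomp_congr hσ' (rfl : sq (idCell C.pro) = _), ← reassoc_of% (sq_resCell
    (compCounit hb κA κQ) C.pro), ← sq_assoc_resCell_resCell hb, Category.assoc, Category.assoc,
    reassoc_of% sq_assocInv_assocHom, reassoc_of% sq_resCell_naturality, reassoc_of% hN',
    sq_hcomp_rightHom_counit hβ, reassoc_of% (sq_assoc_resCell_resCell hh'), sq_resCell,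
    Category.assoc, reassoc_of% h₁, sq_hcomp_idCell, Category.id_comp,
    reassoc_of% sq_leftInv_leftHom]

end Swallowtails

/-! ### From double adjunctions to lax adjunctions -/

section DoubleTrans

variable {D : Type u₁} [DoubleCategory.{c₁, w₁, v₁, u₁} D]
  {E : Type u₂} [DoubleCategory.{c₂, w₂, v₂, u₂} E]

namespace DoubleTrans

variable {H K : DoubleFunctor D E} (T : DoubleTrans H K)

theorem sq_cell_naturality {x y x' y' : D} {f : x ⟶ x'} {m : Pro x y} {n : Pro x' y'}
    {g : y ⟶ y'} (α : Cell f m n g) :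
    sq (H.mapCell α) ≫ sq (T.cell n) = sq (T.cell m) ≫ sq (K.mapCell α) :=
  (sq_compCell _ _ _ _).symm.trans ((congrArg sq (T.cell_naturality α)).trans (sq_compCell _ _ _ _))

theorem sq_cell_comp {x y z : D} (m : Pro x y) (n : Pro y z) :
    sq (T.cell (compPro m n)) ≫ sq (K.muInv m n) =
      sq (H.muInv m n) ≫ sq (hcomp (T.cell m) (T.cell n)) := by
  have h : sq (hcomp (T.cell m) (T.cell n)) ≫ sq (K.muHom m n) =
      sq (H.muHom m n) ≫ sq (T.cell (compPro m n)) :=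
    (sq_compCell _ _ _ _).symm.trans ((congrArg sq (T.cell_comp m n)).trans (sq_compCell _ _ _ _))
  have h' := sq (H.muInv m n) ≫= h =≫ sq (K.muInv m n)
  simp only [Category.assoc, DoubleFunctor.sq_muHom_muInv, Category.comp_id] at h'
  rw [h', reassoc_of% H.sq_muInv_muHom]

theorem sq_cell_id (x : D) :
    sq (T.cell (idPro x)) ≫ sq (K.iotaInv x) = sq (H.iotaInv x) ≫ sq (hid (T.app x)) := by
  have h : sq (hid (T.app x)) ≫ sq (K.iotaHom x) = sq (H.iotaHom x) ≫ sq (T.cell (idPro x)) :=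
    (sq_compCell _ _ _ _).symm.trans ((congrArg sq (T.cell_id x)).trans (sq_compCell _ _ _ _))
  have h' := sq (H.iotaInv x) ≫= h =≫ sq (K.iotaInv x)
  simp only [Category.assoc, DoubleFunctor.sq_iotaHom_iotaInv, Category.comp_id] at h'
  rw [h', reassoc_of% H.sq_iotaInv_iotaHom]

end DoubleTrans

variable {F : DoubleFunctor D E} {G : DoubleFunctor E D}

theorem DoubleFunctor.GlobAction.comp_map_iotaInv (B : G.GlobAction) (x : D) :
    B.map (F.iota x).inv ≫ (G.iota (F.obj x)).inv = ((F.comp G).iota x).inv := by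
  rw [B.map_eq]; rfl

theorem DoubleFunctor.GlobAction.comp_map_muInv (B : G.GlobAction) {x y z : D} (m : Pro x y)
    (n : Pro y z) :
    B.map (F.mu m n).inv ≫ (G.mu (F.mapPro m) (F.mapPro n)).inv = ((F.comp G).mu m n).inv := by
  rw [B.map_eq]; rfl

theorem DoubleFunctor.GlobAction.sq_map_map (A : F.GlobAction) (B : G.GlobAction) {x y : D}
    {m n : Pro x y} (α : m ⟶ n) :
    sq (f := 𝟙 (G.obj (F.obj x))) (g := 𝟙 (G.obj (F.obj y))) (B.map (A.map α)) =
      sq (G.mapCell (F.mapCell (f := 𝟙 x) (g := 𝟙 y) α)) := by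
  rw [B.sq_map]
  exact G.sq_mapCell_congr (A.sq_map α)

/-- The unit of a double adjunction as an arrow-valued transformation. -/
def unitArrowTrans (A : F.GlobAction) (B : G.GlobAction)
    (T : DoubleTrans (DoubleFunctor.id D) (F.comp G)) :
    ArrowTrans (Pseudofunctor.id (UnderlyingBicategory D))
      ((F.underlying A).comp (G.underlying B)) where
  app x := T.app x.as
  cell m := T.cell m
  naturality {x y m _} β := (T.sq_cell_naturality (f := 𝟙 x.as) (g := 𝟙 y.as) β).trans
    (congrArg (sq (T.cell m) ≫ ·) (A.sq_map_map B β).symm)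
  id x := (congrArg (fun γ => sq (T.cell (idPro x.as)) ≫ sq (f := 𝟙 _) (g := 𝟙 _) γ)
    (B.comp_map_iotaInv x.as)).trans (T.sq_cell_id x.as)
  comp m n := (congrArg (fun γ => sq (T.cell (compPro m n)) ≫ sq (f := 𝟙 _) (g := 𝟙 _) γ)
    (B.comp_map_muInv m n)).trans (T.sq_cell_comp m n)

/-- The counit of a double adjunction as an arrow-valued transformation. -/
def counitArrowTrans (A : F.GlobAction) (B : G.GlobAction)
    (T : DoubleTrans (G.comp F) (DoubleFunctor.id E)) :
    ArrowTrans ((G.underlying B).comp (F.underlying A))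
      (Pseudofunctor.id (UnderlyingBicategory E)) where
  app x := T.app x.as
  cell m := T.cell m
  naturality {x y _ n} β := (congrArg (· ≫ sq (T.cell n)) (B.sq_map_map A β)).trans
    (T.sq_cell_naturality (f := 𝟙 x.as) (g := 𝟙 y.as) β)
  id x := (T.sq_cell_id x.as).trans (congrArg (fun γ => sq (f := 𝟙 _) (g := 𝟙 _) γ ≫ _)
    (A.comp_map_iotaInv x.as)).symm
  comp m n := (T.sq_cell_comp m n).trans (congrArg (fun γ => sq (f := 𝟙 _) (g := 𝟙 _) γ ≫ _)
    (A.comp_map_muInv m n)).symm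

theorem DoubleFunctor.GlobAction.isMate_map (A : F.GlobAction) {x y x' y' : D} {f : x ⟶ x'}
    {g : y ⟶ y'} {P : Pro x x'} {Q : Pro y y'} {κP : Cell f P (idPro x') (𝟙 x')}
    {κQ : Cell g Q (idPro y') (𝟙 y')} {m : Pro x y} {n : Pro x' y'}
    {N : compPro m Q ⟶ compPro P n} {α : Cell f m n g} (h : IsMate κP κQ N α) :
    IsMate (F.mapCounit κP) (F.mapCounit κQ)
      ((F.mu m Q).hom ≫ A.map N ≫ (F.mu P n).inv) (F.mapCell α) := by
  rw [A.map_eq]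
  exact F.isMate_map h

/-- The inverse comparison cell of a composite double functor for external identities. -/
def DoubleFunctor.compIotaInv (F : DoubleFunctor D E) (G : DoubleFunctor E D) (x : D) :
    Cell (𝟙 (G.obj (F.obj x))) (G.mapPro (F.mapPro (idPro x))) (idPro (G.obj (F.obj x)))
      (𝟙 (G.obj (F.obj x))) :=
  (F.comp G).iotaInv x

theorem DoubleFunctor.sq_mapCounit_mapCounit (F : DoubleFunctor D E) (G : DoubleFunctor E D)
    {x y : D} {f : x ⟶ y} {P : Pro x y} (κ : Cell f P (idPro y) (𝟙 y)) :
    sq (G.mapCounit (F.mapCounit κ)) =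
      sq (G.mapCell (F.mapCell κ)) ≫ sq (F.compIotaInv G y) := by
  have h : sq (F.compIotaInv G y) = sq (f := 𝟙 (G.obj (F.obj y))) (g := 𝟙 (G.obj (F.obj y)))
      (G.mapGlob (F.iota y).inv) ≫ sq (G.iotaInv (F.obj y)) := sq_comp _ _
  rw [sq_mapCounit, ← G.sq_mapCell_comp (F.sq_mapCounit κ).symm, Category.assoc, h, G.sq_mapGlob]
  rfl

/-- The image of a composite counit under a double functor, transported along the comparison
isomorphisms, is the composite of the images. -/
theorem DoubleFunctor.GlobAction.sq_mu_map_compCounit (A : F.GlobAction) {x y : D} {f : x ⟶ y}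
    {g : y ⟶ x} (hk : f ≫ g = 𝟙 x) (hk' : F.map f ≫ F.map g = 𝟙 (F.obj x)) {P : Pro x y}
    {Q : Pro y x} (κ : Cell f P (idPro y) (𝟙 y)) (κ' : Cell g Q (idPro x) (𝟙 x))
    (σ : compPro P Q ⟶ idPro x)
    (hσ : sq (f := 𝟙 x) (g := 𝟙 x) σ = sq (compCounit hk κ κ')) :
    sq (f := 𝟙 (F.obj x)) (g := 𝟙 (F.obj x)) ((F.mu P Q).hom ≫ A.map σ ≫ (F.iota x).inv) =
      sq (compCounit hk' (F.mapCounit κ) (F.mapCounit κ')) := by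
  rw [← F.sq_muHom_mapCounit_compCounit hk hk', sq_comp, sq_comp, A.sq_map, F.sq_mapCell_congr hσ]
  rfl

theorem DoubleFunctor.GlobAction.sq_map_mu_compCounit (A : F.GlobAction) {x y : D} {f : x ⟶ y}
    {g : y ⟶ x} (hk : f ≫ g = 𝟙 x) (hk' : F.map f ≫ F.map g = 𝟙 (F.obj x)) {P : Pro x y}
    {Q : Pro y x} (κ : Cell f P (idPro y) (𝟙 y)) (κ' : Cell g Q (idPro x) (𝟙 x))
    (τ : idPro x ⟶ compPro P Q)
    (hτ : sq (f := 𝟙 x) (g := 𝟙 x) τ ≫ sq (compCounit hk κ κ') = 𝟙 _) :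
    sq (f := 𝟙 (F.obj x)) (g := 𝟙 (F.obj x)) ((F.iota x).hom ≫ A.map τ ≫ (F.mu P Q).inv) ≫
      sq (compCounit hk' (F.mapCounit κ) (F.mapCounit κ')) = 𝟙 _ := by
  have h : sq (f := 𝟙 (F.obj x)) (g := 𝟙 (F.obj x))
      ((F.iota x).hom ≫ A.map τ ≫ (F.mu P Q).inv) =
      sq (F.iotaHom x) ≫ sq (F.mapCell (f := 𝟙 x) (g := 𝟙 x) τ) ≫ sq (F.muInv P Q) := by
    rw [sq_comp, sq_comp, A.sq_map]
    rfl
  have h' : sq (F.mapCell (f := 𝟙 x) (g := 𝟙 x) τ) ≫ sq (F.mapCell (compCounit hk κ κ')) = 𝟙 _ :=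
    (F.sq_mapCell_comp (γ := idCell (idPro x)) hτ).trans (F.sq_mapCell_id _)
  rw [h, ← F.sq_muHom_mapCounit_compCounit hk hk', Category.assoc, Category.assoc,
    reassoc_of% F.sq_muInv_muHom, reassoc_of% h', F.sq_iotaHom_iotaInv]

namespace DoubleAdjunction

variable (adj : DoubleAdjunction F G)

theorem sq_unit_cell_mapCounit {x : D} {y : D} {f : x ⟶ y} {P : Pro x y}
    (κ : Cell f P (idPro y) (𝟙 y)) :
    sq (adj.unit.cell P) ≫ sq (G.mapCounit (F.mapCounit κ)) =
      sq κ ≫ sq (hid (adj.unit.app y)) := by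
  have h₁ : sq κ ≫ sq (adj.unit.cell (idPro y)) =
    sq (adj.unit.cell P) ≫ sq (G.mapCell (F.mapCell κ)) := adj.unit.sq_cell_naturality κ
  have h₂ : sq (adj.unit.cell (idPro y)) ≫ sq (F.compIotaInv G y) =
    sq (hid (adj.unit.app y)) := (adj.unit.sq_cell_id y).trans (Category.id_comp _)
  exact (congrArg (sq (adj.unit.cell P) ≫ ·) (F.sq_mapCounit_mapCounit G κ)).trans
    ((Category.assoc _ _ _).symm.trans ((congrArg (· ≫ sq (F.compIotaInv G y)) h₁.symm).trans
      ((Category.assoc _ _ _).trans (congrArg (sq κ ≫ ·) h₂))))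

theorem sq_counit_cell_counit {x : E} {y : E} {f : x ⟶ y} {P : Pro x y}
    (κ : Cell f P (idPro y) (𝟙 y)) :
    sq (adj.counit.cell P) ≫ sq κ =
      sq (F.mapCounit (G.mapCounit κ)) ≫ sq (hid (adj.counit.app y)) := by
  have h₁ : sq (F.mapCell (G.mapCell κ)) ≫ sq (adj.counit.cell (idPro y)) =
    sq (adj.counit.cell P) ≫ sq κ := adj.counit.sq_cell_naturality κ
  have h₂ : sq (adj.counit.cell (idPro y)) =
    sq (G.compIotaInv F y) ≫ sq (hid (adj.counit.app y)) :=
    (Category.comp_id _).symm.trans (adj.counit.sq_cell_id y)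
  exact h₁.symm.trans ((congrArg (sq (F.mapCell (G.mapCell κ)) ≫ ·) h₂).trans
    ((Category.assoc _ _ _).symm.trans
      (congrArg (· ≫ sq (hid (adj.counit.app y))) (G.sq_mapCounit_mapCounit F κ).symm)))

theorem map_left_app (x : D) :
    G.map (F.map (adj.unit.app x)) ≫ G.map (adj.counit.app (F.obj x)) = 𝟙 (G.obj (F.obj x)) :=
  (G.map_comp _ _).symm.trans ((congrArg G.map (adj.left_app x)).trans (G.map_id _))

theorem map_right_app (y : E) :
    F.map (adj.unit.app (G.obj y)) ≫ F.map (G.map (adj.counit.app y)) = 𝟙 (F.obj (G.obj y)) :=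
  (F.map_comp _ _).symm.trans ((congrArg F.map (adj.right_app y)).trans (F.map_id _))

open scoped Oplax.OplaxTrans in
/-- A double adjunction whose unit and counit have companions induces a lax adjunction between
underlying pseudofunctors. -/
def laxAdjunction (A : F.GlobAction) (B : G.GlobAction)
    (C : ∀ x, Companion (adj.unit.app x)) (C' : ∀ y, Companion (adj.counit.app y)) :
    LaxAdjunction (F.underlying A) (G.underlying B) where
  unit := (unitArrowTrans A B adj.unit).toOplax fun x => C x.as
  counit := (counitArrowTrans A B adj.counit).toOplax fun y => C' y.as
  s := (Oplax.OplaxTrans.isoMk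
    (fun x => compCounitIso (F.mapCompanion (C x.as)) (C' (F.obj x.as)) (adj.left_app x.as))
    fun {x y} m => IsMate.whisker_eq
      ((A.isMate_map (isMate_mate (C x.as) (C y.as) (adj.unit.cell m))).comp
        (adj.left_app x.as) (adj.left_app y.as)
        (isMate_mate (C' _) (C' _) (adj.counit.cell (F.mapPro m))))
      (isMate_id (F.mapPro m)) (congrArg sq (adj.left_cell m)) _ _ (Category.comp_id _)
      (Category.comp_id _) (fun _ _ => leftIso_injective)).symm
  t := Oplax.OplaxTrans.isoMk
    (fun y => compCounitIso (C (G.obj y.as)) (G.mapCompanion (C' y.as)) (adj.right_app y.as))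
    fun {x y} m => IsMate.whisker_eq
      ((isMate_mate (C _) (C _) (adj.unit.cell (G.mapPro m))).comp
        (adj.right_app x.as) (adj.right_app y.as)
        (B.isMate_map (isMate_mate (C' x.as) (C' y.as) (adj.counit.cell m))))
      (isMate_id (G.mapPro m)) (congrArg sq (adj.right_cell m)) _ _ (Category.comp_id _)
      (Category.comp_id _) (fun _ _ => leftIso_injective)
  swallowtail_unit x := swallowtail_unit_of_isMate (C x.as) (adj.right_app (F.obj x.as))
    (adj.map_left_app x.as) (adj.sq_unit_cell_mapCounit (C x.as).counit)
    (isMate_mate (C x.as) (C (G.obj (F.obj x.as))) _)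
    (compCounitIso_inv (C (G.obj (F.obj x.as))) (G.mapCompanion (C' (F.obj x.as))) _)
    (B.sq_mu_map_compCounit (adj.left_app x.as) _ _ _ _ rfl)
  swallowtail_counit y := swallowtail_counit_of_isMate (C' y.as) (adj.left_app (G.obj y.as))
    (adj.map_right_app y.as) (adj.sq_counit_cell_counit (C' y.as).counit)
    (isMate_mate (C' (F.obj (G.obj y.as))) (C' y.as) _)
    (A.sq_map_mu_compCounit (adj.right_app y.as) _ _ _ _
      (compCounitIso_inv (C (G.obj y.as)) (G.mapCompanion (C' y.as)) _)) rfl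

end DoubleAdjunction

end DoubleTrans

/-! ### Companions are left adjoint to conjoints -/

theorem leftZigzag_eq {B : Type u} [Bicategory.{w, v} B] {a b : B} {f : a ⟶ b} {g : b ⟶ a}
    (η : 𝟙 a ⟶ f ≫ g) (κ : g ≫ f ⟶ 𝟙 b) :
    leftZigzag η κ = η ▷ f ≫ (α_ f g f).hom ≫ f ◁ κ := by
  simp [leftZigzag, bicategoricalComp]

theorem rightZigzag_eq {B : Type u} [Bicategory.{w, v} B] {a b : B} {f : a ⟶ b} {g : b ⟶ a}
    (η : 𝟙 a ⟶ f ≫ g) (κ : g ≫ f ⟶ 𝟙 b) :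
    rightZigzag η κ = g ◁ η ≫ (α_ g f g).inv ≫ κ ▷ g := by
  simp [rightZigzag, bicategoricalComp]

section Conjoints

variable {D : Type u} [DoubleCategory.{c, w, v, u} D] {x y : D}

/-- The unit of the adjunction between a companion and a conjoint. -/
def Companion.adjUnit {f : x ⟶ y} (C : Companion f) (J : Conjoint f) :
    idPro x ⟶ compPro C.pro J.pro :=
  compCell (Category.id_comp (𝟙 x)) (Category.id_comp (𝟙 x)) (leftInv (idPro x))
    (hcomp C.unit J.unit)

/-- The counit of the adjunction between a companion and a conjoint. -/
def Companion.adjCounit {f : x ⟶ y} (C : Companion f) (J : Conjoint f) :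
    compPro J.pro C.pro ⟶ idPro y :=
  compCell (Category.id_comp (𝟙 y)) (Category.id_comp (𝟙 y)) (hcomp J.counit C.counit)
    (leftHom (idPro y))

theorem Conjoint.sq_unit_counit {f : x ⟶ y} (J : Conjoint f) :
    sq J.unit ≫ sq J.counit = sq (hid f) := by
  rw [← J.comp_eq, sq_compCell]

theorem Companion.adj_left_triangle {f : x ⟶ y} (C : Companion f) (J : Conjoint f) :
    ghcomp (C.adjUnit J) (𝟙 C.pro) ≫ (assocIso C.pro J.pro C.pro).hom ≫
      ghcomp (𝟙 C.pro) (C.adjCounit J) = (leftIso C.pro).hom ≫ (rightIso C.pro).inv := by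
  -- The zigzag contains `J.unit` followed by `J.counit`, an identity cell; what remains is the
  -- external composite of `C.unit` and `C.counit`.
  apply sq_injective (f := 𝟙 x) (g := 𝟙 y)
  let η : Cell (𝟙 x) (idPro x) (compPro C.pro J.pro) (𝟙 x) := C.adjUnit J
  let κ : Cell (𝟙 y) (compPro J.pro C.pro) (idPro y) (𝟙 y) := C.adjCounit J
  have hη : sq η = sq (leftInv (idPro x)) ≫ sq (hcomp C.unit J.unit) := sq_compCell _ _ _ _
  have hκ : sq κ = sq (hcomp J.counit C.counit) ≫ sq (leftHom (idPro y)) := sq_compCell _ _ _ _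
  have e₁ : sq (f := 𝟙 x) (g := 𝟙 y) (ghcomp (C.adjUnit J) (𝟙 C.pro) ≫
      (assocIso C.pro J.pro C.pro).hom ≫ ghcomp (𝟙 C.pro) (C.adjCounit J)) =
      sq (hcomp η (idCell C.pro)) ≫ sq (assocHom C.pro J.pro C.pro) ≫
        sq (hcomp (idCell C.pro) κ) := by
    rw [sq_comp, sq_comp]; rfl
  have e₂ : sq (f := 𝟙 x) (g := 𝟙 y) ((leftIso C.pro).hom ≫ (rightIso C.pro).inv) =
      sq (leftHom C.pro) ≫ sq (rightInv C.pro) := sq_comp _ _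
  have h₁ := sq_hcomp_comp (α := leftInv (idPro x)) (β := idCell C.pro)
    (α' := hcomp C.unit J.unit) (β' := idCell C.pro) hη.symm (Category.id_comp _)
  have h₂ := sq_hcomp_comp (α := J.unit) (β := idCell C.pro) (α' := J.counit) (β' := C.counit)
    (α'' := hid f) (β'' := C.counit) J.sq_unit_counit (Category.id_comp _)
  have h₃ : sq (hcomp J.unit (idCell C.pro)) ≫ sq κ = sq (leftHom C.pro) ≫ sq C.counit := by
    rw [hκ, reassoc_of% h₂, sq_left_naturality]
  have h₄ := sq_hcomp_comp (α := C.unit) (β := hcomp J.unit (idCell C.pro)) (α' := idCell C.pro)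
    (β' := κ) (α'' := C.unit) (β'' := compCell (Category.id_comp f) (Category.id_comp (𝟙 y))
      (leftHom C.pro) C.counit) (Category.comp_id _) (by rw [h₃, sq_compCell])
  have h₅ := sq_hcomp_comp (α := idCell (idPro x)) (β := leftHom C.pro) (α' := C.unit)
    (β' := C.counit) (α'' := C.unit) (Category.id_comp _)
    (sq_compCell (Category.id_comp f) (Category.id_comp (𝟙 y)) _ _).symm
  have h₆ := sq_hcomp_comp (α := leftInv (idPro x)) (β := idCell C.pro) (α' := rightHom (idPro x))
    (β' := idCell C.pro) (α'' := idCell _) (β'' := idCell _)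
    (by rw [← leftHom_idPro, sq_leftInv_leftHom]; rfl) (Category.id_comp _)
  rw [e₁, e₂, ← h₁, Category.assoc, reassoc_of% sq_assoc_naturality, h₄, ← h₅,
    reassoc_of% sq_triangle, reassoc_of% h₆, sq_hcomp_idCell, Category.id_comp, C.hcomp_eq,
    sq_compCell]

theorem Companion.adj_right_triangle {f : x ⟶ y} (C : Companion f) (J : Conjoint f) :
    ghcomp (𝟙 J.pro) (C.adjUnit J) ≫ (assocIso J.pro C.pro J.pro).inv ≫
      ghcomp (C.adjCounit J) (𝟙 J.pro) = (rightIso J.pro).hom ≫ (leftIso J.pro).inv := by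
  -- Here `C.unit` and `C.counit` cancel, leaving the external composite of `J.counit` and `J.unit`.
  apply sq_injective (f := 𝟙 y) (g := 𝟙 x)
  let η : Cell (𝟙 x) (idPro x) (compPro C.pro J.pro) (𝟙 x) := C.adjUnit J
  let κ : Cell (𝟙 y) (compPro J.pro C.pro) (idPro y) (𝟙 y) := C.adjCounit J
  have hη : sq η = sq (leftInv (idPro x)) ≫ sq (hcomp C.unit J.unit) := sq_compCell _ _ _ _
  have hκ : sq (hcomp J.counit C.counit) ≫ sq (rightHom (idPro y)) = sq κ := by
    rw [← leftHom_idPro]; exact (sq_compCell _ _ _ _).symm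
  have e₁ : sq (f := 𝟙 y) (g := 𝟙 x) (ghcomp (𝟙 J.pro) (C.adjUnit J) ≫
      (assocIso J.pro C.pro J.pro).inv ≫ ghcomp (C.adjCounit J) (𝟙 J.pro)) =
      sq (hcomp (idCell J.pro) η) ≫ sq (assocInv J.pro C.pro J.pro) ≫
        sq (hcomp κ (idCell J.pro)) := by
    rw [sq_comp, sq_comp]; rfl
  have e₂ : sq (f := 𝟙 y) (g := 𝟙 x) ((rightIso J.pro).hom ≫ (leftIso J.pro).inv) =
      sq (rightHom J.pro) ≫ sq (leftInv J.pro) := sq_comp _ _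
  have h₁ := sq_hcomp_comp (α := hcomp J.counit C.counit) (β := idCell J.pro)
    (α' := rightHom (idPro y)) (β' := idCell J.pro) hκ (Category.id_comp _)
  have h₂ : sq (hcomp C.unit J.unit) ≫ sq (resCell C.counit J.pro) =
      sq (leftHom (idPro x)) ≫ sq J.unit := by
    have h := sq_hcomp_comp (α := C.unit) (β := J.unit) (α' := C.counit) (β' := idCell J.pro)
      C.sq_unit_counit (Category.comp_id (sq J.unit))
    rw [sq_resCell, reassoc_of% h, sq_left_naturality]
  have h₃ : sq η ≫ sq (resCell C.counit J.pro) = sq J.unit := by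
    rw [hη, Category.assoc, h₂, reassoc_of% sq_leftInv_leftHom]
  have h₄ := sq_hcomp_comp (α := idCell J.pro) (β := η) (α' := J.counit)
    (β' := resCell C.counit J.pro) (α'' := J.counit) (β'' := J.unit) (Category.id_comp _) h₃
  rw [e₁, e₂, ← h₁, sq_assocInv_hcomp_resCell, h₄, J.hcomp_eq, sq_compCell]

/-- The companion of an arrow is left adjoint to its conjoint. -/
def Companion.adjunction {f : x ⟶ y} (C : Companion f) (J : Conjoint f) :
    Bicategory.Adjunction (B := UnderlyingBicategory D) (a := ⟨x⟩) (b := ⟨y⟩) C.pro J.pro where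
  unit := C.adjUnit J
  counit := C.adjCounit J
  left_triangle := (leftZigzag_eq _ _).trans (C.adj_left_triangle J)
  right_triangle := (rightZigzag_eq _ _).trans (C.adj_right_triangle J)

end Conjoints

/-! ### Cartesian equipments -/

section Cartesian

variable {D : Type u} [DoubleCategory.{c, w, v, u} D]

/-- Companions in a product of double categories. -/
def Companion.prod {x y : D × D} {f : x ⟶ y} (C : Companion f.1) (C' : Companion f.2) :
    Companion f where
  pro := (C.pro, C'.pro)
  unit := (C.unit, C'.unit)
  counit := (C.counit, C'.counit)
  hcomp_eq := Prod.ext C.hcomp_eq C'.hcomp_eq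
  comp_eq := Prod.ext C.comp_eq C'.comp_eq

/-- Conjoints in a product of double categories. -/
def Conjoint.prod {x y : D × D} {f : x ⟶ y} (J : Conjoint f.1) (J' : Conjoint f.2) :
    Conjoint f where
  pro := (J.pro, J'.pro)
  unit := (J.unit, J'.unit)
  counit := (J.counit, J'.counit)
  hcomp_eq := Prod.ext J.hcomp_eq J'.hcomp_eq
  comp_eq := Prod.ext J.comp_eq J'.comp_eq

/-- Companions in the terminal double category. -/
def Companion.terminal {x y : Discrete PUnit.{1}} (f : x ⟶ y) : Companion f where
  pro := ⟨⟩
  unit := ⟨⟩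
  counit := ⟨⟩
  hcomp_eq := rfl
  comp_eq := rfl

/-- The action of the diagonal on globular cells. -/
def diagGlobAction (D : Type u) [DoubleCategory.{c, w, v, u} D] :
    (diagDouble D).GlobAction where
  map α := (α, α)
  map_eq _ := (castCell_rfl (D := D × D) (x := (_, _)) (y := (_, _)) _).symm

/-- The action of a double functor on globular cells. -/
def globAction {D : Type u₁} [DoubleCategory.{c₁, w₁, v₁, u₁} D]
    {E : Type u₂} [DoubleCategory.{c₂, w₂, v₂, u₂} E] (F : DoubleFunctor D E) : F.GlobAction where
  map := F.mapGlob
  map_eq _ := rfl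

/-- The tensor product pseudofunctor, with source the product of the underlying bicategory with
itself rather than the underlying bicategory of the product. -/
def tensorPseudo (P : DoubleFunctor (D × D) D) :
    (UnderlyingBicategory D × UnderlyingBicategory D) ⥤ᵖ UnderlyingBicategory D where
  obj x := ⟨P.obj (x.1.as, x.2.as)⟩
  map {x y} m := P.mapPro (x := (x.1.as, x.2.as)) (y := (y.1.as, y.2.as)) m
  map₂ {x y m n} α := P.mapGlob (x := (x.1.as, x.2.as)) (y := (y.1.as, y.2.as)) (m := m) (n := n) α
  map₂_id {x y} m := (P.underlying (globAction P)).map₂_id (a := ⟨(x.1.as, x.2.as)⟩)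
    (b := ⟨(y.1.as, y.2.as)⟩) m
  map₂_comp {x y m n p} α β := (P.underlying (globAction P)).map₂_comp (a := ⟨(x.1.as, x.2.as)⟩)
    (b := ⟨(y.1.as, y.2.as)⟩) (f := m) (g := n) (h := p) α β
  mapId x := (P.underlying (globAction P)).mapId ⟨(x.1.as, x.2.as)⟩
  mapComp {x y z} m n := (P.underlying (globAction P)).mapComp (a := ⟨(x.1.as, x.2.as)⟩)
    (b := ⟨(y.1.as, y.2.as)⟩) (c := ⟨(z.1.as, z.2.as)⟩) m n
  map₂_whisker_left {x y z} m n n' β := (P.underlying (globAction P)).map₂_whisker_left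
    (a := ⟨(x.1.as, x.2.as)⟩) (b := ⟨(y.1.as, y.2.as)⟩) (c := ⟨(z.1.as, z.2.as)⟩) m
    (g := n) (h := n') β
  map₂_whisker_right {x y z m m'} β n := (P.underlying (globAction P)).map₂_whisker_right
    (a := ⟨(x.1.as, x.2.as)⟩) (b := ⟨(y.1.as, y.2.as)⟩) (c := ⟨(z.1.as, z.2.as)⟩)
    (f := m) (g := m') β n
  map₂_associator {x y z t} m n p := (P.underlying (globAction P)).map₂_associator
    (a := ⟨(x.1.as, x.2.as)⟩) (b := ⟨(y.1.as, y.2.as)⟩) (c := ⟨(z.1.as, z.2.as)⟩)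
    (d := ⟨(t.1.as, t.2.as)⟩) m n p
  map₂_left_unitor {x y} m := (P.underlying (globAction P)).map₂_left_unitor
    (a := ⟨(x.1.as, x.2.as)⟩) (b := ⟨(y.1.as, y.2.as)⟩) m
  map₂_right_unitor {x y} m := (P.underlying (globAction P)).map₂_right_unitor
    (a := ⟨(x.1.as, x.2.as)⟩) (b := ⟨(y.1.as, y.2.as)⟩) m

/-- The unit object pseudofunctor. -/
def unitPseudo (T : DoubleFunctor (Discrete PUnit.{1}) D) :
    TerminalBicat ⥤ᵖ UnderlyingBicategory D where
  obj _ := ⟨T.obj ⟨⟨⟩⟩⟩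
  map _ := T.mapPro (x := ⟨⟨⟩⟩) (y := ⟨⟨⟩⟩) ⟨⟩
  map₂ _ := T.mapGlob (x := ⟨⟨⟩⟩) (y := ⟨⟨⟩⟩) (m := ⟨⟩) (n := ⟨⟩) ⟨⟩
  map₂_id _ := (T.underlying (globAction T)).map₂_id (a := ⟨⟨⟨⟩⟩⟩) (b := ⟨⟨⟨⟩⟩⟩) ⟨⟩
  map₂_comp _ _ := (T.underlying (globAction T)).map₂_comp (a := ⟨⟨⟨⟩⟩⟩) (b := ⟨⟨⟨⟩⟩⟩)
    (f := ⟨⟩) (g := ⟨⟩) (h := ⟨⟩) ⟨⟩ ⟨⟩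
  mapId _ := (T.underlying (globAction T)).mapId ⟨⟨⟨⟩⟩⟩
  mapComp _ _ := (T.underlying (globAction T)).mapComp (a := ⟨⟨⟨⟩⟩⟩) (b := ⟨⟨⟨⟩⟩⟩)
    (c := ⟨⟨⟨⟩⟩⟩) ⟨⟩ ⟨⟩
  map₂_whisker_left _ _ _ _ := (T.underlying (globAction T)).map₂_whisker_left
    (a := ⟨⟨⟨⟩⟩⟩) (b := ⟨⟨⟨⟩⟩⟩) (c := ⟨⟨⟨⟩⟩⟩) ⟨⟩ (g := ⟨⟩) (h := ⟨⟩) ⟨⟩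
  map₂_whisker_right _ _ := (T.underlying (globAction T)).map₂_whisker_right
    (a := ⟨⟨⟨⟩⟩⟩) (b := ⟨⟨⟨⟩⟩⟩) (c := ⟨⟨⟨⟩⟩⟩) (f := ⟨⟩) (g := ⟨⟩) ⟨⟩ ⟨⟩
  map₂_associator _ _ _ := (T.underlying (globAction T)).map₂_associator
    (a := ⟨⟨⟨⟩⟩⟩) (b := ⟨⟨⟨⟩⟩⟩) (c := ⟨⟨⟨⟩⟩⟩) (d := ⟨⟨⟨⟩⟩⟩) ⟨⟩ ⟨⟩ ⟨⟩
  map₂_left_unitor _ := (T.underlying (globAction T)).map₂_left_unitor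
    (a := ⟨⟨⟨⟩⟩⟩) (b := ⟨⟨⟨⟩⟩⟩) ⟨⟩
  map₂_right_unitor _ := (T.underlying (globAction T)).map₂_right_unitor
    (a := ⟨⟨⟨⟩⟩⟩) (b := ⟨⟨⟨⟩⟩⟩) ⟨⟩

end Cartesian

/-! ### Transfer to products and to the terminal bicategory -/

section Transfer

variable {D : Type u} [DoubleCategory.{c, w, v, u} D]

open scoped Oplax.OplaxTrans in
/-- The underlying bicategory of `D × D` agrees definitionally with the product of the underlying
bicategory of `D` with itself, up to repackaging of objects; a lax adjunction with the diagonal is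
transferred along this identification. -/
def LaxAdjunction.ofDiag {P : DoubleFunctor (D × D) D}
    (L : LaxAdjunction ((diagDouble D).underlying (diagGlobAction D))
      (P.underlying (globAction P))) :
    LaxAdjunction (diagBicat (UnderlyingBicategory D)) (tensorPseudo P) where
  unit :=
    { app x := L.unit.app x
      naturality m := L.unit.naturality m
      naturality_naturality β := L.unit.naturality_naturality β
      naturality_id x := L.unit.naturality_id x
      naturality_comp m n := L.unit.naturality_comp m n }
  counit :=
    { app x := L.counit.app ⟨(x.1.as, x.2.as)⟩
      naturality {x y} m := L.counit.naturality (a := ⟨(x.1.as, x.2.as)⟩)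
        (b := ⟨(y.1.as, y.2.as)⟩) m
      naturality_naturality {x y m n} β := L.counit.naturality_naturality
        (a := ⟨(x.1.as, x.2.as)⟩) (b := ⟨(y.1.as, y.2.as)⟩) (f := m) (g := n) β
      naturality_id x := L.counit.naturality_id ⟨(x.1.as, x.2.as)⟩
      naturality_comp {x y z} m n := L.counit.naturality_comp (a := ⟨(x.1.as, x.2.as)⟩)
        (b := ⟨(y.1.as, y.2.as)⟩) (c := ⟨(z.1.as, z.2.as)⟩) m n }
  s :=
    { hom := ⟨⟨fun x => L.s.hom.as.app x, fun m => L.s.hom.as.naturality m⟩⟩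
      inv := ⟨⟨fun x => L.s.inv.as.app x, fun m => L.s.inv.as.naturality m⟩⟩
      hom_inv_id := Oplax.OplaxTrans.homCategory.ext fun x =>
        congrArg (fun Γ => Γ.as.app x) L.s.hom_inv_id
      inv_hom_id := Oplax.OplaxTrans.homCategory.ext fun x =>
        congrArg (fun Γ => Γ.as.app x) L.s.inv_hom_id }
  t :=
    { hom := ⟨⟨fun x => L.t.hom.as.app ⟨(x.1.as, x.2.as)⟩, fun {x y} m =>
        L.t.hom.as.naturality (a := ⟨(x.1.as, x.2.as)⟩) (b := ⟨(y.1.as, y.2.as)⟩) m⟩⟩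
      inv := ⟨⟨fun x => L.t.inv.as.app ⟨(x.1.as, x.2.as)⟩, fun {x y} m =>
        L.t.inv.as.naturality (a := ⟨(x.1.as, x.2.as)⟩) (b := ⟨(y.1.as, y.2.as)⟩) m⟩⟩
      hom_inv_id := Oplax.OplaxTrans.homCategory.ext fun x =>
        congrArg (fun Γ => Γ.as.app ⟨(x.1.as, x.2.as)⟩) L.t.hom_inv_id
      inv_hom_id := Oplax.OplaxTrans.homCategory.ext fun x =>
        congrArg (fun Γ => Γ.as.app ⟨(x.1.as, x.2.as)⟩) L.t.inv_hom_id }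
  swallowtail_unit x := L.swallowtail_unit x
  swallowtail_counit x := L.swallowtail_counit ⟨(x.1.as, x.2.as)⟩

open scoped Oplax.OplaxTrans in
/-- A lax adjunction with the unique double functor to the terminal double category is transferred
to the terminal bicategory. Its counit and left triangulator take values in a bicategory all of
whose hom-categories are trivial. -/
def LaxAdjunction.ofBang {T : DoubleFunctor (Discrete PUnit.{1}) D}
    (L : LaxAdjunction ((bangDouble D).underlying (globAction (bangDouble D)))
      (T.underlying (globAction T))) :
    LaxAdjunction (bangBicat (UnderlyingBicategory D)) (unitPseudo T) where
  unit :=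
    { app x := L.unit.app x
      naturality m := L.unit.naturality m
      naturality_naturality β := L.unit.naturality_naturality β
      naturality_id x := L.unit.naturality_id x
      naturality_comp m n := L.unit.naturality_comp m n }
  counit :=
    { app _ := 𝟙 _
      naturality _ := 𝟙 _
      naturality_naturality _ := Subsingleton.elim _ _
      naturality_id _ := Subsingleton.elim _ _
      naturality_comp _ _ := Subsingleton.elim _ _ }
  s :=
    { hom := ⟨⟨fun _ => 𝟙 _, fun _ => Subsingleton.elim _ _⟩⟩
      inv := ⟨⟨fun _ => 𝟙 _, fun _ => Subsingleton.elim _ _⟩⟩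
      hom_inv_id := Oplax.OplaxTrans.homCategory.ext fun _ => Subsingleton.elim _ _
      inv_hom_id := Oplax.OplaxTrans.homCategory.ext fun _ => Subsingleton.elim _ _ }
  t :=
    { hom := ⟨⟨fun _ => L.t.hom.as.app ⟨⟨⟨⟩⟩⟩, fun _ =>
        L.t.hom.as.naturality (a := ⟨⟨⟨⟩⟩⟩) (b := ⟨⟨⟨⟩⟩⟩) ⟨⟩⟩⟩
      inv := ⟨⟨fun _ => L.t.inv.as.app ⟨⟨⟨⟩⟩⟩, fun _ =>
        L.t.inv.as.naturality (a := ⟨⟨⟨⟩⟩⟩) (b := ⟨⟨⟨⟩⟩⟩) ⟨⟩⟩⟩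
      hom_inv_id := Oplax.OplaxTrans.homCategory.ext fun _ =>
        congrArg (fun Γ => Γ.as.app ⟨⟨⟨⟩⟩⟩) L.t.hom_inv_id
      inv_hom_id := Oplax.OplaxTrans.homCategory.ext fun _ =>
        congrArg (fun Γ => Γ.as.app ⟨⟨⟨⟩⟩⟩) L.t.inv_hom_id }
  swallowtail_unit x := L.swallowtail_unit x
  swallowtail_counit _ := Subsingleton.elim _ _

/-- A left adjoint in the underlying bicategory of `D × D` is a map of the product bicategory. The
zigzags involve coherence isomorphisms computed in the two bicategories separately, and are compared
through their expressions by associators. -/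
theorem isMap_prod {x y : D × D} {f g}
    (h : Bicategory.Adjunction (B := UnderlyingBicategory (D × D)) (a := ⟨x⟩) (b := ⟨y⟩) f g) :
    IsMap (B := UnderlyingBicategory D × UnderlyingBicategory D)
      (x := (⟨x.1⟩, ⟨x.2⟩)) (y := (⟨y.1⟩, ⟨y.2⟩)) f :=
  IsLeftAdjoint.mk (g := g)
    { unit := h.unit
      counit := h.counit
      left_triangle := (leftZigzag_eq _ _).trans ((leftZigzag_eq _ _).symm.trans h.left_triangle)
      right_triangle :=
        (rightZigzag_eq _ _).trans ((rightZigzag_eq _ _).symm.trans h.right_triangle) }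

end Transfer

end CartEquip

theorem mainTheorem2 {D : Type u} [CartEquip.DoubleCategory.{c, w, v, u} D]
    (hD : CartEquip.IsCartesianEquipment D) :
    CartEquip.IsCartesianBicategory (CartEquip.UnderlyingBicategory D) := by
  obtain ⟨⟨hC, hJ⟩, ⟨P, ⟨adjP⟩⟩, T, ⟨adjT⟩⟩ := hD
  let C {x y : D} (f : x ⟶ y) : CartEquip.Companion f := (hC f).some
  let J {x y : D} (f : x ⟶ y) : CartEquip.Conjoint f := (hJ f).some
  let C' (x : D × D) : CartEquip.Companion (adjP.counit.app x) := .prod (C _) (C _)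
  exact ⟨{
    tensor := CartEquip.tensorPseudo P
    unit := CartEquip.unitPseudo T
    tensorAdj := (adjP.laxAdjunction _ _ (fun x => C (adjP.unit.app x)) C').ofDiag
    unitAdj := (adjT.laxAdjunction _ _ (fun x => C (adjT.unit.app x))
      fun x => .terminal (adjT.counit.app x)).ofBang
    isMap_diag := fun x => IsLeftAdjoint.mk ((C (adjP.unit.app x.as)).adjunction (J _))
    isMap_proj := fun x => CartEquip.isMap_prod
      ((C' (x.1.as, x.2.as)).adjunction (.prod (J _) (J _)))
    isMap_del := fun x => IsLeftAdjoint.mk ((C (adjT.unit.app x.as)).adjunction (J _)) }⟩
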